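/- Let $G$ be a finite group. **2-representations.** A *2-Hilbert space* is an abelian category $H$ enriched in finite-dimensional Hilbert spaces (inner products antilinear in the first variable), with antilinear maps $*\colon \operatorname{Hom}(x,y)\to\operatorname{Hom}(y,x)$ satisfying $f^{**}=f$, $(fg)^*=g^*f^*$, $(fg,h)=(g,f^*h)$ and $(fg,h)=(f,hg^*)$. A morphism $u$ is *unitary* if $u^*u=1$ and $uu^*=1$. A *unitary 2-representation* $\alpha$ of $G$ consists of a 2-Hilbert space $H_\alpha$ with finitely many isomorphism classes of simple objects, linear $*$-functors $\alpha_g\colon H_\alpha\to H_\alpha$ ($g\in G$) that are unitary on hom-spaces, and unitary natural isomorphisms $\phi(e)\colon\mathrm{id}\Rightarrow\alpha_e$ and $\phi(g_2,g_1)\colon\alpha_{g_2}\alpha_{g_1}\Rightarrow\alpha_{g_2g_1}$ satisfying the unit and associativity laws. It is *marked* if a representative $e_i$ has been chosen in each isomorphism class $i$ of simple objects; put $k_i=(\mathrm{id}_{e_i},\mathrm{id}_{e_i})$. A morphism $\sigma\colon\alpha\to\beta$ is a linear $*$-functor $\sigma\colon H_\alpha\to H_\beta$ with coherent unitary natural isomorphisms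 $\sigma(g)\colon\beta_g\sigma\Rightarrow\sigma\alpha_g$ (the choice of markings is ignored); a 2-morphism is a natural transformation compatible with the $\sigma(g)$. $[2\mathcal{R}ep_m(G)]$ is the category of marked unitary 2-representations and isomorphism classes of morphisms. **Bundles.** $\Lambda G$ is the groupoid with objects $x\in G$ and arrows $g\colon x\to gxg^{-1}$. $\mathrm{Hilb}_G(G)$ is the category of functors from $\Lambda G$ to finite-dimensional Hilbert spaces which send arrows to unitary maps; its morphisms are all natural families of linear maps. **The 2-character.** $\chi_\alpha\in\mathrm{Hilb}_G(G)$ has fibres $\chi_\alpha(x)=\operatorname{Nat}(\mathrm{id},\alpha_x)$ with $\langle\theta,\theta'\rangle=\sum_i k_i(\theta_{e_i},\theta'_{e_i})$, and $g\colon x\to gxg^{-1}$ sends $\theta$ to the transformation with component at $z$ $$\phi(gx,g^{-1})_z\,\phi(g,x)_{\alpha_{g^{-1}}z}\,\alpha_g(\theta_{\alpha_{g^{-1}}z})\,\phi(g,g^{-1})_z^*\,\phi(e)_z .$$ An *even-handed adjoint* of $\sigma$ is a linear $*$-functor $\sigma^*\colon H_\beta\to H_\alpha$ with adjunctions $\sigma\dashv\sigma^*$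 and $\sigma^*\dashv\sigma$ whose isomorphisms $\varphi\colon\operatorname{Hom}(\sigma x,y)\to\operatorname{Hom}(x,\sigma^*y)$ and $\psi\colon\operatorname{Hom}(\sigma^*y,x)\to\operatorname{Hom}(y,\sigma x)$ satisfy $\psi(f)=(\varphi^\dagger(f^*))^*$, where $\varphi^\dagger$ is the Hilbert space adjoint of $\varphi$. With $n\colon\mathrm{id}\Rightarrow\sigma\sigma^*$ the unit of $\sigma^*\dashv\sigma$ and $\epsilon\colon\sigma\sigma^*\Rightarrow\mathrm{id}$ the counit of $\sigma\dashv\sigma^*$, put $$\bigl(\chi(\sigma)_x\theta\bigr)_y=\beta_x(\epsilon_y)\circ\bigl(\sigma(x)_{\sigma^*y}\bigr)^*\circ\sigma(\theta_{\sigma^*y})\circ n_y .$$ **Gerbes.** A *finite $G$-equivariant gerbe with metric* $\mathfrak X$ is a central extension by $U(1)$ of the action groupoid of a finite $G$-set $X$, with an invariant function $k\colon X\to\mathbb R_{>0}$. Thus its arrows $i\to j$ over $g\in G$ form a $U(1)$-torsor if $gi=j$ and do not exist otherwise. $\overline{\mathfrak X}$ is the same groupoid with the conjugate $U(1)$; $\mathfrak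 X'\otimes\mathfrak X$ has objects the pairs, arrows $v\otimes u$ for $v,u$ over the same $g$ with $zv\otimes u=v\otimes zu$, and metric $k_\mu k_i$. A 1-morphism $E\colon\mathfrak X\to\mathfrak X'$ is a functor from $\mathfrak X'\otimes\overline{\mathfrak X}$ to finite-dimensional Hilbert spaces and unitary maps on which $U(1)$ acts by scalars. Composition is $(E'\circ E)_{\kappa,i}=\bigoplus_\mu k_\mu\,E'_{\kappa,\mu}\otimes E_{\mu,i}$ (inner product on the summand $\mu$ multiplied by $k_\mu$), where $v\otimes u$ over $g$ acts on the summand $\mu$ by $E'(v\otimes p)\otimes E(p\otimes u)$ for any arrow $p\colon\mu\to g\mu$ over $g$. $[\mathcal{G}erbes(G)]$ is the category of gerbes with metric and isomorphism classes of 1-morphisms; the identity of $\mathfrak X$ is the class of the bundle whose fibre at $(i,j)$ is zero for $i\ne j$ and is the hermitian line associated to the torsor of arrows $b\colon i\to i$ over $e\in G$ for $i=j$, with $v\otimes u$ acting by $b\otimes c\mapsto vbu^{-1}\otimes c$. **The geometric character.** The transgressed line bundle $\tau(\mathfrak X)_{\mathbb C}$ has, over each pair $(i,x)$ with $xi=i$,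 the hermitian line $(P\times\mathbb C)/U(1)$ of the torsor $P$ of arrows $i\to i$ over $x$ (with $zu\otimes c=u\otimes zc$, and $|u\otimes c|=|c|$); $g$ acts by $u\otimes c\mapsto vuv^{-1}\otimes c$ for any arrow $v\colon i\to gi$ over $g$. The geometric character $\mathrm{ch}(\mathfrak X)\in\mathrm{Hilb}_G(G)$ is its push-forward to $\Lambda G$: the fibre at $x$ is the space of sections $\psi$ over $\{i: xi=i\}$ with $\langle\psi,\psi'\rangle=\sum_i k_i(\psi(i),\psi'(i))$, and $(g\psi)(gi)=g\cdot\psi(i)$. For $E\colon\mathfrak X\to\mathfrak X'$, the map $\mathrm{ch}(E)_x$ has the matrix elements $$\langle\psi'_\mu,\mathrm{ch}(E)_x\psi_i\rangle=\overline{\operatorname{Tr}E(u'\otimes u)},$$ where $xi=i$, $x\mu=\mu$, $u\colon i\to i$ and $u'\colon\mu\to\mu$ are arrows over $x$, $\psi_i$ is the section supported at $i$ with value $u\otimes k_i^{-1/2}$, and $\psi'_\mu$ is the section supported at $\mu$ with value $u'\otimes k_\mu^{-1/2}$. **The associated gerbe.** The gerbe $\mathfrak X_\alpha$ of a marked unitary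 2-representation has as objects the isomorphism classes $i$ of simple objects, with $gi=[\alpha_g(e_i)]$ and metric $k_i$; the arrows over $g$ from $i$ to $gi$ are the unitary maps $v\colon e_{gi}\to\alpha_g(e_i)$, the composite of $v$ with a later $v'$ over $g'$ is $\phi(g',g)_{e_i}\,\alpha_{g'}(v)\,v'$, and the identity of $i$ is $\phi(e)_{e_i}$. A morphism $\sigma\colon\alpha\to\beta$ gives $\langle\sigma\rangle\colon\mathfrak X_\alpha\to\mathfrak X_\beta$ with $\langle\sigma\rangle_{\mu,i}=\operatorname{Hom}(e_\mu,\sigma(e_i))$, on which $v\otimes u$ over $g$ acts by $\lambda\mapsto\sigma(u)^*\,\sigma(g)_{e_i}\,\beta_g(\lambda)\,v$. **Theorem.** Every $\sigma$ has an even-handed adjoint, $\chi(\sigma)$ does not depend on which one is used, and $\chi$, $\langle\cdot\rangle$ and $\mathrm{ch}$, as given above on objects and morphisms, are well-defined functors $$\chi\colon[2\mathcal{R}ep_m(G)]\to\mathrm{Hilb}_G(G),\qquad \langle\cdot\rangle\colon[2\mathcal{R}ep_m(G)]\to[\mathcal{G}erbes(G)],\qquad \mathrm{ch}\colon[\mathcal{G}erbes(G)]\to\mathrm{Hilb}_G(G).$$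 Moreover there are unitary isomorphisms $\gamma_\alpha\colon\chi_\alpha\to\mathrm{ch}(\mathfrak X_\alpha)$ in $\mathrm{Hilb}_G(G)$, natural in $\alpha\in[2\mathcal{R}ep_m(G)]$. That is, $\chi\cong\mathrm{ch}\circ\langle\cdot\rangle$ by a unitary natural isomorphism. -/

import Mathlib

open CategoryTheory CategoryTheory.Limits TensorProduct

universe v u w

noncomputable section

/-- A 2-Hilbert space: an abelian category enriched in finite-dimensional Hilbert spaces, with
antilinear maps `dag : Hom(X, Y) → Hom(Y, X)` such that `f** = f`, `(f g)* = g* f*`,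
`(f g, h) = (g, f* h)` and `(f g, h) = (f, h g*)`.  Inner products are antilinear in the first
variable.  (In Lean `g ≫ f` is the composite `f g`.) -/
class TwoHilbert (H : Type u) [Category.{v} H] [Abelian H] [Linear ℂ H] where
  finDim : ∀ X Y : H, FiniteDimensional ℂ (X ⟶ Y)
  core : ∀ X Y : H, InnerProductSpace.Core ℂ (X ⟶ Y)
  dag : ∀ {X Y : H}, (X ⟶ Y) → (Y ⟶ X)
  dag_add : ∀ {X Y : H} (f g : X ⟶ Y), dag (f + g) = dag f + dag g
  dag_smul : ∀ {X Y : H} (c : ℂ) (f : X ⟶ Y), dag (c • f) = (starRingEnd ℂ c) • dag f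
  dag_dag : ∀ {X Y : H} (f : X ⟶ Y), dag (dag f) = f
  dag_comp : ∀ {X Y Z : H} (g : X ⟶ Y) (f : Y ⟶ Z), dag (g ≫ f) = dag f ≫ dag g
  inner_comp_left : ∀ {X Y Z : H} (g : X ⟶ Y) (f : Y ⟶ Z) (h : X ⟶ Z),
    (core X Z).inner (g ≫ f) h = (core X Y).inner g (h ≫ dag f)
  inner_comp_right : ∀ {X Y Z : H} (g : X ⟶ Y) (f : Y ⟶ Z) (h : X ⟶ Z),
    (core X Z).inner (g ≫ f) h = (core Y Z).inner f (dag g ≫ h)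

namespace TwoHilbert

variable {H : Type u} [Category.{v} H] [Abelian H] [Linear ℂ H] [TwoHilbert H]

/-- The inner product on a hom-space. -/
def ip {X Y : H} (f g : X ⟶ Y) : ℂ := (core X Y).inner f g

/-- A morphism `u` is unitary if `u* u = 1` and `u u* = 1`. -/
def IsUnitary {X Y : H} (f : X ⟶ Y) : Prop := f ≫ dag f = 𝟙 X ∧ dag f ≫ f = 𝟙 Y

/-- The scale factor `(id, id)` of an object. -/
def scale (X : H) : ℝ := (ip (𝟙 X) (𝟙 X)).re

/-! Elementary facts. -/

theorem ip_add_left {X Y : H} (f g h : X ⟶ Y) : ip (f + g) h = ip f h + ip g h :=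
  (core X Y).add_left f g h

theorem ip_smul_left {X Y : H} (c : ℂ) (f h : X ⟶ Y) :
    ip (c • f) h = (starRingEnd ℂ c) * ip f h :=
  (core X Y).smul_left f h c

theorem ip_conj {X Y : H} (f g : X ⟶ Y) : (starRingEnd ℂ) (ip g f) = ip f g :=
  (core X Y).conj_inner_symm f g

theorem ip_smul_right {X Y : H} (c : ℂ) (f h : X ⟶ Y) : ip f (c • h) = c * ip f h := by
  rw [← ip_conj, ip_smul_left, map_mul, Complex.conj_conj, ip_conj]

theorem ip_self_nonneg {X Y : H} (f : X ⟶ Y) : 0 ≤ (ip f f).re :=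
  (core X Y).re_inner_nonneg f

theorem ip_self_im {X Y : H} (f : X ⟶ Y) : (ip f f).im = 0 :=
  Complex.conj_eq_iff_im.1 (ip_conj f f)

theorem eq_zero_of_ip_self {X Y : H} (f : X ⟶ Y) (h : ip f f = 0) : f = 0 :=
  (core X Y).definite f h

theorem ip_self_re_pos {X Y : H} (f : X ⟶ Y) (h : f ≠ 0) : 0 < (ip f f).re := by
  refine lt_of_le_of_ne (ip_self_nonneg f) fun h0 => h (eq_zero_of_ip_self f ?_)
  exact Complex.ext h0.symm (ip_self_im f)

theorem ip_comp_left {X Y Z : H} (g : X ⟶ Y) (f : Y ⟶ Z) (h : X ⟶ Z) :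
    ip (g ≫ f) h = ip g (h ≫ dag f) := inner_comp_left g f h

theorem ip_comp_right {X Y Z : H} (g : X ⟶ Y) (f : Y ⟶ Z) (h : X ⟶ Z) :
    ip (g ≫ f) h = ip f (dag g ≫ h) := inner_comp_right g f h

theorem dag_id (X : H) : dag (𝟙 X) = 𝟙 X := by
  have h := dag_comp (dag (𝟙 X)) (𝟙 X)
  rw [Category.comp_id, dag_dag, Category.comp_id] at h
  exact h.symm

theorem dag_zero (X Y : H) : dag (0 : X ⟶ Y) = 0 := by
  simpa using dag_smul (0 : ℂ) (0 : X ⟶ Y)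

theorem IsUnitary.id (X : H) : IsUnitary (𝟙 X) := by
  simp [IsUnitary, dag_id]

theorem IsUnitary.dag {X Y : H} {f : X ⟶ Y} (h : IsUnitary f) :
    IsUnitary (TwoHilbert.dag f) := by
  simpa [IsUnitary, dag_dag, and_comm] using h

theorem IsUnitary.comp {X Y Z : H} {f : X ⟶ Y} {g : Y ⟶ Z} (hf : IsUnitary f)
    (hg : IsUnitary g) : IsUnitary (f ≫ g) := by
  constructor
  · rw [dag_comp, Category.assoc, reassoc_of% hg.1, hf.1]
  · rw [dag_comp, Category.assoc, reassoc_of% hf.2, hg.2]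

theorem IsUnitary.smul {X Y : H} {f : X ⟶ Y} (hf : IsUnitary f) (z : Circle) :
    IsUnitary ((z : ℂ) • f) := by
  have hz : (z : ℂ) * (starRingEnd ℂ) (z : ℂ) = 1 := by
    rw [Complex.mul_conj, Circle.normSq_coe]; simp
  constructor
  · rw [dag_smul, Linear.comp_smul, Linear.smul_comp, smul_smul, mul_comm, hz, hf.1, one_smul]
  · rw [dag_smul, Linear.comp_smul, Linear.smul_comp, smul_smul, hz, hf.2, one_smul]

/-- A unitary morphism as an isomorphism. -/
def IsUnitary.iso {X Y : H} {f : X ⟶ Y} (h : IsUnitary f) : X ≅ Y :=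
  ⟨f, TwoHilbert.dag f, h.1, h.2⟩

theorem IsUnitary.ip_comp_left {X Y Z : H} {f : X ⟶ Y} (hf : IsUnitary f) (g h : Y ⟶ Z) :
    ip (f ≫ g) (f ≫ h) = ip g h := by
  rw [ip_comp_right, reassoc_of% hf.2]

theorem IsUnitary.ip_comp_right {X Y Z : H} {f : Y ⟶ Z} (hf : IsUnitary f) (g h : X ⟶ Y) :
    ip (g ≫ f) (h ≫ f) = ip g h := by
  rw [TwoHilbert.ip_comp_left, Category.assoc, hf.1, Category.comp_id]

theorem scale_eq_of_unitary {X Y : H} {f : X ⟶ Y} (hf : IsUnitary f) : scale X = scale Y := by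
  unfold scale
  rw [← hf.ip_comp_right, ← hf.ip_comp_left (𝟙 Y) (𝟙 Y)]
  simp

theorem scale_pos (X : H) [Simple X] : 0 < scale X :=
  ip_self_re_pos _ (id_nonzero X)

/-- Schur's lemma. -/
theorem schur {X : H} [Simple X] (f : X ⟶ X) : ∃ c : ℂ, f = c • 𝟙 X := by
  have := finDim X X
  obtain ⟨c, hc⟩ := endomorphism_simple_eq_smul_id ℂ f
  exact ⟨c, hc.symm⟩

/-- Isomorphic simple objects are unitarily isomorphic. -/
theorem exists_unitary {X Y : H} [Simple X] (e : X ≅ Y) : ∃ f : X ⟶ Y, IsUnitary f := by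
  obtain ⟨c, hc⟩ := schur (e.hom ≫ dag e.hom)
  have hne : e.hom ≠ 0 := by
    intro h
    apply id_nonzero X
    rw [← e.hom_inv_id, h, zero_comp]
  have h1 : ip e.hom e.hom = c * ip (𝟙 X) (𝟙 X) := by
    have := TwoHilbert.ip_comp_left (𝟙 X) e.hom e.hom
    rw [Category.id_comp, hc, ip_smul_right] at this
    exact this
  have hs := scale_pos X
  have hp := ip_self_re_pos _ hne
  have him := ip_self_im e.hom
  have hsi := ip_self_im (𝟙 X)
  rw [h1, Complex.mul_re, hsi, mul_zero, sub_zero] at hp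
  rw [h1, Complex.mul_im, hsi, mul_zero, zero_add] at him
  have hcr : 0 < c.re := by
    by_contra hneg
    exact absurd hp (not_lt.2 (mul_nonpos_of_nonpos_of_nonneg (not_lt.1 hneg) hs.le))
  have hci : c.im = 0 := by
    rcases mul_eq_zero.1 him with h | h
    · exact h
    · exact absurd h hs.ne'
  have hc' : c = ((c.re : ℝ) : ℂ) := Complex.ext rfl (by simpa using hci)
  set r : ℝ := (Real.sqrt c.re)⁻¹ with hr
  have hrr : (r : ℂ) * ((r : ℂ) * c) = 1 := by
    rw [hc', ← Complex.ofReal_mul, ← Complex.ofReal_mul, ← Complex.ofReal_one]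
    congr 1
    have : Real.sqrt c.re * Real.sqrt c.re = c.re := Real.mul_self_sqrt hcr.le
    have h0 : Real.sqrt c.re ≠ 0 := (Real.sqrt_pos.2 hcr).ne'
    rw [hr]; field_simp; nlinarith
  have hu : ((r : ℂ) • e.hom) ≫ dag ((r : ℂ) • e.hom) = 𝟙 X := by
    rw [dag_smul, Linear.comp_smul, Linear.smul_comp, hc, smul_smul, smul_smul,
      Complex.conj_ofReal, mul_assoc, hrr, one_smul]
  have hr0 : (r : ℂ) ≠ 0 := left_ne_zero_of_mul_eq_one hrr
  refine ⟨(r : ℂ) • e.hom, hu, ?_⟩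
  have : IsIso ((r : ℂ) • e.hom) :=
    ⟨(r : ℂ)⁻¹ • e.inv,
      by rw [Linear.comp_smul, Linear.smul_comp, smul_smul, inv_mul_cancel₀ hr0, one_smul,
        e.hom_inv_id],
      by rw [Linear.comp_smul, Linear.smul_comp, smul_smul, mul_inv_cancel₀ hr0, one_smul,
        e.inv_hom_id]⟩
  rw [← cancel_epi ((r : ℂ) • e.hom), reassoc_of% hu, Category.comp_id]

/-- A 2-Hilbert space is semisimple, in the form: a natural transformation out of the identity is
determined by its components on simple objects. -/
theorem app_eq_zero {F : H ⥤ H} (θ : 𝟭 H ⟶ F)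
    (h : ∀ S : H, Simple S → θ.app S = 0) (X : H) : θ.app X = 0 := by
  suffices ∀ (n : ℕ) (X : H), Module.finrank ℂ (X ⟶ X) ≤ n → θ.app X = 0 from
    this _ X le_rfl
  intro n
  induction n with
  | zero =>
    intro X hX
    have := finDim X X
    have := Module.finrank_zero_iff.1 (Nat.le_zero.1 hX)
    have : 𝟙 X = 0 := Subsingleton.elim _ _
    have h2 : 𝟙 X ≫ θ.app X = 0 := by rw [this]; exact zero_comp
    exact (Category.id_comp _).symm.trans h2
  | succ n ih =>
    intro X hX
    by_cases hS : Simple X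
    · exact h X hS
    by_cases h0 : 𝟙 X = 0
    · have h2 : 𝟙 X ≫ θ.app X = 0 := by rw [h0]; exact zero_comp
      exact (Category.id_comp _).symm.trans h2
    obtain ⟨Y, f, hm, hf⟩ : ∃ (Y : H) (f : Y ⟶ X) (_ : Mono f), ¬ (IsIso f ↔ f ≠ 0) := by
      by_contra hcon
      push Not at hcon
      exact hS ⟨fun {Y} f hm => by
        have := hcon Y f hm
        exact this⟩
    have hiso : ¬ IsIso f := by
      intro hi
      apply hf
      refine ⟨fun _ hz => h0 ?_, fun _ => hi⟩
      exact (IsIso.inv_hom_id f).symm.trans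
        ((congrArg (fun t => inv f ≫ t) hz).trans comp_zero)
    have hf0 : f ≠ 0 := by
      by_contra hz
      exact hf ⟨fun hi => absurd hi hiso, fun hn => absurd hz hn⟩
    -- `f f*` is invertible
    have hpm : Mono (f ≫ dag f) := by
      refine Preadditive.mono_of_cancel_zero _ fun {P} a ha => ?_
      have : ip (a ≫ f) (a ≫ f) = 0 := by
        rw [TwoHilbert.ip_comp_left, Category.assoc, ha]
        simpa using ip_smul_right (0 : ℂ) a (0 : P ⟶ Y)
      have := eq_zero_of_ip_self _ this
      rw [← cancel_mono f, this, zero_comp]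
    have hsd : dag (f ≫ dag f) = f ≫ dag f := by rw [dag_comp, dag_dag]
    have hpe : Epi (f ≫ dag f) := by
      refine Preadditive.epi_of_cancel_zero _ fun {P} a ha => ?_
      have h1 : dag a ≫ (f ≫ dag f) = 0 := by
        rw [← hsd, ← dag_comp, ha, dag_zero]
      have h2 : dag a = 0 := by rw [← cancel_mono (f ≫ dag f), h1, zero_comp]
      rw [← dag_dag a, h2, dag_zero]
    have : IsIso (f ≫ dag f) := isIso_of_mono_of_epi _
    set r : X ⟶ Y := dag f ≫ inv (f ≫ dag f) with hr
    have hfr : f ≫ r = 𝟙 Y := by rw [hr, ← Category.assoc, IsIso.hom_inv_id]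
    set k := kernel.ι (dag f) with hk
    have hkd : k ≫ dag f = 0 := kernel.condition _
    have hl0 : (𝟙 X - r ≫ f) ≫ dag f = 0 := by
      rw [Preadditive.sub_comp, Category.id_comp, Category.assoc, hr, Category.assoc,
        IsIso.inv_hom_id, Category.comp_id, sub_self]
    set l := kernel.lift (dag f) (𝟙 X - r ≫ f) hl0 with hl
    have hlk : l ≫ k = 𝟙 X - r ≫ f := kernel.lift_ι _ _ _
    have hkr : k ≫ r = 0 := by rw [hr, ← Category.assoc, hkd, zero_comp]
    have hkl : k ≫ l = 𝟙 _ := by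
      rw [← cancel_mono k, Category.assoc, hlk, Preadditive.comp_sub, Category.comp_id,
        ← Category.assoc, hkr, zero_comp, sub_zero, Category.id_comp]
    have small : ∀ (Z : H) (i : Z ⟶ X) (p : X ⟶ Z), i ≫ p = 𝟙 Z →
        ¬ (∃ a : Z ⟶ Z, p ≫ a ≫ i = 𝟙 X) → Module.finrank ℂ (Z ⟶ Z) ≤ n := by
      intro Z i p hip hns
      have := finDim X X
      have := finDim Z Z
      let T : (Z ⟶ Z) →ₗ[ℂ] (X ⟶ X) :=
        { toFun := fun a => p ≫ a ≫ i
          map_add' := fun a b => by simp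
          map_smul' := fun c a => by simp }
      have hT : Function.Injective T := by
        intro a b hab
        have hab' : p ≫ a ≫ i = p ≫ b ≫ i := hab
        have := congrArg (fun t => i ≫ t ≫ p) hab'
        simpa [hip, reassoc_of% hip] using this
      have hlt : Module.finrank ℂ (Z ⟶ Z) < Module.finrank ℂ (X ⟶ X) := by
        refine lt_of_le_of_ne (LinearMap.finrank_le_finrank_of_injective hT) fun heq => ?_
        have hs := (LinearMap.injective_iff_surjective_of_finrank_eq_finrank heq).1 hT
        obtain ⟨a, ha⟩ := hs (𝟙 X)
        exact hns ⟨a, ha⟩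
      omega
    have hY : θ.app Y = 0 := by
      refine ih Y (small Y f r hfr ?_)
      rintro ⟨a, ha⟩
      apply hiso
      have : IsSplitEpi f := ⟨⟨⟨r ≫ a, by rw [Category.assoc, ha]⟩⟩⟩
      exact isIso_of_mono_of_epi f
    have hZ : θ.app (kernel (dag f)) = 0 := by
      refine ih _ (small _ k l hkl ?_)
      rintro ⟨a, ha⟩
      have : dag f = 0 := by
        rw [← Category.id_comp (dag f), ← ha, Category.assoc, Category.assoc, hkd, comp_zero,
          comp_zero]
      apply hf0
      rw [← dag_dag f, this, dag_zero]
    have hid : 𝟙 X = r ≫ f + l ≫ k := by rw [hlk]; abel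
    have n1 : f ≫ θ.app X = θ.app Y ≫ F.map f := θ.naturality f
    have n2 : k ≫ θ.app X = θ.app (kernel (dag f)) ≫ F.map k := θ.naturality k
    have e1 : f ≫ θ.app X = 0 := by rw [n1, hY]; exact zero_comp
    have e2 : k ≫ θ.app X = 0 := by rw [n2, hZ]; exact zero_comp
    have e3 : (r ≫ f) ≫ θ.app X = 0 :=
      (Category.assoc r f (θ.app X)).trans (by rw [e1]; exact comp_zero)
    have e4 : (l ≫ k) ≫ θ.app X = 0 :=
      (Category.assoc l k (θ.app X)).trans (by rw [e2]; exact comp_zero)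
    have : 𝟙 X ≫ θ.app X = 0 := by
      rw [hid]
      exact (Preadditive.add_comp _ _ _ (r ≫ f) (l ≫ k) (θ.app X)).trans (by
        rw [e3, e4, add_zero])
    exact (Category.id_comp _).symm.trans this

/-- A linear `*`-functor between 2-Hilbert spaces (it then preserves direct sums). -/
structure IsLinearStar {K : Type w} [Category.{v} K] [Abelian K] [Linear ℂ K] [TwoHilbert K]
    (F : H ⥤ K) : Prop where
  map_add : ∀ {X Y : H} (f g : X ⟶ Y), F.map (f + g) = F.map f + F.map g
  map_smul : ∀ {X Y : H} (c : ℂ) (f : X ⟶ Y), F.map (c • f) = c • F.map f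
  map_dag : ∀ {X Y : H} (f : X ⟶ Y), F.map (dag f) = dag (F.map f)

theorem IsLinearStar.map_unitary {K : Type w} [Category.{v} K] [Abelian K] [Linear ℂ K]
    [TwoHilbert K] {F : H ⥤ K} (hF : IsLinearStar F) {X Y : H} {f : X ⟶ Y}
    (hf : IsUnitary f) : IsUnitary (F.map f) := by
  constructor
  · rw [← hF.map_dag, ← F.map_comp, hf.1, F.map_id]
  · rw [← hF.map_dag, ← F.map_comp, hf.2, F.map_id]

end TwoHilbert

open TwoHilbert

/-- A unitary 2-representation of `G`: a finite-dimensional 2-Hilbert space `H`, linear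
`*`-functors `α_g : H → H` which are unitary on hom-spaces, and unitary natural isomorphisms
`φ(e) : id ⇒ α_e` and `φ(g₂, g₁) : α_{g₂} ∘ α_{g₁} ⇒ α_{g₂ g₁}` satisfying the unit and
associativity laws.  The target of `φ(g₂, g₁)` is written as `α_g` for any `g` with
`g₂ * g₁ = g`, so that no transport along equalities in `G` is needed.  The functor composite
`α_{g₂} ∘ α_{g₁}` is `act g₁ ⋙ act g₂`. -/
structure TwoRep (G : Type v) [Group G] where
  H : Type u
  [cat : Category.{v} H]
  [abelian : Abelian H]
  [linear : Linear ℂ H]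
  [hilb : TwoHilbert H]
  finDim : ∃ (n : ℕ) (s : Fin n → H), ∀ S : H, Simple S → ∃ i, Nonempty (S ≅ s i)
  act : G → H ⥤ H
  act_linearStar : ∀ g, IsLinearStar (act g)
  act_surj : ∀ g (X Y : H) (f : (act g).obj X ⟶ (act g).obj Y), ∃ f', (act g).map f' = f
  act_inner : ∀ g {X Y : H} (f f' : X ⟶ Y), ip ((act g).map f) ((act g).map f') = ip f f'
  unit : 𝟭 H ⟶ act 1
  unit_unitary : ∀ X, IsUnitary (unit.app X)
  mul : ∀ {g₂ g₁ g : G}, g₂ * g₁ = g → (act g₁ ⋙ act g₂ ⟶ act g)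
  mul_unitary : ∀ {g₂ g₁ g : G} (h : g₂ * g₁ = g) (X : H), IsUnitary ((mul h).app X)
  unit_mul : ∀ (g : G) (X : H),
    unit.app ((act g).obj X) ≫ (mul (one_mul g)).app X = 𝟙 ((act g).obj X)
  mul_unit : ∀ (g : G) (X : H),
    (act g).map (unit.app X) ≫ (mul (mul_one g)).app X = 𝟙 ((act g).obj X)
  mul_mul : ∀ {g₃ g₂ g₁ a b c : G} (ha : g₂ * g₁ = a) (hb : g₃ * g₂ = b)
    (hc : g₃ * a = c) (hc' : b * g₁ = c) (X : H),
    (act g₃).map ((mul ha).app X) ≫ (mul hc).app X =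
      (mul hb).app ((act g₁).obj X) ≫ (mul hc').app X

attribute [instance] TwoRep.cat TwoRep.abelian TwoRep.linear TwoRep.hilb

/-- A marked unitary 2-representation: one distinguished simple object `e i` has been chosen in
each isomorphism class `i` of simple objects. -/
structure MarkedTwoRep (G : Type v) [Group G] extends TwoRep.{v, u} G where
  I : Type (max u v)
  finI : Finite I
  e : I → H
  simple : ∀ i, Simple (e i)
  marking : ∀ S : H, Simple S → ∃! i, Nonempty (S ≅ e i)

attribute [instance] MarkedTwoRep.finI MarkedTwoRep.simple

variable {G : Type v} [Group G]

/-- A morphism of unitary 2-representations: a linear `*`-functor `σ` with unitary natural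
isomorphisms `σ(g) : β_g ∘ σ ⇒ σ ∘ α_g` satisfying the coherence laws. -/
structure TwoRepHom (α β : TwoRep.{v, u} G) where
  functor : α.H ⥤ β.H
  linearStar : IsLinearStar functor
  coh : ∀ g : G, functor ⋙ β.act g ⟶ α.act g ⋙ functor
  coh_unitary : ∀ (g : G) (X : α.H), IsUnitary ((coh g).app X)
  coh_mul : ∀ {g₂ g₁ g : G} (h : g₂ * g₁ = g) (X : α.H),
    (β.mul h).app (functor.obj X) ≫ (coh g).app X =
      (β.act g₂).map ((coh g₁).app X) ≫ (coh g₂).app ((α.act g₁).obj X) ≫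
        functor.map ((α.mul h).app X)
  coh_unit : ∀ X : α.H,
    β.unit.app (functor.obj X) ≫ (coh 1).app X = functor.map (α.unit.app X)

/-- A 2-morphism of unitary 2-representations, that is, a modification. -/
structure TwoRepMod {α β : TwoRep.{v, u} G} (σ ρ : TwoRepHom α β) where
  nat : σ.functor ⟶ ρ.functor
  comm : ∀ (g : G) (X : α.H),
    (σ.coh g).app X ≫ nat.app ((α.act g).obj X) =
      (β.act g).map (nat.app X) ≫ (ρ.coh g).app X

namespace TwoRepHom

/-- Isomorphism of 1-morphisms: an invertible 2-morphism. -/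
def Isomorphic {α β : TwoRep.{v, u} G} (σ ρ : TwoRepHom α β) : Prop :=
  ∃ (θ : TwoRepMod σ ρ) (θ' : TwoRepMod ρ σ), θ.nat ≫ θ'.nat = 𝟙 _ ∧ θ'.nat ≫ θ.nat = 𝟙 _

/-- The identity 1-morphism. -/
def id (α : TwoRep.{v, u} G) : TwoRepHom α α where
  functor := 𝟭 α.H
  linearStar := ⟨fun _ _ => rfl, fun _ _ => rfl, fun _ => rfl⟩
  coh g := 𝟙 (α.act g)
  coh_unitary g X := IsUnitary.id _
  coh_mul h X := by simp
  coh_unit X := by simp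

/-- The composite 1-morphism `τ ∘ σ`. -/
def comp {α β γ : TwoRep.{v, u} G} (σ : TwoRepHom α β) (τ : TwoRepHom β γ) :
    TwoRepHom α γ where
  functor := σ.functor ⋙ τ.functor
  linearStar :=
    ⟨fun f g => by simp [σ.linearStar.map_add, τ.linearStar.map_add],
     fun c f => by simp [σ.linearStar.map_smul, τ.linearStar.map_smul],
     fun f => by simp [σ.linearStar.map_dag, τ.linearStar.map_dag]⟩
  coh g :=
    { app := fun X => (τ.coh g).app (σ.functor.obj X) ≫ τ.functor.map ((σ.coh g).app X)
      naturality := fun X Y f => by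
        have h1 := (τ.coh g).naturality (σ.functor.map f)
        have h2 := (σ.coh g).naturality f
        simp only [Functor.comp_map] at h1 h2 ⊢
        rw [reassoc_of% h1, Category.assoc, ← τ.functor.map_comp, ← τ.functor.map_comp, h2] }
  coh_unitary g X := (τ.coh_unitary g _).comp (τ.linearStar.map_unitary (σ.coh_unitary g X))
  coh_mul {g₂ g₁ g} h X := by
    have h1 := τ.coh_mul h (σ.functor.obj X)
    have h2 := σ.coh_mul h X
    have h3 := (τ.coh g₂).naturality ((σ.coh g₁).app X)
    simp only [Functor.comp_map, Functor.comp_obj, Functor.map_comp, Category.assoc] at h1 h2 h3 ⊢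
    rw [reassoc_of% h1, ← τ.functor.map_comp, h2]
    simp only [Functor.map_comp]
    rw [reassoc_of% h3]
  coh_unit X := by
    have h1 := τ.coh_unit (σ.functor.obj X)
    have h2 := σ.coh_unit X
    simp only [Functor.comp_obj, Functor.comp_map] at h1 h2 ⊢
    rw [reassoc_of% h1, ← τ.functor.map_comp, h2]

theorem Isomorphic.refl {α β : TwoRep.{v, u} G} (σ : TwoRepHom α β) : Isomorphic σ σ :=
  ⟨⟨𝟙 _, fun g X => by simp⟩, ⟨𝟙 _, fun g X => by simp⟩, by simp, by simp⟩

theorem Isomorphic.symm {α β : TwoRep.{v, u} G} {σ ρ : TwoRepHom α β} (h : Isomorphic σ ρ) :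
    Isomorphic ρ σ := by
  obtain ⟨θ, θ', h1, h2⟩ := h
  exact ⟨θ', θ, h2, h1⟩

/-- Vertical composition of 2-morphisms. -/
def vcomp {α β : TwoRep.{v, u} G} {σ ρ τ : TwoRepHom α β} (θ : TwoRepMod σ ρ)
    (θ' : TwoRepMod ρ τ) : TwoRepMod σ τ where
  nat := θ.nat ≫ θ'.nat
  comm g X := by
    simp only [NatTrans.comp_app, Functor.map_comp]
    rw [reassoc_of% θ.comm g X, θ'.comm g X, Category.assoc]

theorem Isomorphic.trans {α β : TwoRep.{v, u} G} {σ ρ τ : TwoRepHom α β}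
    (h : Isomorphic σ ρ) (h' : Isomorphic ρ τ) : Isomorphic σ τ := by
  obtain ⟨θ, θ', h1, h2⟩ := h
  obtain ⟨κ, κ', h3, h4⟩ := h'
  refine ⟨vcomp θ κ, vcomp κ' θ', ?_, ?_⟩
  · simp only [vcomp, Category.assoc, reassoc_of% h3, h1]
  · simp only [vcomp, Category.assoc, reassoc_of% h2, h4]

/-- Horizontal composition of 2-morphisms. -/
def hcomp {α β γ : TwoRep.{v, u} G} {σ ρ : TwoRepHom α β} {τ κ : TwoRepHom β γ}
    (θ : TwoRepMod σ ρ) (ω : TwoRepMod τ κ) : TwoRepMod (σ.comp τ) (ρ.comp κ) where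
  nat := Functor.whiskerRight θ.nat τ.functor ≫ Functor.whiskerLeft ρ.functor ω.nat
  comm g X := by
    have h1 := θ.comm g X
    have h2 := ω.comm g (ρ.functor.obj X)
    have h3 := (τ.coh g).naturality (θ.nat.app X)
    have h4 := ω.nat.naturality ((ρ.coh g).app X)
    simp only [comp, Functor.comp_map, Functor.comp_obj, NatTrans.comp_app,
      Functor.whiskerRight_app, Functor.whiskerLeft_app, Functor.map_comp, Category.assoc]
      at h1 h2 h3 h4 ⊢
    rw [← τ.functor.map_comp_assoc, h1, τ.functor.map_comp_assoc, ← reassoc_of% h3, h4,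
      ← reassoc_of% h2]

theorem Isomorphic.comp {α β γ : TwoRep.{v, u} G} {σ ρ : TwoRepHom α β} {τ κ : TwoRepHom β γ}
    (h : Isomorphic σ ρ) (h' : Isomorphic τ κ) : Isomorphic (σ.comp τ) (ρ.comp κ) := by
  obtain ⟨θ, θ', h1, h2⟩ := h
  obtain ⟨ω, ω', h3, h4⟩ := h'
  refine ⟨hcomp θ ω, hcomp θ' ω', ?_, ?_⟩
  · ext X
    have a1 := congrArg (fun t => t.app X) h1
    have a3 := congrArg (fun t => t.app (σ.functor.obj X)) h3
    have n := ω.nat.naturality (θ'.nat.app X)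
    simp only [NatTrans.comp_app, NatTrans.id_app] at a1 a3
    change (τ.functor.map (θ.nat.app X) ≫ ω.nat.app (ρ.functor.obj X)) ≫
      (κ.functor.map (θ'.nat.app X) ≫ ω'.nat.app (σ.functor.obj X)) =
        𝟙 (τ.functor.obj (σ.functor.obj X))
    rw [Category.assoc, ← reassoc_of% n, a3, ← τ.functor.map_comp_assoc, a1]
    simp
  · ext X
    have a1 := congrArg (fun t => t.app X) h2
    have a3 := congrArg (fun t => t.app (ρ.functor.obj X)) h4
    have n := ω'.nat.naturality (θ.nat.app X)
    simp only [NatTrans.comp_app, NatTrans.id_app] at a1 a3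
    change (κ.functor.map (θ'.nat.app X) ≫ ω'.nat.app (σ.functor.obj X)) ≫
      (τ.functor.map (θ.nat.app X) ≫ ω.nat.app (ρ.functor.obj X)) =
        𝟙 (κ.functor.obj (ρ.functor.obj X))
    rw [Category.assoc, ← reassoc_of% n, a3, ← κ.functor.map_comp_assoc, a1]
    simp

/-- Isomorphism is an equivalence relation on 1-morphisms. -/
instance setoid (α β : TwoRep.{v, u} G) : Setoid (TwoRepHom α β) where
  r := Isomorphic
  iseqv := ⟨Isomorphic.refl, Isomorphic.symm, Isomorphic.trans⟩

/-- 1-morphisms with the same functor and the same coherence maps are isomorphic. -/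
theorem Isomorphic.of_app {α β : TwoRep.{v, u} G} {σ ρ : TwoRepHom α β}
    (i : σ.functor ≅ ρ.functor)
    (h : ∀ (g : G) (X : α.H), (σ.coh g).app X ≫ i.hom.app ((α.act g).obj X) =
      (β.act g).map (i.hom.app X) ≫ (ρ.coh g).app X) : Isomorphic σ ρ := by
  refine ⟨⟨i.hom, h⟩, ⟨i.inv, fun g X => ?_⟩, i.hom_inv_id, i.inv_hom_id⟩
  have h1 := h g X
  have h2 : (β.act g).map (i.inv.app X) ≫ (β.act g).map (i.hom.app X) = 𝟙 _ := by
    rw [← Functor.map_comp]; simp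
  have h3 : i.hom.app ((α.act g).obj X) ≫ i.inv.app ((α.act g).obj X) = 𝟙 _ := by simp
  calc (ρ.coh g).app X ≫ i.inv.app ((α.act g).obj X)
      = (β.act g).map (i.inv.app X) ≫ ((β.act g).map (i.hom.app X) ≫ (ρ.coh g).app X) ≫
          i.inv.app ((α.act g).obj X) := by rw [Category.assoc, reassoc_of% h2]
    _ = _ := by
      rw [← h1, Category.assoc]
      simp

end TwoRepHom

/-- The homotopy category `[2Rep_m(G)]`: objects are marked unitary 2-representations, morphisms
are isomorphism classes of 1-morphisms of the underlying 2-representations. -/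
structure HoTwoRep (G : Type v) [Group G] where
  rep : MarkedTwoRep.{v, u} G

instance : Category (HoTwoRep.{v, u} G) where
  Hom α β := Quotient (TwoRepHom.setoid α.rep.toTwoRep β.rep.toTwoRep)
  id α := Quotient.mk _ (TwoRepHom.id α.rep.toTwoRep)
  comp f g := Quotient.map₂ TwoRepHom.comp (fun _ _ h _ _ h' =>
    TwoRepHom.Isomorphic.comp h h') f g
  id_comp f := by
    induction f using Quotient.ind with | _ σ =>
    refine Quotient.sound (TwoRepHom.Isomorphic.of_app (Iso.refl σ.functor) fun g X => ?_)
    simp [TwoRepHom.comp, TwoRepHom.id]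
  comp_id f := by
    induction f using Quotient.ind with | _ σ =>
    refine Quotient.sound (TwoRepHom.Isomorphic.of_app (Iso.refl σ.functor) fun g X => ?_)
    simp [TwoRepHom.comp, TwoRepHom.id]
  assoc f g h := by
    induction f using Quotient.ind with | _ σ =>
    induction g using Quotient.ind with | _ τ =>
    induction h using Quotient.ind with | _ κ =>
    refine Quotient.sound (TwoRepHom.Isomorphic.of_app
      (Iso.refl (σ.functor ⋙ τ.functor ⋙ κ.functor)) fun g X => ?_)
    simp [TwoRepHom.comp]

/-- The class in the homotopy category of a 1-morphism of 2-representations. -/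
def HoTwoRep.mk_hom {α β : HoTwoRep.{v, u} G} (σ : TwoRepHom α.rep.toTwoRep β.rep.toTwoRep) :
    α ⟶ β := Quotient.mk _ σ

/-- A unitary representation of a groupoid `C`: a functor from `C` to finite-dimensional Hilbert
spaces which sends arrows to unitary maps.  (The maps are isometries, and they are invertible
because `C` is a groupoid.) -/
structure UnitaryBundle (C : Type u) [Groupoid.{v} C] where
  fib : C → Type w
  [normed : ∀ a, NormedAddCommGroup (fib a)]
  [inner : ∀ a, InnerProductSpace ℂ (fib a)]
  [finDim : ∀ a, FiniteDimensional ℂ (fib a)]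
  map : ∀ {a b : C}, (a ⟶ b) → (fib a →ₗᵢ[ℂ] fib b)
  map_id : ∀ (a : C) (ψ : fib a), map (𝟙 a) ψ = ψ
  map_comp : ∀ {a b c : C} (f : a ⟶ b) (g : b ⟶ c) (ψ : fib a), map (f ≫ g) ψ = map g (map f ψ)

attribute [instance] UnitaryBundle.normed UnitaryBundle.inner UnitaryBundle.finDim

namespace UnitaryBundle

variable {C : Type u} [Groupoid.{v} C]

/-- A morphism of unitary bundles: a natural family of linear maps. -/
@[ext]
structure Hom (E F : UnitaryBundle.{v, u, w} C) where
  app : ∀ a, E.fib a →ₗ[ℂ] F.fib a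
  naturality : ∀ {a b : C} (f : a ⟶ b) (ψ : E.fib a), app b (E.map f ψ) = F.map f (app a ψ)

instance : Category (UnitaryBundle.{v, u, w} C) where
  Hom := Hom
  id E := ⟨fun _ => LinearMap.id, fun _ _ => rfl⟩
  comp S T := ⟨fun a => (T.app a).comp (S.app a), fun f ψ => by
    simp [S.naturality, T.naturality]⟩

end UnitaryBundle

/-! ### Loop groupoids -/

/-- Objects of the loop groupoid `ΛG` of a finite group `G`: the elements of `G`. -/
structure LoopGroup (G : Type v) where
  pt : G

/-- Arrows `g : x → g x g⁻¹` of `ΛG`. -/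
@[ext]
structure LoopGroup.Hom (x y : LoopGroup G) where
  g : G
  conj : g * x.pt * g⁻¹ = y.pt

instance : Groupoid (LoopGroup G) where
  Hom := LoopGroup.Hom
  id x := ⟨1, by simp⟩
  comp a b := ⟨b.g * a.g, by rw [← b.conj, ← a.conj]; group⟩
  inv a := ⟨a.g⁻¹, by rw [← a.conj]; group⟩
  id_comp a := LoopGroup.Hom.ext (mul_one a.g)
  comp_id a := LoopGroup.Hom.ext (one_mul a.g)
  assoc a b c := LoopGroup.Hom.ext (mul_assoc c.g b.g a.g).symm
  inv_comp a := LoopGroup.Hom.ext (mul_inv_cancel a.g)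
  comp_inv a := LoopGroup.Hom.ext (inv_mul_cancel a.g)

/-- The category `Hilb_G(G)` of unitary equivariant vector bundles over `G`, that is, of unitary
representations of the loop groupoid `ΛG`. -/
abbrev HilbG (G : Type v) [Group G] := UnitaryBundle.{v, v, w} (LoopGroup G)

/-- Objects of the loop groupoid `ΛX_G` of the action groupoid of a `G`-set `X`: the loops
`x : i → i`, that is, pairs of `x : G` and a fixed point `i` of `x`. -/
structure Loop (G : Type v) [Group G] (X : Type w) [MulAction G X] where
  x : G
  i : X
  fix : x • i = i

/-- Arrows `g : (i, x) → (g i, g x g⁻¹)` of `ΛX_G`. -/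
@[ext]
structure Loop.Hom {X : Type w} [MulAction G X] (a b : Loop G X) where
  g : G
  conj : g * a.x * g⁻¹ = b.x
  move : g • a.i = b.i

instance {X : Type w} [MulAction G X] : Groupoid (Loop G X) where
  Hom := Loop.Hom
  id x := ⟨1, by simp, by simp⟩
  comp a b := ⟨b.g * a.g, by rw [← b.conj, ← a.conj]; group, by
    rw [mul_smul, a.move, b.move]⟩
  inv a := ⟨a.g⁻¹, by rw [← a.conj]; group, by rw [← a.move, inv_smul_smul]⟩
  id_comp a := Loop.Hom.ext (mul_one a.g)
  comp_id a := Loop.Hom.ext (one_mul a.g)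
  assoc a b c := Loop.Hom.ext (mul_assoc c.g b.g a.g).symm
  inv_comp a := Loop.Hom.ext (mul_inv_cancel a.g)
  comp_inv a := Loop.Hom.ext (inv_mul_cancel a.g)

/-- The inner product `⟨ψ, ψ'⟩ = ∑ i, k i * (ψ i, ψ' i)` on a weighted direct sum of inner product
spaces. -/
@[reducible]
def weightedCore {ι : Type u} [Fintype ι] {V : ι → Type w} [∀ i, NormedAddCommGroup (V i)]
    [∀ i, InnerProductSpace ℂ (V i)] (k : ι → ℝ) (hk : ∀ i, 0 < k i) :
    InnerProductSpace.Core ℂ (∀ i, V i) where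
  inner ψ ψ' := ∑ i, (k i : ℂ) * Inner.inner ℂ (ψ i) (ψ' i)
  conj_inner_symm ψ ψ' := by simp [map_sum]
  re_inner_nonneg ψ := by
    rw [map_sum]
    refine Finset.sum_nonneg fun i _ => ?_
    rw [RCLike.re_eq_complex_re, Complex.re_ofReal_mul]
    exact mul_nonneg (hk _).le (inner_self_nonneg (𝕜 := ℂ))
  add_left ψ ψ' ψ'' := by
    rw [← Finset.sum_add_distrib]
    refine Finset.sum_congr rfl fun i _ => ?_
    rw [← mul_add, ← inner_add_left]; rfl
  smul_left ψ ψ' c := by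
    rw [Finset.mul_sum]
    refine Finset.sum_congr rfl fun i _ => ?_
    rw [mul_left_comm, ← inner_smul_left]; rfl
  definite ψ h := by
    have h' := congrArg Complex.re h
    rw [Complex.re_sum] at h'
    simp only [Complex.re_ofReal_mul, Complex.zero_re] at h'
    have h'' := (Finset.sum_eq_zero_iff_of_nonneg fun i _ =>
      mul_nonneg (hk i).le (inner_self_nonneg (𝕜 := ℂ) (x := ψ i))).1 h'
    funext i
    have := (mul_eq_zero.1 (h'' i (Finset.mem_univ _))).resolve_left (hk _).ne'
    exact inner_self_eq_zero (𝕜 := ℂ) |>.1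
      (Complex.ext this (by simpa using inner_self_im (𝕜 := ℂ) (ψ i)))

/-! ### Push-forward of bundles along `ΛX_G → ΛG` -/

namespace Push

variable {X : Type w} [MulAction G X]

/-- The fixed points of `x`. -/
abbrev Fix (X : Type w) [MulAction G X] (x : G) : Type w := {i : X // x • i = i}

instance [Finite X] (x : G) : Fintype (Fix X x) := Fintype.ofFinite _

/-- A fixed point as a loop. -/
def Fix.loop {x : G} (i : Fix X x) : Loop G X := ⟨x, i.1, i.2⟩

variable (L : UnitaryBundle.{v, max v w, w} (Loop G X))

/-- Sections of `L` over the fixed points of `x`. -/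
def Sec (x : G) : Type w := ∀ i : Fix X x, L.fib i.loop

instance (x : G) : AddCommGroup (Sec L x) :=
  inferInstanceAs (AddCommGroup (∀ i : Fix X x, L.fib i.loop))

instance (x : G) : Module ℂ (Sec L x) :=
  inferInstanceAs (Module ℂ (∀ i : Fix X x, L.fib i.loop))

instance [Finite X] (x : G) : FiniteDimensional ℂ (Sec L x) :=
  inferInstanceAs (FiniteDimensional ℂ (∀ i : Fix X x, L.fib i.loop))

/-- The inner product `⟨ψ, ψ'⟩ = ∑ i, k i * (ψ i, ψ' i)` on sections. -/
@[reducible]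
def secCore [Finite X] (k : X → ℝ) (hk : ∀ i, 0 < k i) (x : G) :
    InnerProductSpace.Core ℂ (Sec L x) :=
  weightedCore (V := fun i : Fix X x => L.fib i.loop) (fun i => k i.1) (fun i => hk i.1)

variable {L}

theorem map_congr {x : G} (ψ : Sec L x) {i i' : Fix X x} {b : Loop G X} (h : i = i')
    (f : i.loop ⟶ b) (f' : i'.loop ⟶ b) (hg : f.g = f'.g) :
    L.map f (ψ i) = L.map f' (ψ i') := by
  subst h
  rw [show f = f' from Loop.Hom.ext hg]

/-- Moving fixed points of `x` to fixed points of `g x g⁻¹`. -/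
def fixEquiv {x y : LoopGroup G} (f : x ⟶ y) : Fix X x.pt ≃ Fix X y.pt where
  toFun i := ⟨f.g • i.1, by
    rw [← f.conj, mul_smul, mul_smul, inv_smul_smul, i.2]⟩
  invFun j := ⟨f.g⁻¹ • j.1, by
    have h : y.pt • j.1 = j.1 := j.2
    have h2 : x.pt * f.g⁻¹ = f.g⁻¹ * y.pt := by rw [← f.conj]; group
    rw [← mul_smul, h2, mul_smul, h]⟩
  left_inv i := Subtype.ext (inv_smul_smul _ _)
  right_inv j := Subtype.ext (smul_inv_smul _ _)

/-- The arrow of `ΛX_G` over `f` which ends at `j`. -/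
def lift {x y : LoopGroup G} (f : x ⟶ y) (j : Fix X y.pt) :
    ((fixEquiv f).symm j).loop ⟶ j.loop :=
  ⟨f.g, f.conj, smul_inv_smul _ _⟩

end Push

/-- The push-forward `π_* L` along `π : ΛX_G → ΛG` of a unitary bundle `L` over `ΛX_G`, with
respect to an invariant metric `k` on `X`: the fibre at `x` is the space of sections of `L` over
the fixed points of `x`, with `⟨ψ, ψ'⟩ = ∑ i, k i * (ψ i, ψ' i)`, and `g` sends `ψ` to the section
whose value at `g i` is `L(g)(ψ(i))`. -/
def pushForward {X : Type w} [MulAction G X] [Finite X] (k : X → ℝ) (hk : ∀ i, 0 < k i)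
    (hinv : ∀ (g : G) i, k (g • i) = k i) (L : UnitaryBundle.{v, max v w, w} (Loop G X)) :
    HilbG.{v, w} G where
  fib x := Push.Sec L x.pt
  normed x := (Push.secCore L k hk x.pt).toNormedAddCommGroup
  inner x := InnerProductSpace.ofCore (Push.secCore L k hk x.pt).toCore
  finDim x := inferInstanceAs (FiniteDimensional ℂ (Push.Sec L x.pt))
  map {x y} f :=
    letI : ∀ x : LoopGroup G, NormedAddCommGroup (Push.Sec L x.pt) :=
      fun x => (Push.secCore L k hk x.pt).toNormedAddCommGroup
    letI : ∀ x : LoopGroup G, InnerProductSpace ℂ (Push.Sec L x.pt) :=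
      fun x => InnerProductSpace.ofCore (Push.secCore L k hk x.pt).toCore
    LinearMap.isometryOfInner
      { toFun := fun ψ j => L.map (Push.lift f j) (ψ ((Push.fixEquiv f).symm j))
        map_add' := fun ψ ψ' => funext fun j => (L.map (Push.lift f j)).map_add _ _
        map_smul' := fun c ψ => funext fun j => (L.map (Push.lift f j)).map_smul _ _ }
      (fun ψ ψ' => by
        change ∑ j : Push.Fix X y.pt, (k j.1 : ℂ) * Inner.inner ℂ
            (L.map (Push.lift f j) (ψ ((Push.fixEquiv f).symm j)))
            (L.map (Push.lift f j) (ψ' ((Push.fixEquiv f).symm j))) =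
          ∑ i : Push.Fix X x.pt, (k i.1 : ℂ) * Inner.inner ℂ (ψ i) (ψ' i)
        rw [← (Push.fixEquiv f).symm.sum_comp]
        refine Finset.sum_congr rfl fun j _ => ?_
        rw [LinearIsometry.inner_map_map]
        have : k j.1 = k ((Push.fixEquiv f).symm j).1 := (hinv f.g⁻¹ j.1).symm
        rw [this])
  map_id x ψ := by
    funext j
    have h : (Push.fixEquiv (𝟙 x)).symm j = j := Subtype.ext (by
      change (1 : G)⁻¹ • j.1 = j.1
      simp)
    have := Push.map_congr ψ h (Push.lift (𝟙 x) j) (𝟙 j.loop) rfl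
    exact this.trans (L.map_id _ _)
  map_comp {x y z} f g ψ := by
    funext j
    have h : (Push.fixEquiv (f ≫ g)).symm j =
        (Push.fixEquiv f).symm ((Push.fixEquiv g).symm j) := Subtype.ext (by
      change (g.g * f.g)⁻¹ • j.1 = f.g⁻¹ • g.g⁻¹ • j.1
      rw [mul_inv_rev, mul_smul])
    have := Push.map_congr ψ h (Push.lift (f ≫ g) j)
      (Push.lift f _ ≫ Push.lift g j) rfl
    exact this.trans (L.map_comp _ _ _)

/-! ### Finite equivariant gerbes -/

/-- A finite `G`-equivariant gerbe with a metric: a central extension by `U(1)` of the action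
groupoid of a finite `G`-set `X`, together with a positive invariant function `k` on `X`.
The projection to the action groupoid is the identity on objects and sends `f : i ⟶ j` to the
arrow labelled by `deg f`, where `deg f • i = j`; it is full, and `circ i` identifies `U(1)` with
the arrows over the identity of `i`. -/
structure Gerbe (G : Type v) [Group G] where
  X : Type w
  [finite : Finite X]
  [action : MulAction G X]
  [gpd : Groupoid.{w} X]
  deg : ∀ {i j : X}, (i ⟶ j) → G
  deg_smul : ∀ {i j : X} (f : i ⟶ j), deg f • i = j
  deg_id : ∀ i : X, deg (𝟙 i) = 1
  deg_comp : ∀ {i j l : X} (f : i ⟶ j) (g : j ⟶ l), deg (f ≫ g) = deg g * deg f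
  full : ∀ (g : G) (i j : X), g • i = j → ∃ f : i ⟶ j, deg f = g
  circ : ∀ i : X, Circle → (i ⟶ i)
  circ_mul : ∀ (i : X) (z z' : Circle), circ i (z * z') = circ i z ≫ circ i z'
  circ_inj : ∀ i : X, Function.Injective (circ i)
  deg_circ : ∀ (i : X) (z : Circle), deg (circ i z) = 1
  circ_surj : ∀ (i : X) (f : i ⟶ i), deg f = 1 → ∃ z, circ i z = f
  central : ∀ {i j : X} (f : i ⟶ j) (z : Circle), circ i z ≫ f = f ≫ circ j z
  k : X → ℝ
  k_pos : ∀ i, 0 < k i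
  k_smul : ∀ (g : G) (i : X), k (g • i) = k i

attribute [instance] Gerbe.finite Gerbe.action Gerbe.gpd

namespace Gerbe

section basic

variable (𝔛 : Gerbe.{v, w} G)

theorem circ_one (i : 𝔛.X) : 𝔛.circ i 1 = 𝟙 i := by
  have h := 𝔛.circ_mul i 1 1
  rw [mul_one] at h
  rw [← cancel_epi (𝔛.circ i 1), ← h, Category.comp_id]

theorem deg_inv {i j : 𝔛.X} (f : i ⟶ j) : 𝔛.deg (Groupoid.inv f) = (𝔛.deg f)⁻¹ := by
  have h := 𝔛.deg_comp f (Groupoid.inv f)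
  rw [Groupoid.comp_inv, 𝔛.deg_id] at h
  exact eq_inv_of_mul_eq_one_left h.symm

/-- Arrows of the same degree differ by an element of `U(1)`. -/
theorem exists_circ {i j : 𝔛.X} (f f' : i ⟶ j) (h : 𝔛.deg f = 𝔛.deg f') :
    ∃ z, f = 𝔛.circ i z ≫ f' := by
  obtain ⟨z, hz⟩ := 𝔛.circ_surj i (f ≫ Groupoid.inv f') (by
    rw [𝔛.deg_comp, 𝔛.deg_inv, h, inv_mul_cancel])
  exact ⟨z, by rw [hz, Category.assoc, Groupoid.inv_comp, Category.comp_id]⟩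

theorem circ_comp {i j : 𝔛.X} (f : i ⟶ j) (z z' : Circle) :
    𝔛.circ i z ≫ 𝔛.circ i z' ≫ f = 𝔛.circ i (z * z') ≫ f := by
  rw [𝔛.circ_mul, Category.assoc]

theorem deg_circ_comp {i j : 𝔛.X} (f : i ⟶ j) (z : Circle) :
    𝔛.deg (𝔛.circ i z ≫ f) = 𝔛.deg f := by
  rw [𝔛.deg_comp, 𝔛.deg_circ, mul_one]

theorem inv_circ (i : 𝔛.X) (z : Circle) : Groupoid.inv (𝔛.circ i z) = 𝔛.circ i z⁻¹ := by
  rw [← cancel_epi (𝔛.circ i z), Groupoid.comp_inv, ← 𝔛.circ_mul, mul_inv_cancel, circ_one]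

/-- Conjugation by an arrow depends only on its degree. -/
theorem conj_eq {i j : 𝔛.X} (f f' : i ⟶ j) (h : 𝔛.deg f = 𝔛.deg f') (u : j ⟶ j) :
    f ≫ u ≫ Groupoid.inv f = f' ≫ u ≫ Groupoid.inv f' := by
  obtain ⟨z, rfl⟩ := 𝔛.exists_circ f f' h
  have : Groupoid.inv (𝔛.circ i z ≫ f') = Groupoid.inv f' ≫ 𝔛.circ i z⁻¹ := by
    rw [← 𝔛.inv_circ]
    simp
  have h2 : 𝔛.circ i z ≫ f' ≫ 𝔛.circ j z⁻¹ = f' := by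
    rw [← 𝔛.central, 𝔛.circ_comp, mul_inv_cancel, circ_one, Category.id_comp]
  rw [this, ← Category.assoc u, ← 𝔛.central, Category.assoc, reassoc_of% h2]

/-- The arrows `i ⟶ j` over `g`: a `U(1)`-torsor if `g • i = j`, and empty otherwise. -/
def Tor (g : G) (i j : 𝔛.X) : Type w := {f : i ⟶ j // 𝔛.deg f = g}

/-- The hermitian line of a `U(1)`-torsor `P` of arrows: the functions `F : P → ℂ` such that
`F (z p) = z⁻¹ F p`.  The element `p ⊗ c` of the line `(P × ℂ) / U(1)` corresponds to the function
with `F p = c`.  (If there are no arrows it is the zero space.) -/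
def lineSub (g : G) (i j : 𝔛.X) : Submodule ℂ (𝔛.Tor g i j → ℂ) where
  carrier := {F | ∀ (z : Circle) (p q : 𝔛.Tor g i j), q.1 = 𝔛.circ i z ≫ p.1 →
    F q = (starRingEnd ℂ) (z : ℂ) * F p}
  add_mem' {F F'} h h' z p q e := by
    simp only [Pi.add_apply, h z p q e, h' z p q e, mul_add]
  zero_mem' z p q e := by simp
  smul_mem' c F h z p q e := by
    simp only [Pi.smul_apply, smul_eq_mul, h z p q e]; ring

/-- See `lineSub`. -/
def Line (g : G) (i j : 𝔛.X) : Type w := 𝔛.lineSub g i j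

instance (g : G) (i j : 𝔛.X) : AddCommGroup (𝔛.Line g i j) :=
  inferInstanceAs (AddCommGroup (𝔛.lineSub g i j))

instance (g : G) (i j : 𝔛.X) : Module ℂ (𝔛.Line g i j) :=
  inferInstanceAs (Module ℂ (𝔛.lineSub g i j))

variable {𝔛}

theorem Line.ext {g : G} {i j : 𝔛.X} {F F' : 𝔛.Line g i j} (h : ∀ p, F.1 p = F'.1 p) : F = F' :=
  Subtype.ext (funext h)

theorem conj_mul_self (z : Circle) : (starRingEnd ℂ) (z : ℂ) * (z : ℂ) = 1 := by
  rw [mul_comm, Complex.mul_conj, Circle.normSq_coe]; simp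

/-- The fibrewise product of two elements of a line does not depend on the base point. -/
theorem Line.prod_indep {g : G} {i j : 𝔛.X} (F F' : 𝔛.Line g i j) (p q : 𝔛.Tor g i j) :
    (starRingEnd ℂ) (F.1 p) * F'.1 p = (starRingEnd ℂ) (F.1 q) * F'.1 q := by
  obtain ⟨z, hz⟩ := 𝔛.exists_circ p.1 q.1 (p.2.trans q.2.symm)
  rw [F.2 z q p hz, F'.2 z q p hz, map_mul, Complex.conj_conj]
  linear_combination ((starRingEnd ℂ) (F.1 q) * F'.1 q) * conj_mul_self z

theorem Line.eq_zero_of {g : G} {i j : 𝔛.X} (F : 𝔛.Line g i j) (p : 𝔛.Tor g i j)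
    (h : F.1 p = 0) : F = 0 := by
  refine Line.ext fun q => ?_
  obtain ⟨z, hz⟩ := 𝔛.exists_circ q.1 p.1 (q.2.trans p.2.symm)
  rw [F.2 z p q hz, h, mul_zero]; rfl

open Classical in
/-- The inner product `(p ⊗ c, p' ⊗ c') = (p' / p) * conj c * c'` on the line of a torsor: with
functions it is `conj (F p) * F' p` for any `p`. -/
def Line.ip {g : G} {i j : 𝔛.X} (F F' : 𝔛.Line g i j) : ℂ :=
  if h : Nonempty (𝔛.Tor g i j) then (starRingEnd ℂ) (F.1 h.some) * F'.1 h.some else 0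

theorem Line.ip_eq {g : G} {i j : 𝔛.X} (F F' : 𝔛.Line g i j) (p : 𝔛.Tor g i j) :
    Line.ip F F' = (starRingEnd ℂ) (F.1 p) * F'.1 p := by
  rw [Line.ip, dif_pos ⟨p⟩]
  exact Line.prod_indep F F' _ _

theorem Line.ip_empty {g : G} {i j : 𝔛.X} (F F' : 𝔛.Line g i j) (h : ¬ Nonempty (𝔛.Tor g i j)) :
    Line.ip F F' = 0 := by
  rw [Line.ip, dif_neg h]

variable (𝔛) in
/-- The Hilbert space structure on the line of a torsor. -/
@[reducible]
def lineCore (g : G) (i j : 𝔛.X) : InnerProductSpace.Core ℂ (𝔛.Line g i j) where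
  inner := Line.ip
  conj_inner_symm F F' := by
    by_cases h : Nonempty (𝔛.Tor g i j)
    · obtain ⟨p⟩ := h
      simp only [Line.ip_eq _ _ p, map_mul, Complex.conj_conj, mul_comm]
    · simp [Line.ip_empty _ _ h]
  re_inner_nonneg F := by
    by_cases h : Nonempty (𝔛.Tor g i j)
    · obtain ⟨p⟩ := h
      rw [Line.ip_eq _ _ p, mul_comm, Complex.mul_conj]
      exact Complex.normSq_nonneg _
    · simp [Line.ip_empty _ _ h]
  add_left F F' F'' := by
    by_cases h : Nonempty (𝔛.Tor g i j)
    · obtain ⟨p⟩ := h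
      simp only [Line.ip_eq _ _ p]
      rw [← add_mul, ← map_add]; rfl
    · simp [Line.ip_empty _ _ h]
  smul_left F F' c := by
    by_cases h : Nonempty (𝔛.Tor g i j)
    · obtain ⟨p⟩ := h
      simp only [Line.ip_eq _ _ p]
      rw [← mul_assoc, ← map_mul]; rfl
    · simp [Line.ip_empty _ _ h]
  definite F hF := by
    by_cases h : Nonempty (𝔛.Tor g i j)
    · obtain ⟨p⟩ := h
      refine Line.eq_zero_of F p ?_
      change Line.ip F F = 0 at hF
      rw [Line.ip_eq _ _ p] at hF
      simpa using hF
    · exact Line.ext fun p => absurd ⟨p⟩ h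

instance (g : G) (i j : 𝔛.X) : NormedAddCommGroup (𝔛.Line g i j) :=
  (𝔛.lineCore g i j).toNormedAddCommGroup

instance (g : G) (i j : 𝔛.X) : InnerProductSpace ℂ (𝔛.Line g i j) :=
  InnerProductSpace.ofCore (𝔛.lineCore g i j).toCore

instance (g : G) (i j : 𝔛.X) : FiniteDimensional ℂ (𝔛.Line g i j) := by
  by_cases h : Nonempty (𝔛.Tor g i j)
  · obtain ⟨p⟩ := h
    let T : 𝔛.Line g i j →ₗ[ℂ] ℂ :=
      { toFun := fun F => F.1 p
        map_add' := fun _ _ => rfl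
        map_smul' := fun _ _ => rfl }
    refine FiniteDimensional.of_injective T ?_
    rw [← LinearMap.ker_eq_bot, LinearMap.ker_eq_bot']
    exact fun F hF => Line.eq_zero_of F p hF
  · have : Subsingleton (𝔛.Line g i j) := ⟨fun F F' => Line.ext fun p => absurd ⟨p⟩ h⟩
    infer_instance

/-- The element `p ⊗ c` of the line of a torsor. -/
def Line.tmul {g : G} {i j : 𝔛.X} (p : 𝔛.Tor g i j) (c : ℂ) : 𝔛.Line g i j :=
  ⟨fun q => (starRingEnd ℂ)
      ((𝔛.exists_circ q.1 p.1 (q.2.trans p.2.symm)).choose : ℂ) * c, by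
    intro z q r e
    set hq := 𝔛.exists_circ q.1 p.1 (q.2.trans p.2.symm)
    set hr := 𝔛.exists_circ r.1 p.1 (r.2.trans p.2.symm)
    have h1 : 𝔛.circ i hr.choose = 𝔛.circ i (z * hq.choose) := by
      rw [← cancel_mono p.1, ← hr.choose_spec, e, ← 𝔛.circ_comp, ← hq.choose_spec]
    have h2 := 𝔛.circ_inj i h1
    change (starRingEnd ℂ) (hr.choose : ℂ) * c =
      (starRingEnd ℂ) (z : ℂ) * ((starRingEnd ℂ) (hq.choose : ℂ) * c)
    rw [h2, Circle.coe_mul, map_mul, mul_assoc]⟩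

theorem Line.tmul_apply {g : G} {i j : 𝔛.X} (p : 𝔛.Tor g i j) (c : ℂ) :
    (Line.tmul p c).1 p = c := by
  set hp := 𝔛.exists_circ p.1 p.1 (p.2.trans p.2.symm)
  have h1 : 𝔛.circ i hp.choose = 𝔛.circ i 1 := by
    rw [← cancel_mono p.1, ← hp.choose_spec, 𝔛.circ_one, Category.id_comp]
  have h2 := 𝔛.circ_inj i h1
  change (starRingEnd ℂ) (hp.choose : ℂ) * c = c
  rw [h2]; simp

/-- The map of lines induced by an equivariant map of torsors (in the opposite direction). -/
def Line.pull {g g' : G} {i j i' j' : 𝔛.X} (t : 𝔛.Tor g' i' j' → 𝔛.Tor g i j)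
    (ht : ∀ (z : Circle) (p q : 𝔛.Tor g' i' j'), q.1 = 𝔛.circ i' z ≫ p.1 →
      (t q).1 = 𝔛.circ i z ≫ (t p).1) (hne : Nonempty (𝔛.Tor g i j) → Nonempty (𝔛.Tor g' i' j')) :
    𝔛.Line g i j →ₗᵢ[ℂ] 𝔛.Line g' i' j' :=
  LinearMap.isometryOfInner
    { toFun := fun F => ⟨fun q => F.1 (t q), fun z p q e => F.2 z _ _ (ht z p q e)⟩
      map_add' := fun _ _ => rfl
      map_smul' := fun _ _ => rfl }
    (fun F F' => by
      change Line.ip _ _ = Line.ip _ _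
      by_cases h : Nonempty (𝔛.Tor g' i' j')
      · obtain ⟨p⟩ := h
        rw [Line.ip_eq _ _ p, Line.ip_eq _ _ (t p)]
        rfl
      · rw [Line.ip_empty _ _ h, Line.ip_empty _ _ (fun h' => h (hne h'))])

end basic

/-! ### Transgression and the geometric character -/

section transgression

variable (𝔛 : Gerbe.{v, w} G)

/-- A choice of an arrow of `𝔛` lying over an arrow of the loop groupoid. -/
def liftArrow {a b : Loop G 𝔛.X} (f : a ⟶ b) : a.i ⟶ b.i := (𝔛.full f.g a.i b.i f.move).choose

theorem deg_liftArrow {a b : Loop G 𝔛.X} (f : a ⟶ b) : 𝔛.deg (𝔛.liftArrow f) = f.g :=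
  (𝔛.full f.g a.i b.i f.move).choose_spec

/-- The map `w ↦ v⁻¹ w v` on arrows over loops, where `v` lies over the given arrow. -/
def conjTor {a b : Loop G 𝔛.X} (f : a ⟶ b) (q : 𝔛.Tor b.x b.i b.i) : 𝔛.Tor a.x a.i a.i :=
  ⟨𝔛.liftArrow f ≫ q.1 ≫ Groupoid.inv (𝔛.liftArrow f), by
    rw [𝔛.deg_comp, 𝔛.deg_comp, 𝔛.deg_inv, 𝔛.deg_liftArrow, q.2, ← f.conj]; group⟩

theorem conjTor_eq {a b : Loop G 𝔛.X} (f : a ⟶ b) (q : 𝔛.Tor b.x b.i b.i) (v : a.i ⟶ b.i)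
    (hv : 𝔛.deg v = f.g) : (𝔛.conjTor f q).1 = v ≫ q.1 ≫ Groupoid.inv v :=
  𝔛.conj_eq _ _ ((𝔛.deg_liftArrow f).trans hv.symm) _

theorem tor_nonempty (a : Loop G 𝔛.X) : Nonempty (𝔛.Tor a.x a.i a.i) := by
  obtain ⟨f, hf⟩ := 𝔛.full a.x a.i a.i a.fix
  exact ⟨⟨f, hf⟩⟩

/-- The transgressed line bundle `τ(𝔛)_ℂ` over the loop groupoid `ΛX_G`: the fibre at a loop
`x : i → i` is the line of the torsor of arrows of `𝔛` over it, and `g : (i, x) → (g i, g x g⁻¹)`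
acts by `u ⊗ c ↦ v u v⁻¹ ⊗ c`, where `v` is any arrow of `𝔛` over `g : i → g i`. -/
def transgression : UnitaryBundle.{v, max v w, w} (Loop G 𝔛.X) where
  fib a := 𝔛.Line a.x a.i a.i
  map {a b} f := Line.pull (𝔛.conjTor f) (fun z p q e => by
    change 𝔛.liftArrow f ≫ q.1 ≫ _ = 𝔛.circ _ z ≫ 𝔛.liftArrow f ≫ p.1 ≫ _
    rw [e, Category.assoc, ← Category.assoc (𝔛.liftArrow f), ← 𝔛.central, Category.assoc])
    (fun _ => 𝔛.tor_nonempty b)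
  map_id a F := Line.ext fun p => congrArg F.1 (Subtype.ext (by
    rw [𝔛.conjTor_eq (𝟙 a) p (𝟙 _) (𝔛.deg_id _)]; simp))
  map_comp {a b c} f g F := Line.ext fun p => congrArg F.1 (Subtype.ext (by
    rw [𝔛.conjTor_eq (f ≫ g) p (𝔛.liftArrow f ≫ 𝔛.liftArrow g) (by
      rw [𝔛.deg_comp, 𝔛.deg_liftArrow, 𝔛.deg_liftArrow]; rfl)]
    change _ = 𝔛.liftArrow f ≫ (𝔛.liftArrow g ≫ p.1 ≫ _) ≫ _
    simp))

/-- The geometric character `ch(𝔛)`: the push-forward to `ΛG` of the transgressed line bundle. -/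
def geomChar : HilbG.{v, w} G :=
  pushForward 𝔛.k 𝔛.k_pos 𝔛.k_smul 𝔛.transgression

variable {𝔛}

open Classical in
/-- The section of `τ(𝔛)_ℂ` over the fixed points of `x` which is localized at the fixed point
`i`, with value `u ⊗ 1 / √(k i)` there. -/
def locSec {x : LoopGroup G} (i : Push.Fix 𝔛.X x.pt) (u : 𝔛.Tor x.pt i.1 i.1) :
    𝔛.geomChar.fib x :=
  (Pi.single i (Line.tmul u (1 / Real.sqrt (𝔛.k i.1) : ℂ)) : ∀ i : Push.Fix 𝔛.X x.pt,
    𝔛.Line x.pt i.1 i.1)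

end transgression

/-! ### Tensor products and conjugates of gerbes -/

section tensor

/-- The conjugate gerbe: the same groupoid with the conjugate action of `U(1)`. -/
def conj (𝔛 : Gerbe.{v, w} G) : Gerbe.{v, w} G where
  X := 𝔛.X
  finite := 𝔛.finite
  action := 𝔛.action
  gpd := 𝔛.gpd
  deg := 𝔛.deg
  deg_smul := 𝔛.deg_smul
  deg_id := 𝔛.deg_id
  deg_comp := 𝔛.deg_comp
  full := 𝔛.full
  circ i z := 𝔛.circ i z⁻¹
  circ_mul i z z' := by rw [mul_inv]; exact 𝔛.circ_mul i _ _
  circ_inj i z z' h := inv_injective (𝔛.circ_inj i h)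
  deg_circ i z := 𝔛.deg_circ i _
  circ_surj i f h := by
    obtain ⟨z, hz⟩ := 𝔛.circ_surj i f h
    exact ⟨z⁻¹, by rw [inv_inv, hz]⟩
  central f z := 𝔛.central f _
  k := 𝔛.k
  k_pos := 𝔛.k_pos
  k_smul := 𝔛.k_smul

/-- Objects of the tensor product of two gerbes: pairs. -/
@[ext]
structure TensorPt (𝔜 𝔛 : Gerbe.{v, w} G) where
  fst : 𝔜.X
  snd : 𝔛.X

variable {𝔜 𝔛 : Gerbe.{v, w} G}

instance : Finite (TensorPt 𝔜 𝔛) :=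
  Finite.of_injective (fun p => (p.fst, p.snd)) fun p q h => by
    cases p; cases q; simpa using h

instance : MulAction G (TensorPt 𝔜 𝔛) where
  smul g p := ⟨g • p.fst, g • p.snd⟩
  one_smul p := TensorPt.ext (one_smul G p.fst) (one_smul G p.snd)
  mul_smul g h p := TensorPt.ext (mul_smul g h p.fst) (mul_smul g h p.snd)

/-- Pairs of arrows of the same degree. -/
def TensorPre (a b : TensorPt 𝔜 𝔛) : Type w :=
  {p : (a.fst ⟶ b.fst) × (a.snd ⟶ b.snd) // 𝔜.deg p.1 = 𝔛.deg p.2}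

/-- The identification `(z p, q) ∼ (p, z q)` defining the tensor product of `U(1)`-torsors. -/
instance tensorSetoid (a b : TensorPt 𝔜 𝔛) : Setoid (TensorPre a b) where
  r p q := ∃ z : Circle, p.1.1 = 𝔜.circ _ z ≫ q.1.1 ∧ q.1.2 = 𝔛.circ _ z ≫ p.1.2
  iseqv :=
    { refl := fun p => ⟨1, by simp [circ_one], by simp [circ_one]⟩
      symm := by
        rintro p q ⟨z, h1, h2⟩
        exact ⟨z⁻¹, by rw [h1, circ_comp, inv_mul_cancel, circ_one, Category.id_comp],
          by rw [h2, circ_comp, inv_mul_cancel, circ_one, Category.id_comp]⟩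
      trans := by
        rintro p q r ⟨z, h1, h2⟩ ⟨z', h3, h4⟩
        exact ⟨z * z', by rw [h1, h3, circ_comp],
          by rw [h4, h2, circ_comp, mul_comm]⟩ }

/-- Arrows of the tensor product of two gerbes. -/
def TensorHom (a b : TensorPt 𝔜 𝔛) : Type w := Quotient (tensorSetoid a b)

/-- The arrow `p ⊗ q`. -/
def TensorHom.mk {a b : TensorPt 𝔜 𝔛} (p : a.fst ⟶ b.fst) (q : a.snd ⟶ b.snd)
    (h : 𝔜.deg p = 𝔛.deg q) : TensorHom a b := Quotient.mk _ ⟨(p, q), h⟩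

theorem TensorHom.ind {a b : TensorPt 𝔜 𝔛} {P : TensorHom a b → Prop}
    (h : ∀ p q e, P (TensorHom.mk p q e)) (t : TensorHom a b) : P t := by
  induction t using Quotient.ind with | _ t =>
  exact h t.1.1 t.1.2 t.2

theorem TensorHom.mk_circ {a b : TensorPt 𝔜 𝔛} (p : a.fst ⟶ b.fst) (q : a.snd ⟶ b.snd)
    (h : 𝔜.deg p = 𝔛.deg q) (z : Circle) (h1 : 𝔜.deg (𝔜.circ _ z ≫ p) = 𝔛.deg q)
    (h2 : 𝔜.deg p = 𝔛.deg (𝔛.circ _ z ≫ q)) :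
    TensorHom.mk (𝔜.circ _ z ≫ p) q h1 = TensorHom.mk p (𝔛.circ _ z ≫ q) h2 :=
  Quotient.sound ⟨z, rfl, rfl⟩

instance : Groupoid (TensorPt 𝔜 𝔛) where
  Hom := TensorHom
  id a := TensorHom.mk (𝟙 _) (𝟙 _) (by rw [deg_id, deg_id])
  comp {a b c} := Quotient.map₂
    (fun f g => ⟨(f.1.1 ≫ g.1.1, f.1.2 ≫ g.1.2), by
      rw [𝔜.deg_comp, 𝔛.deg_comp, f.2, g.2]⟩)
    (by
      rintro f f' ⟨z, h1, h2⟩ g g' ⟨z', h3, h4⟩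
      refine ⟨z * z', ?_, ?_⟩
      · change f.1.1 ≫ g.1.1 = _ ≫ f'.1.1 ≫ g'.1.1
        rw [h1, h3, Category.assoc, ← reassoc_of% 𝔜.central f'.1.1 z', circ_comp]
      · change f'.1.2 ≫ g'.1.2 = _ ≫ f.1.2 ≫ g.1.2
        rw [h2, h4, Category.assoc, ← reassoc_of% 𝔛.central f.1.2 z', circ_comp])
  inv {a b} := Quotient.map
    (fun f => ⟨(Groupoid.inv f.1.1, Groupoid.inv f.1.2), by
      rw [𝔜.deg_inv, 𝔛.deg_inv, f.2]⟩)
    (by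
      rintro f f' ⟨z, h1, h2⟩
      refine ⟨z⁻¹, ?_, ?_⟩
      · change Groupoid.inv f.1.1 = _ ≫ Groupoid.inv f'.1.1
        rw [h1, ← 𝔜.inv_circ, ← cancel_epi (𝔜.circ _ z ≫ f'.1.1), Groupoid.comp_inv,
          𝔜.inv_circ, 𝔜.central (Groupoid.inv f'.1.1), Category.assoc, reassoc_of% (Groupoid.comp_inv f'.1.1),
          ← 𝔜.circ_mul, mul_inv_cancel, circ_one]
      · change Groupoid.inv f'.1.2 = _ ≫ Groupoid.inv f.1.2
        rw [h2, ← 𝔛.inv_circ, ← cancel_epi (𝔛.circ _ z ≫ f.1.2), Groupoid.comp_inv,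
          𝔛.inv_circ, 𝔛.central (Groupoid.inv f.1.2), Category.assoc, reassoc_of% (Groupoid.comp_inv f.1.2),
          ← 𝔛.circ_mul, mul_inv_cancel, circ_one])
  id_comp f := by
    induction f using TensorHom.ind with | _ p q e =>
    exact congrArg (Quotient.mk _) (Subtype.ext (Prod.ext (Category.id_comp p)
      (Category.id_comp q)))
  comp_id f := by
    induction f using TensorHom.ind with | _ p q e =>
    exact congrArg (Quotient.mk _) (Subtype.ext (Prod.ext (Category.comp_id p)
      (Category.comp_id q)))
  assoc f g h := by
    induction f using TensorHom.ind with | _ p q e =>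
    induction g using TensorHom.ind with | _ p' q' e' =>
    induction h using TensorHom.ind with | _ p'' q'' e'' =>
    exact congrArg (Quotient.mk _) (Subtype.ext (Prod.ext (Category.assoc p p' p'')
      (Category.assoc q q' q'')))
  inv_comp f := by
    induction f using TensorHom.ind with | _ p q e =>
    exact congrArg (Quotient.mk _) (Subtype.ext (Prod.ext (Groupoid.inv_comp p)
      (Groupoid.inv_comp q)))
  comp_inv f := by
    induction f using TensorHom.ind with | _ p q e =>
    exact congrArg (Quotient.mk _) (Subtype.ext (Prod.ext (Groupoid.comp_inv p)
      (Groupoid.comp_inv q)))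

/-- The arrow `p ⊗ q`, as an arrow of the groupoid. -/
def tens {a b : TensorPt 𝔜 𝔛} (p : a.fst ⟶ b.fst) (q : a.snd ⟶ b.snd)
    (h : 𝔜.deg p = 𝔛.deg q) : a ⟶ b := TensorHom.mk p q h

theorem tens_comp {a b c : TensorPt 𝔜 𝔛} (p : a.fst ⟶ b.fst) (q : a.snd ⟶ b.snd)
    (h : 𝔜.deg p = 𝔛.deg q) (p' : b.fst ⟶ c.fst) (q' : b.snd ⟶ c.snd)
    (h' : 𝔜.deg p' = 𝔛.deg q') :
    tens p q h ≫ tens p' q' h' = tens (a := a) (b := c) (p ≫ p') (q ≫ q')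
      (by rw [𝔜.deg_comp, 𝔛.deg_comp, h, h']) := rfl

theorem tens_id (a : TensorPt 𝔜 𝔛) :
    𝟙 a = tens (𝟙 a.fst) (𝟙 a.snd) (by rw [deg_id, deg_id]) := rfl

theorem exists_tens {a b : TensorPt 𝔜 𝔛} (t : a ⟶ b) : ∃ p q h, t = tens p q h := by
  induction t using TensorHom.ind with | _ p q e => exact ⟨p, q, e, rfl⟩

variable (𝔜 𝔛) in
/-- The tensor product of gerbes with metrics, with the product metric. -/
def tensor : Gerbe.{v, w} G where
  X := TensorPt 𝔜 𝔛
  deg := Quotient.lift (fun p => 𝔜.deg p.1.1) (by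
    rintro p q ⟨z, h1, -⟩
    rw [h1, deg_circ_comp])
  deg_smul f := by
    induction f using TensorHom.ind with | _ p q e =>
    refine TensorPt.ext (𝔜.deg_smul p) ?_
    change 𝔜.deg p • _ = _
    rw [e]
    exact 𝔛.deg_smul q
  deg_id a := 𝔜.deg_id _
  deg_comp f g := by
    induction f using TensorHom.ind with | _ p q e =>
    induction g using TensorHom.ind with | _ p' q' e' =>
    exact 𝔜.deg_comp p p'
  full g a b h := by
    obtain ⟨p, hp⟩ := 𝔜.full g a.fst b.fst (congrArg TensorPt.fst h)
    obtain ⟨q, hq⟩ := 𝔛.full g a.snd b.snd (congrArg TensorPt.snd h)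
    exact ⟨TensorHom.mk p q (hp.trans hq.symm), hp⟩
  circ a z := tens (𝔜.circ _ z) (𝟙 _) (by rw [deg_circ, deg_id])
  circ_mul a z z' := by
    rw [tens_comp]
    congr 1
    · exact 𝔜.circ_mul _ _ _
    · simp
  circ_inj a z z' h := by
    obtain ⟨c, h1, h2⟩ := Quotient.exact h
    change 𝔜.circ _ z = 𝔜.circ _ c ≫ 𝔜.circ _ z' at h1
    change 𝟙 _ = 𝔛.circ _ c ≫ 𝟙 _ at h2
    rw [Category.comp_id, ← circ_one] at h2
    rw [← 𝔛.circ_inj _ h2, circ_one, Category.id_comp] at h1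
    exact 𝔜.circ_inj _ h1
  deg_circ a z := 𝔜.deg_circ _ _
  circ_surj a f h := by
    induction f using TensorHom.ind with | _ p q e =>
    change 𝔜.deg p = 1 at h
    obtain ⟨z, rfl⟩ := 𝔜.circ_surj _ p h
    obtain ⟨z', rfl⟩ := 𝔛.circ_surj _ q (e.symm.trans h)
    refine ⟨z * z', Quotient.sound ⟨z', ?_, ?_⟩⟩
    · change 𝔜.circ _ (z * z') = 𝔜.circ _ z' ≫ 𝔜.circ _ z
      rw [← 𝔜.circ_mul, mul_comm]
    · change 𝔛.circ _ z' = 𝔛.circ _ z' ≫ 𝟙 _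
      rw [Category.comp_id]
  central {a b} f z := by
    obtain ⟨p, q, e, rfl⟩ := exists_tens f
    rw [tens_comp, tens_comp]
    congr 1
    · exact 𝔜.central _ _
    · simp
  k a := 𝔜.k a.fst * 𝔛.k a.snd
  k_pos a := mul_pos (𝔜.k_pos _) (𝔛.k_pos _)
  k_smul g a := by
    change 𝔜.k (g • a.fst) * 𝔛.k (g • a.snd) = _
    rw [𝔜.k_smul, 𝔛.k_smul]

end tensor

end Gerbe

/-! ### The homotopy category of gerbes -/

/-- A unitary equivariant vector bundle over a gerbe: a functor to finite-dimensional Hilbert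
spaces with unitary maps, on which the central `U(1)` acts by scalars. -/
structure GerbeBundle (𝔛 : Gerbe.{v, w} G) extends UnitaryBundle.{w, w, w} 𝔛.X where
  map_circ : ∀ (i : 𝔛.X) (z : Circle) (ψ : fib i), map (𝔛.circ i z) ψ = (z : ℂ) • ψ

/-- 1-morphisms `𝔛 → 𝔜` of gerbes: unitary equivariant vector bundles over the tensor product of
`𝔜` with the conjugate of `𝔛`. -/
abbrev GerbeHom (𝔛 𝔜 : Gerbe.{v, w} G) := GerbeBundle (𝔜.tensor 𝔛.conj)

namespace GerbeHom

open Gerbe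

/-- The object `(μ, i)` of the tensor product of `𝔜` with the conjugate of `𝔛`. -/
abbrev pt {𝔛 𝔜 : Gerbe.{v, w} G} (μ : 𝔜.X) (i : 𝔛.X) : (𝔜.tensor 𝔛.conj).X :=
  (⟨μ, i⟩ : TensorPt 𝔜 𝔛.conj)

/-- The arrow `p ⊗ q : (μ, i) ⟶ (ν, j)` of the tensor product of `𝔜` with the conjugate
of `𝔛`. -/
def arr {𝔛 𝔜 : Gerbe.{v, w} G} {μ ν : 𝔜.X} {i j : 𝔛.X} (p : μ ⟶ ν) (q : i ⟶ j)
    (h : 𝔜.deg p = 𝔛.deg q) : (pt μ i : (𝔜.tensor 𝔛.conj).X) ⟶ pt ν j :=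
  tens (𝔜 := 𝔜) (𝔛 := 𝔛.conj) (a := ⟨μ, i⟩) (b := ⟨ν, j⟩) p q h

variable {𝔚 𝔛 𝔜 𝔷 : Gerbe.{v, w} G}

theorem exists_arr {μ ν : 𝔜.X} {i j : 𝔛.X}
    (t : (pt μ i : (𝔜.tensor 𝔛.conj).X) ⟶ pt ν j) : ∃ p q h, t = arr p q h :=
  exists_tens (𝔜 := 𝔜) (𝔛 := 𝔛.conj) t

theorem arr_comp {μ ν κ : 𝔜.X} {i j l : 𝔛.X} (p : μ ⟶ ν) (q : i ⟶ j)
    (h : 𝔜.deg p = 𝔛.deg q) (p' : ν ⟶ κ) (q' : j ⟶ l) (h' : 𝔜.deg p' = 𝔛.deg q') :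
    arr p q h ≫ arr p' q' h' = arr (p ≫ p') (q ≫ q')
      (by rw [𝔜.deg_comp, 𝔛.deg_comp, h, h']) := rfl

theorem arr_id (μ : 𝔜.X) (i : 𝔛.X) :
    arr (𝟙 μ) (𝟙 i) (by rw [deg_id, deg_id]) = 𝟙 (pt μ i : (𝔜.tensor 𝔛.conj).X) := rfl

variable (E : GerbeHom 𝔛 𝔜)

theorem map_circ_left {μ ν : 𝔜.X} {i j : 𝔛.X} (p : μ ⟶ ν) (q : i ⟶ j)
    (h : 𝔜.deg p = 𝔛.deg q) (z : Circle) (h' : 𝔜.deg (𝔜.circ μ z ≫ p) = 𝔛.deg q)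
    (ψ : E.fib (pt μ i)) :
    E.map (arr (𝔜.circ μ z ≫ p) q h') ψ = (z : ℂ) • E.map (arr p q h) ψ := by
  have : arr (𝔜.circ μ z ≫ p) q h' = (𝔜.tensor 𝔛.conj).circ (pt μ i) z ≫ arr p q h := by
    change _ = arr (𝔜.circ μ z) (𝟙 i) (by rw [deg_circ, deg_id]) ≫ _
    rw [arr_comp]
    congr 1
    simp
  rw [this, E.map_comp, E.map_circ, LinearIsometry.map_smul]

theorem map_circ_right {μ ν : 𝔜.X} {i j : 𝔛.X} (p : μ ⟶ ν) (q : i ⟶ j)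
    (h : 𝔜.deg p = 𝔛.deg q) (z : Circle) (h' : 𝔜.deg p = 𝔛.deg (𝔛.circ i z ≫ q))
    (ψ : E.fib (pt μ i)) :
    E.map (arr p (𝔛.circ i z ≫ q) h') ψ = ((z⁻¹ : Circle) : ℂ) • E.map (arr p q h) ψ := by
  have h'' : 𝔜.deg (𝔜.circ μ z⁻¹ ≫ p) = 𝔛.deg q := by rw [deg_circ_comp, h]
  rw [← map_circ_left E p q h z⁻¹ h'']
  congr 2
  have := TensorHom.mk_circ (𝔜 := 𝔜) (𝔛 := 𝔛.conj) (a := ⟨μ, i⟩) (b := ⟨ν, j⟩) p q h z⁻¹ h''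
    (by
      change _ = 𝔛.deg (𝔛.circ i z⁻¹⁻¹ ≫ q)
      rw [deg_circ_comp, h])
  have e : (𝔛.conj.circ i z⁻¹ : i ⟶ i) = 𝔛.circ i z := by
    change 𝔛.circ i z⁻¹⁻¹ = _
    rw [inv_inv]
  refine Eq.trans ?_ this.symm
  change TensorHom.mk _ _ _ = TensorHom.mk _ _ _
  congr 1
  exact congrArg (fun t => t ≫ q) e.symm

end GerbeHom

namespace GerbeHom

open Gerbe

variable {𝔚 𝔛 𝔜 𝔷 : Gerbe.{v, w} G}

instance (𝔛 : Gerbe.{v, w} G) : Fintype 𝔛.X := Fintype.ofFinite _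

/-- The first component of an object of the tensor product. -/
abbrev fstPt (a : (𝔷.tensor 𝔛.conj).X) : 𝔷.X := TensorPt.fst (𝔜 := 𝔷) (𝔛 := 𝔛.conj) a

/-- The second component of an object of the tensor product. -/
abbrev sndPt (a : (𝔷.tensor 𝔛.conj).X) : 𝔛.X := TensorPt.snd (𝔜 := 𝔷) (𝔛 := 𝔛.conj) a

section comp

variable (E : GerbeHom 𝔛 𝔜) (E' : GerbeHom 𝔜 𝔷)

/-- The map `E'(v ⊗ p) ⊗ E(p ⊗ q)`. -/
def twist {κ κ' : 𝔷.X} {μ ν : 𝔜.X} {i j : 𝔛.X} (v : κ ⟶ κ') (p : μ ⟶ ν) (q : i ⟶ j)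
    (hv : 𝔷.deg v = 𝔜.deg p) (hq : 𝔜.deg p = 𝔛.deg q) :
    E'.fib (pt κ μ) ⊗[ℂ] E.fib (pt μ i) →ₗᵢ[ℂ] E'.fib (pt κ' ν) ⊗[ℂ] E.fib (pt ν j) :=
  TensorProduct.mapIsometry (E'.map (arr v p hv)) (E.map (arr p q hq))

theorem twist_tmul {κ κ' : 𝔷.X} {μ ν : 𝔜.X} {i j : 𝔛.X} (v : κ ⟶ κ') (p : μ ⟶ ν) (q : i ⟶ j)
    (hv : 𝔷.deg v = 𝔜.deg p) (hq : 𝔜.deg p = 𝔛.deg q) (x : E'.fib (pt κ μ))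
    (y : E.fib (pt μ i)) :
    twist E E' v p q hv hq (x ⊗ₜ y) = E'.map (arr v p hv) x ⊗ₜ E.map (arr p q hq) y := rfl

/-- The choice of `p` does not matter. -/
theorem twist_indep {κ κ' : 𝔷.X} {μ ν : 𝔜.X} {i j : 𝔛.X} {v v' : κ ⟶ κ'} {p p' : μ ⟶ ν}
    {q q' : i ⟶ j} (hv : 𝔷.deg v = 𝔜.deg p) (hq : 𝔜.deg p = 𝔛.deg q)
    (hv' : 𝔷.deg v' = 𝔜.deg p') (hq' : 𝔜.deg p' = 𝔛.deg q')
    (h : (arr v q (hv.trans hq) : (pt κ i : (𝔷.tensor 𝔛.conj).X) ⟶ pt κ' j) =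
      arr v' q' (hv'.trans hq')) (t : E'.fib (pt κ μ) ⊗[ℂ] E.fib (pt μ i)) :
    twist E E' v p q hv hq t = twist E E' v' p' q' hv' hq' t := by
  obtain ⟨z, h1, h2⟩ := Quotient.exact h
  change v = 𝔷.circ _ z ≫ v' at h1
  change q' = 𝔛.circ _ z⁻¹ ≫ q at h2
  have h3 : q = 𝔛.circ _ z ≫ q' := by
    rw [h2, circ_comp, mul_inv_cancel, circ_one, Category.id_comp]
  have hd : 𝔜.deg p = 𝔜.deg p' := by
    rw [hq, hq', h3, deg_circ_comp]
  obtain ⟨c, rfl⟩ := 𝔜.exists_circ p p' hd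
  subst h1 h3
  have hs : (c * z⁻¹) * (z * c⁻¹) = 1 := by
    rw [mul_assoc, inv_mul_cancel_left, mul_inv_cancel]
  have hs' := congrArg (fun t : Circle => (t : ℂ)) hs
  simp only [Circle.coe_mul, Circle.coe_one] at hs'
  induction t using TensorProduct.induction_on with
  | zero => simp
  | add x y hx hy => rw [map_add, map_add, hx, hy]
  | tmul x y =>
    rw [twist_tmul, twist_tmul,
      map_circ_left E' v' (𝔜.circ μ c ≫ p') (by rw [hv', deg_circ_comp]) z,
      map_circ_right E' v' p' hv' c,
      map_circ_left E p' (𝔛.circ i z ≫ q') (by rw [hq', deg_circ_comp]) c,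
      map_circ_right E p' q' hq' z]
    simp only [TensorProduct.smul_tmul', TensorProduct.tmul_smul, smul_smul]
    refine (congrArg (fun t : ℂ => (t • E'.map (arr v' p' hv') x) ⊗ₜ[ℂ] E.map (arr p' q' hq') y)
      hs').trans ?_
    exact congrArg (fun t => t ⊗ₜ[ℂ] E.map (arr p' q' hq') y) (one_smul ℂ _)

/-- The fibre `⨁ μ, E'(κ, μ) ⊗ E(μ, i)` of the composite. -/
def CompFib (a : (𝔷.tensor 𝔛.conj).X) : Type w :=
  ∀ μ : 𝔜.X, E'.fib (pt (fstPt a) μ) ⊗[ℂ] E.fib (pt μ (sndPt a))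

instance (a : (𝔷.tensor 𝔛.conj).X) : AddCommGroup (CompFib E E' a) :=
  inferInstanceAs (AddCommGroup (∀ μ : 𝔜.X,
    E'.fib (pt (fstPt a) μ) ⊗[ℂ] E.fib (pt μ (sndPt a))))

instance (a : (𝔷.tensor 𝔛.conj).X) : Module ℂ (CompFib E E' a) :=
  inferInstanceAs (Module ℂ (∀ μ : 𝔜.X,
    E'.fib (pt (fstPt a) μ) ⊗[ℂ] E.fib (pt μ (sndPt a))))

instance (a : (𝔷.tensor 𝔛.conj).X) : FiniteDimensional ℂ (CompFib E E' a) :=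
  inferInstanceAs (FiniteDimensional ℂ (∀ μ : 𝔜.X,
    E'.fib (pt (fstPt a) μ) ⊗[ℂ] E.fib (pt μ (sndPt a))))

/-- The inner product on the fibre: the summand at `μ` is weighted by `k μ`. -/
@[reducible]
def compCore (a : (𝔷.tensor 𝔛.conj).X) : InnerProductSpace.Core ℂ (CompFib E E' a) :=
  weightedCore (V := fun μ : 𝔜.X =>
    E'.fib (pt (fstPt a) μ) ⊗[ℂ] E.fib (pt μ (sndPt a))) 𝔜.k 𝔜.k_pos

instance (a : (𝔷.tensor 𝔛.conj).X) : NormedAddCommGroup (CompFib E E' a) :=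
  (compCore E E' a).toNormedAddCommGroup

instance (a : (𝔷.tensor 𝔛.conj).X) : InnerProductSpace ℂ (CompFib E E' a) :=
  InnerProductSpace.ofCore (compCore E E' a).toCore

/-- An arrow of `𝔜` ending at `ν` of the degree of a given arrow of the tensor product. -/
theorem exists_lift {a b : (𝔷.tensor 𝔛.conj).X} (t : a ⟶ b) (ν : 𝔜.X) :
    ∃ (v : fstPt a ⟶ fstPt b) (p : ((𝔷.tensor 𝔛.conj).deg t)⁻¹ • ν ⟶ ν)
      (q : (sndPt a) ⟶ sndPt b) (hv : 𝔷.deg v = 𝔜.deg p)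
      (hq : 𝔜.deg p = 𝔛.deg q),
      t = arr (μ := fstPt a) (ν := fstPt b) v q (hv.trans hq) := by
  obtain ⟨v, q, h, rfl⟩ := exists_arr (𝔜 := 𝔷) (𝔛 := 𝔛) (μ := fstPt a)
    (i := sndPt a) (ν := fstPt b) (j := sndPt b) t
  obtain ⟨p, hp⟩ := 𝔜.full (𝔷.deg v) ((𝔷.deg v)⁻¹ • ν) ν (smul_inv_smul _ _)
  exact ⟨v, p, q, hp.symm, hp.trans h, rfl⟩

/-- The action of an arrow `v ⊗ q` on the composite: the component at `ν` is
`E'(v ⊗ p) ⊗ E(p ⊗ q)`, for any `p : μ ⟶ ν` of the same degree, applied to the component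
at `μ`. -/
def compFun {a b : (𝔷.tensor 𝔛.conj).X} (t : a ⟶ b) (x : CompFib E E' a) : CompFib E E' b :=
  fun ν =>
    let hv := exists_lift t ν
    let hp := hv.choose_spec
    let hq := hp.choose_spec
    let h1 := hq.choose_spec
    twist E E' hv.choose hp.choose hq.choose h1.choose h1.choose_spec.choose (x _)

variable {E E'}

theorem compFun_apply {κ κ' : 𝔷.X} {μ ν : 𝔜.X} {i j : 𝔛.X} (v : κ ⟶ κ') (p : μ ⟶ ν) (q : i ⟶ j)
    (hv : 𝔷.deg v = 𝔜.deg p) (hq : 𝔜.deg p = 𝔛.deg q) (x : CompFib E E' (pt κ i)) :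
    compFun E E' (arr v q (hv.trans hq)) x ν = twist E E' v p q hv hq (x μ) := by
  generalize ht : (arr v q (hv.trans hq) : (pt κ i : (𝔷.tensor 𝔛.conj).X) ⟶ pt κ' j) = t
  have hμ : μ = ((𝔷.tensor 𝔛.conj).deg t)⁻¹ • ν := by
    rw [← ht]
    change μ = (𝔷.deg v)⁻¹ • ν
    rw [hv]
    exact (eq_inv_smul_iff).2 (𝔜.deg_smul p)
  subst hμ
  have h := exists_lift (𝔜 := 𝔜) t ν
  exact twist_indep E E' _ _ _ _
    (h.choose_spec.choose_spec.choose_spec.choose_spec.choose_spec.symm.trans ht.symm) _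

theorem twist_comp {κ κ' κ'' : 𝔷.X} {μ ν ξ : 𝔜.X} {i j l : 𝔛.X} {v : κ ⟶ κ'} {p : μ ⟶ ν}
    {q : i ⟶ j} {v' : κ' ⟶ κ''} {p' : ν ⟶ ξ} {q' : j ⟶ l}
    (hv : 𝔷.deg v = 𝔜.deg p) (hq : 𝔜.deg p = 𝔛.deg q) (hv' : 𝔷.deg v' = 𝔜.deg p')
    (hq' : 𝔜.deg p' = 𝔛.deg q') (hv'' : 𝔷.deg (v ≫ v') = 𝔜.deg (p ≫ p'))
    (hq'' : 𝔜.deg (p ≫ p') = 𝔛.deg (q ≫ q')) (t : E'.fib (pt κ μ) ⊗[ℂ] E.fib (pt μ i)) :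
    twist E E' (v ≫ v') (p ≫ p') (q ≫ q') hv'' hq'' t =
      twist E E' v' p' q' hv' hq' (twist E E' v p q hv hq t) := by
  induction t using TensorProduct.induction_on with
  | zero => simp
  | add x y hx hy => simp only [map_add, hx, hy]
  | tmul x y =>
    simp only [twist_tmul]
    rw [← arr_comp v p hv v' p' hv', ← arr_comp p q hq p' q' hq', E'.map_comp, E.map_comp]

/-- An arrow of degree `g` starting at a given point. -/
theorem exists_from (g : G) (μ : 𝔜.X) : ∃ p : μ ⟶ g • μ, 𝔜.deg p = g := 𝔜.full g μ _ rfl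

theorem exists_to (g : G) (ν : 𝔜.X) : ∃ p : g⁻¹ • ν ⟶ ν, 𝔜.deg p = g :=
  𝔜.full g _ ν (smul_inv_smul _ _)

variable (E E')

/-- The composite `E' ∘ E` of 1-morphisms of gerbes. -/
def comp : GerbeHom 𝔛 𝔷 where
  fib := CompFib E E'
  map {a b} t := LinearMap.isometryOfInner
    { toFun := compFun E E' t
      map_add' := fun x y => funext fun ν => map_add (twist E E' _ _ _ _ _) _ _
      map_smul' := fun c x => funext fun ν => map_smul (twist E E' _ _ _ _ _) _ _ }
    (fun x y => by
      change ∑ ν : 𝔜.X, (𝔜.k ν : ℂ) * Inner.inner ℂ (compFun E E' t x ν) (compFun E E' t y ν) =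
        ∑ μ : 𝔜.X, (𝔜.k μ : ℂ) * Inner.inner ℂ (x μ) (y μ)
      refine Eq.trans ?_ (Equiv.sum_comp (MulAction.toPerm ((𝔷.tensor 𝔛.conj).deg t)⁻¹)
        (fun μ : 𝔜.X => (𝔜.k μ : ℂ) * Inner.inner ℂ (x μ) (y μ)))
      refine Finset.sum_congr rfl fun ν _ => ?_
      rw [MulAction.toPerm_apply, 𝔜.k_smul]
      exact congrArg (fun t => (𝔜.k ν : ℂ) * t)
        (LinearIsometry.inner_map_map (twist E E' _ _ _ _ _) _ _))
  map_id a x := by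
    funext ν
    refine (compFun_apply (κ := fstPt a) (i := sndPt a) (𝟙 _) (𝟙 ν) (𝟙 _)
      (by rw [deg_id, deg_id]) (by rw [deg_id, deg_id]) x).trans ?_
    generalize x ν = t
    induction t using TensorProduct.induction_on with
    | zero => simp
    | add x y hx hy => rw [map_add, hx, hy]
    | tmul x y => rw [twist_tmul, arr_id, arr_id, E'.map_id, E.map_id]
  map_comp {a b c} s t x := by
    obtain ⟨v, q, h, rfl⟩ := exists_arr (𝔜 := 𝔷) (𝔛 := 𝔛) (μ := fstPt a)
      (i := sndPt a) (ν := fstPt b) (j := sndPt b) s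
    obtain ⟨v', q', h', rfl⟩ := exists_arr (𝔜 := 𝔷) (𝔛 := 𝔛) (μ := fstPt b)
      (i := sndPt b) (ν := fstPt c) (j := sndPt c) t
    funext ξ
    obtain ⟨p', hp'⟩ := exists_to (𝔷.deg v') ξ
    obtain ⟨p, hp⟩ := exists_to (𝔷.deg v) ((𝔷.deg v')⁻¹ • ξ)
    have hc : 𝔷.deg (v ≫ v') = 𝔜.deg (p ≫ p') := by
      rw [deg_comp, deg_comp, hp, hp']
    have hc' : 𝔜.deg (p ≫ p') = 𝔛.deg (q ≫ q') := by
      rw [deg_comp, deg_comp, hp, hp', h, h']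
    refine (compFun_apply (v ≫ v') (p ≫ p') (q ≫ q') hc hc' x).trans ?_
    refine Eq.trans ?_ (compFun_apply v' p' q' hp'.symm (hp'.trans h') _).symm
    refine (twist_comp hp.symm (hp.trans h) hp'.symm (hp'.trans h') hc hc' _).trans ?_
    congr 1
    exact (compFun_apply v p q hp.symm (hp.trans h) x).symm
  map_circ a z x := by
    funext ν
    refine (compFun_apply (κ := fstPt a) (i := sndPt a) (𝔷.circ _ z) (𝟙 ν) (𝟙 _)
      (by rw [deg_circ, deg_id]) (by rw [deg_id, deg_id]) x).trans ?_
    change _ = (z : ℂ) • x ν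
    generalize x ν = t
    induction t using TensorProduct.induction_on with
    | zero => simp
    | add x y hx hy => rw [map_add, hx, hy, smul_add]
    | tmul x y =>
      rw [twist_tmul, arr_id, E.map_id, TensorProduct.smul_tmul']
      congr 1
      exact E'.map_circ (pt _ ν) z x

end comp

end GerbeHom

/-! ### The homotopy category of gerbes -/

namespace GerbeHom

open Gerbe

variable {𝔚 𝔛 𝔜 𝔷 : Gerbe.{v, w} G}

/-- Isomorphism of 1-morphisms of gerbes: isomorphism of vector bundles. -/
def Isomorphic (E F : GerbeHom 𝔛 𝔜) : Prop := Nonempty (E.toUnitaryBundle ≅ F.toUnitaryBundle)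

theorem Isomorphic.of_equiv {E F : GerbeHom 𝔛 𝔜} (e : ∀ a, E.fib a ≃ₗ[ℂ] F.fib a)
    (h : ∀ {a b : (𝔜.tensor 𝔛.conj).X} (t : a ⟶ b) (x : E.fib a),
      e b (E.map t x) = F.map t (e a x)) : Isomorphic E F :=
  ⟨{ hom := (⟨fun a => (e a).toLinearMap, fun t x => h t x⟩ :
        UnitaryBundle.Hom E.toUnitaryBundle F.toUnitaryBundle)
     inv := (⟨fun a => (e a).symm.toLinearMap, fun {a b} t x => by
        change (e b).symm (F.map t x) = E.map t ((e a).symm x)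
        rw [LinearEquiv.symm_apply_eq, h, LinearEquiv.apply_symm_apply]⟩ :
        UnitaryBundle.Hom F.toUnitaryBundle E.toUnitaryBundle)
     hom_inv_id := UnitaryBundle.Hom.ext (funext fun a => LinearMap.ext fun x =>
        (e a).symm_apply_apply x)
     inv_hom_id := UnitaryBundle.Hom.ext (funext fun a => LinearMap.ext fun x =>
        (e a).apply_symm_apply x) }⟩

theorem Isomorphic.of_equiv_arr {E F : GerbeHom 𝔛 𝔜} (e : ∀ μ i, E.fib (pt μ i) ≃ₗ[ℂ] F.fib (pt μ i))
    (h : ∀ {μ ν : 𝔜.X} {i j : 𝔛.X} (p : μ ⟶ ν) (q : i ⟶ j) (hd : 𝔜.deg p = 𝔛.deg q)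
      (x : E.fib (pt μ i)),
      e ν j (E.map (arr p q hd) x) = F.map (arr p q hd) (e μ i x)) : Isomorphic E F := by
  refine Isomorphic.of_equiv (fun a => e (fstPt a) (sndPt a)) fun {a b} t x => ?_
  obtain ⟨v, q, hd, rfl⟩ := exists_arr (𝔜 := 𝔜) (𝔛 := 𝔛) (μ := fstPt a)
      (i := sndPt a) (ν := fstPt b) (j := sndPt b) t
  exact h v q hd x

theorem Isomorphic.exists_equiv {E F : GerbeHom 𝔛 𝔜} (h : Isomorphic E F) :
    ∃ e : ∀ a, E.fib a ≃ₗ[ℂ] F.fib a, ∀ (a b : (𝔜.tensor 𝔛.conj).X) (t : a ⟶ b) (x : E.fib a),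
      e b (E.map t x) = F.map t (e a x) := by
  obtain ⟨i⟩ := h
  refine ⟨fun a => LinearEquiv.ofLinearMap (UnitaryBundle.Hom.app i.hom a)
    (UnitaryBundle.Hom.app i.inv a) ?_ ?_, fun a b t x => UnitaryBundle.Hom.naturality i.hom t x⟩
  · exact congrFun (congrArg UnitaryBundle.Hom.app i.inv_hom_id) a
  · exact congrFun (congrArg UnitaryBundle.Hom.app i.hom_inv_id) a

instance setoid (𝔛 𝔜 : Gerbe.{v, w} G) : Setoid (GerbeHom 𝔛 𝔜) where
  r := Isomorphic
  iseqv := ⟨fun _ => ⟨Iso.refl _⟩, fun ⟨i⟩ => ⟨i.symm⟩, fun ⟨i⟩ ⟨j⟩ => ⟨i.trans j⟩⟩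

theorem Isomorphic.comp {E F : GerbeHom 𝔛 𝔜} {E' F' : GerbeHom 𝔜 𝔷} (h : Isomorphic E F)
    (h' : Isomorphic E' F') : Isomorphic (E.comp E') (F.comp F') := by
  obtain ⟨e, he⟩ := h.exists_equiv
  obtain ⟨e', he'⟩ := h'.exists_equiv
  refine Isomorphic.of_equiv_arr (fun κ i => LinearEquiv.piCongrRight fun μ =>
    TensorProduct.congr (e' (pt κ μ)) (e (pt μ i))) fun {κ κ' i i'} v q h x => ?_
  funext ν
  obtain ⟨p, hp⟩ := exists_to (𝔷.deg v) ν
  refine Eq.trans ?_ (compFun_apply (E := F) (E' := F') v p q hp.symm (hp.trans h) _).symm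
  change (TensorProduct.congr _ _) (compFun E E' (arr v q h) x ν) = _
  rw [compFun_apply v p q hp.symm (hp.trans h) x]
  change _ = twist F F' v p q hp.symm (hp.trans h) ((TensorProduct.congr _ _) (x _))
  generalize x _ = s
  induction s using TensorProduct.induction_on with
  | zero => simp
  | add x y hx hy => simp only [map_add, hx, hy]
  | tmul x y =>
    rw [twist_tmul, TensorProduct.congr_tmul, TensorProduct.congr_tmul, twist_tmul, he, he']

/-! The identity 1-morphism. -/

/-- The map `b ↦ v⁻¹ b u` on arrows of degree `1`. -/
def idTor {i i' j j' : 𝔛.X} (v : j ⟶ j') (u : i ⟶ i') (h : 𝔛.deg v = 𝔛.deg u)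
    (b : 𝔛.Tor 1 i' j') : 𝔛.Tor 1 i j :=
  ⟨u ≫ b.1 ≫ Groupoid.inv v, by
    rw [𝔛.deg_comp, 𝔛.deg_comp, 𝔛.deg_inv, b.2, h]; group⟩

/-- The map `F ↦ F(v⁻¹ · u)` between lines. -/
def idMap {i i' j j' : 𝔛.X} (v : j ⟶ j') (u : i ⟶ i') (h : 𝔛.deg v = 𝔛.deg u) :
    𝔛.Line 1 i j →ₗᵢ[ℂ] 𝔛.Line 1 i' j' :=
  Line.pull (idTor v u h) (fun z p q e => by
    change u ≫ q.1 ≫ _ = 𝔛.circ i z ≫ u ≫ p.1 ≫ _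
    rw [e, Category.assoc, ← Category.assoc u, ← 𝔛.central, Category.assoc])
    (fun ⟨b⟩ => ⟨⟨Groupoid.inv u ≫ b.1 ≫ v, by
      rw [𝔛.deg_comp, 𝔛.deg_comp, 𝔛.deg_inv, b.2, h]; group⟩⟩)

theorem idMap_apply {i i' j j' : 𝔛.X} (v : j ⟶ j') (u : i ⟶ i') (h : 𝔛.deg v = 𝔛.deg u)
    (F : 𝔛.Line 1 i j) (b : 𝔛.Tor 1 i' j') : (idMap v u h F).1 b = F.1 (idTor v u h b) := rfl

theorem idMap_indep {i i' j j' : 𝔛.X} {v v' : j ⟶ j'} {u u' : i ⟶ i'} (h : 𝔛.deg v = 𝔛.deg u)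
    (h' : 𝔛.deg v' = 𝔛.deg u')
    (e : (arr v u h : (pt j i : (𝔛.tensor 𝔛.conj).X) ⟶ pt j' i') = arr v' u' h')
    (F : 𝔛.Line 1 i j) : idMap v u h F = idMap v' u' h' F := by
  obtain ⟨z, h1, h2⟩ := Quotient.exact e
  change v = 𝔛.circ _ z ≫ v' at h1
  change u' = 𝔛.circ _ z⁻¹ ≫ u at h2
  have h3 : u = 𝔛.circ _ z ≫ u' := by
    rw [h2, circ_comp, mul_inv_cancel, circ_one, Category.id_comp]
  subst h1 h3
  refine Line.ext fun b => congrArg F.1 (Subtype.ext ?_)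
  change (𝔛.circ i z ≫ u') ≫ b.1 ≫ Groupoid.inv (𝔛.circ j z ≫ v') = u' ≫ b.1 ≫ Groupoid.inv v'
  have : Groupoid.inv (𝔛.circ j z ≫ v') = Groupoid.inv v' ≫ 𝔛.circ j z⁻¹ := by
    rw [← 𝔛.inv_circ]; simp
  have h4 := 𝔛.central (u' ≫ b.1 ≫ Groupoid.inv v') z⁻¹
  rw [this]
  calc (𝔛.circ i z ≫ u') ≫ b.1 ≫ Groupoid.inv v' ≫ 𝔛.circ j z⁻¹
      = 𝔛.circ i z ≫ (u' ≫ b.1 ≫ Groupoid.inv v') ≫ 𝔛.circ j z⁻¹ := by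
        simp only [Category.assoc]
    _ = u' ≫ b.1 ≫ Groupoid.inv v' := by
        rw [← h4, 𝔛.circ_comp, mul_inv_cancel, circ_one, Category.id_comp]

/-- The action of an arrow `v ⊗ u` on the identity 1-morphism. -/
def idFun {a b : (𝔛.tensor 𝔛.conj).X} (t : a ⟶ b) :
    𝔛.Line 1 (sndPt a) (fstPt a) →ₗᵢ[ℂ] 𝔛.Line 1 (sndPt b) (fstPt b) :=
  let hv := exists_arr (𝔜 := 𝔛) (𝔛 := 𝔛) (μ := fstPt a) (i := sndPt a) (ν := fstPt b)
      (j := sndPt b) t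
  idMap hv.choose hv.choose_spec.choose hv.choose_spec.choose_spec.choose

theorem idFun_arr {i i' j j' : 𝔛.X} (v : j ⟶ j') (u : i ⟶ i') (h : 𝔛.deg v = 𝔛.deg u)
    (F : 𝔛.Line 1 i j) :
    idFun (arr v u h : (pt j i : (𝔛.tensor 𝔛.conj).X) ⟶ pt j' i') F = idMap v u h F := by
  have hv := exists_arr (arr v u h : (pt j i : (𝔛.tensor 𝔛.conj).X) ⟶ pt j' i')
  exact idMap_indep _ _ hv.choose_spec.choose_spec.choose_spec.symm F

variable (𝔛) in
/-- The identity 1-morphism: the fibre at `(j, i)` is the line of the torsor of arrows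
`i ⟶ j` of degree `1` (which is zero if `i ≠ j`), and `v ⊗ u` acts by `b ↦ v b u⁻¹`. -/
def id : GerbeHom 𝔛 𝔛 where
  fib a := 𝔛.Line 1 (sndPt a) (fstPt a)
  map t := idFun t
  map_id a F := by
    refine (idFun_arr (𝟙 (fstPt a)) (𝟙 (sndPt a)) (by rw [deg_id, deg_id]) F).trans ?_
    refine Line.ext fun b => congrArg F.1 (Subtype.ext ?_)
    change 𝟙 _ ≫ b.1 ≫ Groupoid.inv (𝟙 _) = b.1
    simp
  map_comp {a b c} s t F := by
    obtain ⟨v, q, h, rfl⟩ := exists_arr (𝔜 := 𝔛) (𝔛 := 𝔛) (μ := fstPt a)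
      (i := sndPt a) (ν := fstPt b) (j := sndPt b) s
    obtain ⟨v', q', h', rfl⟩ := exists_arr (𝔜 := 𝔛) (𝔛 := 𝔛) (μ := fstPt b)
      (i := sndPt b) (ν := fstPt c) (j := sndPt c) t
    refine (idFun_arr (v ≫ v') (q ≫ q') (by rw [deg_comp, deg_comp, h, h']) F).trans ?_
    refine Eq.trans ?_ (idFun_arr v' q' h' _).symm
    refine Eq.trans ?_ (congrArg (idMap v' q' h') (idFun_arr v q h F).symm)
    refine Line.ext fun b => congrArg F.1 (Subtype.ext ?_)
    change (q ≫ q') ≫ b.1 ≫ Groupoid.inv (v ≫ v') =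
      q ≫ (q' ≫ b.1 ≫ Groupoid.inv v') ≫ Groupoid.inv v
    simp
  map_circ a z F := by
    refine (idFun_arr (𝔛.circ (fstPt a) z) (𝟙 (sndPt a)) (by rw [deg_circ, deg_id]) F).trans ?_
    refine Line.ext fun b => ?_
    refine (F.2 z⁻¹ b (idTor _ _ _ b) ?_).trans ?_
    · change 𝟙 _ ≫ b.1 ≫ Groupoid.inv (𝔛.circ _ z) = 𝔛.circ _ z⁻¹ ≫ b.1
      rw [𝔛.inv_circ, 𝔛.central, Category.id_comp]
    · change _ = (z : ℂ) * F.1 b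
      rw [Circle.coe_inv_eq_conj, Complex.conj_conj]

theorem id_map {i i' j j' : 𝔛.X} (v : j ⟶ j') (u : i ⟶ i') (h : 𝔛.deg v = 𝔛.deg u)
    (F : 𝔛.Line 1 i j) : (id 𝔛).map (arr v u h : (pt j i : (𝔛.tensor 𝔛.conj).X) ⟶ pt j' i') F =
      idMap v u h F := idFun_arr v u h F

end GerbeHom

namespace GerbeHom

open Gerbe

variable {𝔚 𝔛 𝔜 𝔷 : Gerbe.{v, w} G}

/-! The unit isomorphisms. -/

/-- Evaluation at the identity arrow. -/
def lineEv (i : 𝔛.X) : 𝔛.Line 1 i i ≃ₗ[ℂ] ℂ :=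
  LinearEquiv.ofBijective
    ({ toFun := fun F => F.1 ⟨𝟙 i, 𝔛.deg_id i⟩
       map_add' := fun _ _ => rfl
       map_smul' := fun _ _ => rfl } : 𝔛.Line 1 i i →ₗ[ℂ] ℂ)
    ⟨(LinearMap.ker_eq_bot (f := _)).1 (LinearMap.ker_eq_bot'.2 fun F h =>
        Line.eq_zero_of F ⟨𝟙 i, 𝔛.deg_id i⟩ h),
      fun c => ⟨Line.tmul ⟨𝟙 i, 𝔛.deg_id i⟩ c, Line.tmul_apply _ _⟩⟩

theorem lineEv_apply (i : 𝔛.X) (F : 𝔛.Line 1 i i) :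
    lineEv i F = F.1 ⟨𝟙 i, 𝔛.deg_id i⟩ := rfl

theorem lineEv_idMap {i i' : 𝔛.X} (u : i ⟶ i') (F : 𝔛.Line 1 i i) :
    lineEv i' (idMap u u rfl F) = lineEv i F := by
  change F.1 (idTor u u rfl _) = F.1 _
  refine congrArg F.1 (Subtype.ext ?_)
  change u ≫ 𝟙 _ ≫ Groupoid.inv u = 𝟙 _
  simp

/-- Evaluation at the identity arrow, on the fibres of the identity 1-morphism. -/
def idEv (i : 𝔛.X) : (id 𝔛).fib (pt i i) ≃ₗ[ℂ] ℂ := lineEv i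

theorem idEv_map {i i' : 𝔛.X} (u : i ⟶ i') (F : (id 𝔛).fib (pt i i)) :
    idEv i' ((id 𝔛).map (arr u u rfl) F) = idEv i F :=
  (congrArg (lineEv i') (id_map u u rfl F)).trans (lineEv_idMap u F)

theorem id_subsingleton {i j : 𝔛.X} (h : i ≠ j) : Subsingleton ((id 𝔛).fib (pt j i)) :=
  ⟨fun (F F' : 𝔛.Line 1 i j) => Line.ext fun p => absurd (by
    have := 𝔛.deg_smul p.1
    rwa [p.2, one_smul] at this) h⟩

open Classical in
/-- A product of modules all of which but one are zero. -/
def projEquiv {ι : Type u} {V : ι → Type w} [∀ i, AddCommGroup (V i)] [∀ i, Module ℂ (V i)]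
    (i : ι) (h : ∀ j, j ≠ i → Subsingleton (V j)) : (∀ j, V j) ≃ₗ[ℂ] V i :=
  LinearEquiv.ofBijective (LinearMap.proj i)
    ⟨fun x y e => funext fun j => by
      by_cases hj : j = i
      · subst hj; exact e
      · have := h j hj
        exact Subsingleton.elim _ _,
      fun c => ⟨Pi.single i c, Pi.single_eq_same i c⟩⟩

theorem tensor_subsingleton_right {M N : Type w} [AddCommGroup M] [AddCommGroup N] [Module ℂ M]
    [Module ℂ N] [Subsingleton N] : Subsingleton (M ⊗[ℂ] N) := by
  refine subsingleton_of_forall_eq 0 fun t => ?_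
  induction t using TensorProduct.induction_on with
  | zero => rfl
  | add x y hx hy => rw [hx, hy, add_zero]
  | tmul x y => rw [Subsingleton.elim y 0, TensorProduct.tmul_zero]

theorem tensor_subsingleton_left {M N : Type w} [AddCommGroup M] [AddCommGroup N] [Module ℂ M]
    [Module ℂ N] [Subsingleton M] : Subsingleton (M ⊗[ℂ] N) := by
  refine subsingleton_of_forall_eq 0 fun t => ?_
  induction t using TensorProduct.induction_on with
  | zero => rfl
  | add x y hx hy => rw [hx, hy, add_zero]
  | tmul x y => rw [Subsingleton.elim x 0, TensorProduct.zero_tmul]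

theorem id_comp (E : GerbeHom 𝔛 𝔜) : Isomorphic ((id 𝔛).comp E) E := by
  refine Isomorphic.of_equiv_arr (fun κ i =>
    ((projEquiv (V := fun μ : 𝔛.X => E.fib (pt κ μ) ⊗[ℂ] (id 𝔛).fib (pt μ i)) i
      (fun μ h => by
        have := id_subsingleton (𝔛 := 𝔛) h.symm
        exact tensor_subsingleton_right)).trans
      (TensorProduct.congr (LinearEquiv.refl ℂ _) (idEv i))).trans
      (TensorProduct.rid ℂ _)) fun {κ κ' i i'} v u h x => ?_
  change TensorProduct.rid ℂ _ (TensorProduct.congr _ _ (compFun (id 𝔛) E (arr v u h) x i')) =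
    E.map (arr v u h) (TensorProduct.rid ℂ _ (TensorProduct.congr _ (idEv i) (x i)))
  rw [compFun_apply v u u h rfl x]
  generalize x i = s
  induction s using TensorProduct.induction_on with
  | zero => simp
  | add x y hx hy => simp only [map_add, hx, hy]
  | tmul x F =>
    rw [twist_tmul, TensorProduct.congr_tmul, TensorProduct.congr_tmul, TensorProduct.rid_tmul,
      TensorProduct.rid_tmul, LinearEquiv.refl_apply, LinearEquiv.refl_apply, map_smul]
    congr 1
    exact idEv_map u F

theorem comp_id (E : GerbeHom 𝔛 𝔜) : Isomorphic (E.comp (id 𝔜)) E := by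
  refine Isomorphic.of_equiv_arr (fun κ i =>
    ((projEquiv (V := fun μ : 𝔜.X => (id 𝔜).fib (pt κ μ) ⊗[ℂ] E.fib (pt μ i)) κ
      (fun μ h => by
        have := id_subsingleton (𝔛 := 𝔜) h
        exact tensor_subsingleton_left)).trans
      (TensorProduct.congr (idEv κ) (LinearEquiv.refl ℂ _))).trans
      (TensorProduct.lid ℂ _)) fun {κ κ' i i'} v u h x => ?_
  change TensorProduct.lid ℂ _ (TensorProduct.congr _ _ (compFun E (id 𝔜) (arr v u h) x κ')) =
    E.map (arr v u h) (TensorProduct.lid ℂ _ (TensorProduct.congr (idEv κ) _ (x κ)))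
  rw [compFun_apply v v u rfl h x]
  generalize x κ = s
  induction s using TensorProduct.induction_on with
  | zero => simp
  | add x y hx hy => simp only [map_add, hx, hy]
  | tmul F x =>
    rw [twist_tmul, TensorProduct.congr_tmul, TensorProduct.congr_tmul, TensorProduct.lid_tmul,
      TensorProduct.lid_tmul, LinearEquiv.refl_apply, LinearEquiv.refl_apply, map_smul]
    congr 1
    exact idEv_map v F

/-! The associativity isomorphism. -/

section assoc

/-- Interchange of arguments. -/
def piSwap {ι κ : Type w} (V : ι → κ → Type w) [∀ i j, AddCommGroup (V i j)]
    [∀ i j, Module ℂ (V i j)] : (∀ i j, V i j) ≃ₗ[ℂ] ∀ j i, V i j where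
  toFun f j i := f i j
  invFun f i j := f j i
  map_add' _ _ := rfl
  map_smul' _ _ := rfl
  left_inv _ := rfl
  right_inv _ := rfl

theorem piRight_proj {ι N : Type w} [Fintype ι] [DecidableEq ι] [AddCommGroup N] [Module ℂ N]
    (V : ι → Type w) [∀ i, AddCommGroup (V i)] [∀ i, Module ℂ (V i)] (s : N ⊗[ℂ] (∀ i, V i))
    (i : ι) : TensorProduct.piRight ℂ ℂ N V s i =
      TensorProduct.map LinearMap.id (LinearMap.proj i) s := by
  induction s using TensorProduct.induction_on with
  | zero => simp
  | add x y hx hy => rw [map_add, map_add, ← hx, ← hy]; rfl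
  | tmul x y => rfl

theorem piLeft_proj {ι N : Type w} [Fintype ι] [DecidableEq ι] [AddCommGroup N] [Module ℂ N]
    (V : ι → Type w) [∀ i, AddCommGroup (V i)] [∀ i, Module ℂ (V i)] (s : (∀ i, V i) ⊗[ℂ] N)
    (i : ι) : TensorProduct.piLeft ℂ N V s i =
      TensorProduct.map (LinearMap.proj i) LinearMap.id s := by
  induction s using TensorProduct.induction_on with
  | zero => simp
  | add x y hx hy => rw [map_add, map_add, ← hx, ← hy]; rfl
  | tmul x y => rfl

variable (E : GerbeHom 𝔚 𝔛) (E' : GerbeHom 𝔛 𝔜) (E'' : GerbeHom 𝔜 𝔷)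

/-- A coordinate on the fibres of `E' ∘ E`. -/
def coord (ν : 𝔜.X) (i : 𝔚.X) (μ : 𝔛.X) :
    (E.comp E').fib (pt ν i) →ₗ[ℂ] E'.fib (pt ν μ) ⊗[ℂ] E.fib (pt μ i) :=
  (LinearMap.proj μ : (∀ μ : 𝔛.X, E'.fib (pt ν μ) ⊗[ℂ] E.fib (pt μ i)) →ₗ[ℂ] _)

theorem coord_map {κ κ' : 𝔜.X} {i i' : 𝔚.X} {μ ν : 𝔛.X} (v : κ ⟶ κ') (p : μ ⟶ ν) (q : i ⟶ i')
    (hv : 𝔜.deg v = 𝔛.deg p) (hq : 𝔛.deg p = 𝔚.deg q) (x : (E.comp E').fib (pt κ i)) :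
    coord E E' κ' i' ν ((E.comp E').map (arr v q (hv.trans hq)) x) =
      twist E E' v p q hv hq (coord E E' κ i μ x) :=
  compFun_apply v p q hv hq x

open Classical in
/-- Coordinates on the fibres of `E'' ∘ (E' ∘ E)`. -/
def coordL (κ : 𝔷.X) (i : 𝔚.X) : ((E.comp E').comp E'').fib (pt κ i) ≃ₗ[ℂ]
    ∀ (ν : 𝔜.X) (μ : 𝔛.X), E''.fib (pt κ ν) ⊗[ℂ] (E'.fib (pt ν μ) ⊗[ℂ] E.fib (pt μ i)) :=
  LinearEquiv.piCongrRight (fun ν => (TensorProduct.piRight ℂ ℂ (E''.fib (pt κ ν))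
    (fun μ : 𝔛.X => E'.fib (pt ν μ) ⊗[ℂ] E.fib (pt μ i)) :
      E''.fib (pt κ ν) ⊗[ℂ] (E.comp E').fib (pt ν i) ≃ₗ[ℂ] _))

open Classical in
/-- Coordinates on the fibres of `(E'' ∘ E') ∘ E`. -/
def coordR (κ : 𝔷.X) (i : 𝔚.X) : (E.comp (E'.comp E'')).fib (pt κ i) ≃ₗ[ℂ]
    ∀ (ν : 𝔜.X) (μ : 𝔛.X), E''.fib (pt κ ν) ⊗[ℂ] (E'.fib (pt ν μ) ⊗[ℂ] E.fib (pt μ i)) :=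
  (LinearEquiv.piCongrRight (fun μ => (TensorProduct.piLeft ℂ (E.fib (pt μ i))
    (fun ν : 𝔜.X => E''.fib (pt κ ν) ⊗[ℂ] E'.fib (pt ν μ)) :
      (E'.comp E'').fib (pt κ μ) ⊗[ℂ] E.fib (pt μ i) ≃ₗ[ℂ] _) ≪≫ₗ
    LinearEquiv.piCongrRight fun ν => TensorProduct.assoc ℂ (E''.fib (pt κ ν)) (E'.fib (pt ν μ))
      (E.fib (pt μ i)))) ≪≫ₗ
  piSwap (fun (μ : 𝔛.X) (ν : 𝔜.X) =>
    E''.fib (pt κ ν) ⊗[ℂ] (E'.fib (pt ν μ) ⊗[ℂ] E.fib (pt μ i)))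

theorem coordL_apply {κ : 𝔷.X} {i : 𝔚.X} (x : ((E.comp E').comp E'').fib (pt κ i)) (ν : 𝔜.X)
    (μ : 𝔛.X) : coordL E E' E'' κ i x ν μ =
      TensorProduct.map LinearMap.id (coord E E' ν i μ) (coord (E.comp E') E'' κ i ν x) := by
  classical
  exact piRight_proj (fun μ : 𝔛.X => E'.fib (pt ν μ) ⊗[ℂ] E.fib (pt μ i)) (x ν) μ

theorem coordR_apply {κ : 𝔷.X} {i : 𝔚.X} (x : (E.comp (E'.comp E'')).fib (pt κ i)) (ν : 𝔜.X)
    (μ : 𝔛.X) : coordR E E' E'' κ i x ν μ =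
      TensorProduct.assoc ℂ _ _ _ (TensorProduct.map (coord E' E'' κ μ ν) LinearMap.id
        (coord E (E'.comp E'') κ i μ x)) := by
  classical
  exact congrArg (TensorProduct.assoc ℂ _ _ _)
    (piLeft_proj (fun ν : 𝔜.X => E''.fib (pt κ ν) ⊗[ℂ] E'.fib (pt ν μ)) (x μ) ν)

theorem coordL_map {κ κ' : 𝔷.X} {ν ν' : 𝔜.X} {μ μ' : 𝔛.X} {i i' : 𝔚.X} (v : κ ⟶ κ') (p : ν ⟶ ν')
    (r : μ ⟶ μ') (u : i ⟶ i') (h1 : 𝔷.deg v = 𝔜.deg p) (h2 : 𝔜.deg p = 𝔛.deg r)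
    (h3 : 𝔛.deg r = 𝔚.deg u) (x : ((E.comp E').comp E'').fib (pt κ i)) :
    coordL E E' E'' κ' i' (((E.comp E').comp E'').map (arr v u (h1.trans (h2.trans h3))) x) ν' μ' =
      TensorProduct.map (E''.map (arr v p h1)).toLinearMap
        (twist E E' p r u h2 h3).toLinearMap (coordL E E' E'' κ i x ν μ) := by
  rw [coordL_apply, coordL_apply, coord_map (E.comp E') E'' v p u h1 (h2.trans h3)]
  generalize coord (E.comp E') E'' κ i ν x = s
  induction s using TensorProduct.induction_on with
  | zero => simp only [map_zero]
  | add x y hx hy => simp only [map_add, hx, hy]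
  | tmul x y =>
    rw [twist_tmul, TensorProduct.map_tmul, TensorProduct.map_tmul, TensorProduct.map_tmul,
      coord_map E E' p r u h2 h3]
    rfl

theorem coordR_map {κ κ' : 𝔷.X} {ν ν' : 𝔜.X} {μ μ' : 𝔛.X} {i i' : 𝔚.X} (v : κ ⟶ κ') (p : ν ⟶ ν')
    (r : μ ⟶ μ') (u : i ⟶ i') (h1 : 𝔷.deg v = 𝔜.deg p) (h2 : 𝔜.deg p = 𝔛.deg r)
    (h3 : 𝔛.deg r = 𝔚.deg u) (x : (E.comp (E'.comp E'')).fib (pt κ i)) :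
    coordR E E' E'' κ' i' ((E.comp (E'.comp E'')).map (arr v u (h1.trans (h2.trans h3))) x) ν' μ' =
      TensorProduct.map (E''.map (arr v p h1)).toLinearMap
        (twist E E' p r u h2 h3).toLinearMap (coordR E E' E'' κ i x ν μ) := by
  rw [coordR_apply, coordR_apply, coord_map E (E'.comp E'') v r u (h1.trans h2) h3]
  generalize coord E (E'.comp E'') κ i μ x = s
  induction s using TensorProduct.induction_on with
  | zero => simp only [map_zero]
  | add x y hx hy => simp only [map_add, hx, hy]
  | tmul x y =>
    rw [twist_tmul, TensorProduct.map_tmul, TensorProduct.map_tmul,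
      coord_map E' E'' v p r h1 h2]
    generalize coord E' E'' κ μ ν x = s
    induction s using TensorProduct.induction_on with
    | zero => simp only [map_zero, TensorProduct.zero_tmul]
    | add x y hx hy => simp only [map_add, TensorProduct.add_tmul, hx, hy]
    | tmul x z => rfl

theorem comp_assoc : Isomorphic ((E.comp E').comp E'') (E.comp (E'.comp E'')) := by
  refine Isomorphic.of_equiv_arr (fun κ i =>
    coordL E E' E'' κ i ≪≫ₗ (coordR E E' E'' κ i).symm) fun {κ κ' i i'} v u h x => ?_
  apply (coordR E E' E'' κ' i').injective
  change coordR E E' E'' κ' i' ((coordR E E' E'' κ' i').symm _) =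
    coordR E E' E'' κ' i' ((E.comp (E'.comp E'')).map (arr v u h)
      ((coordR E E' E'' κ i).symm (coordL E E' E'' κ i x)))
  rw [LinearEquiv.apply_symm_apply]
  funext ν' μ'
  obtain ⟨p, hp⟩ := exists_to (𝔷.deg v) ν'
  obtain ⟨r, hr⟩ := exists_to (𝔷.deg v) μ'
  change coordL E E' E'' κ' i' _ ν' μ' = _
  rw [coordL_map E E' E'' v p r u hp.symm (hp.trans hr.symm) (hr.trans h),
    coordR_map E E' E'' v p r u hp.symm (hp.trans hr.symm) (hr.trans h),
    LinearEquiv.apply_symm_apply]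

end assoc

end GerbeHom

/-- The homotopy category `[Gerbes(G)]`: objects are finite `G`-equivariant gerbes with metrics,
morphisms are isomorphism classes of 1-morphisms. -/
structure HoGerbes (G : Type v) [Group G] where
  gerbe : Gerbe.{v, w} G

instance : Category (HoGerbes.{v, w} G) where
  Hom 𝔛 𝔜 := Quotient (GerbeHom.setoid 𝔛.gerbe 𝔜.gerbe)
  id 𝔛 := Quotient.mk _ (GerbeHom.id 𝔛.gerbe)
  comp f g := Quotient.map₂ GerbeHom.comp (fun _ _ h _ _ h' => GerbeHom.Isomorphic.comp h h') f g
  id_comp f := by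
    induction f using Quotient.ind with | _ E =>
    exact Quotient.sound (GerbeHom.id_comp E)
  comp_id f := by
    induction f using Quotient.ind with | _ E =>
    exact Quotient.sound (GerbeHom.comp_id E)
  assoc f g h := by
    induction f using Quotient.ind with | _ E =>
    induction g using Quotient.ind with | _ E' =>
    induction h using Quotient.ind with | _ E'' =>
    exact Quotient.sound (GerbeHom.comp_assoc E E' E'')

/-- The class in the homotopy category of a 1-morphism of gerbes. -/
def HoGerbes.mk_hom {𝔛 𝔜 : HoGerbes.{v, w} G} (E : GerbeHom 𝔛.gerbe 𝔜.gerbe) :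
    𝔛 ⟶ 𝔜 := Quotient.mk _ E

/-! ### The gerbe associated to a marked unitary 2-representation -/

namespace TwoRep

variable (α : TwoRep.{v, u} G)

/-- The component `X ⟶ α_e X` of `φ(e)`. -/
def un (X : α.H) : X ⟶ (α.act 1).obj X := α.unit.app X

/-- The component `α_{g₂} (α_{g₁} X) ⟶ α_g X` of `φ(g₂, g₁)`, where `g₂ * g₁ = g`. -/
def mu {g₂ g₁ g : G} (h : g₂ * g₁ = g) (X : α.H) :
    (α.act g₂).obj ((α.act g₁).obj X) ⟶ (α.act g).obj X := (α.mul h).app X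

/-- The identification of `α_g X` and `α_g' X` if `g = g'`. -/
def ca {g g' : G} (h : g = g') (X : α.H) : (α.act g).obj X ⟶ (α.act g').obj X :=
  eqToHom (congrArg (fun t => (α.act t).obj X) h)

@[simp]
theorem ca_rfl {g : G} (h : g = g) (X : α.H) : α.ca h X = 𝟙 _ := rfl

theorem mu_ca {g₂ g₁ g g' : G} (h : g₂ * g₁ = g) (e : g = g') (X : α.H) :
    α.mu h X ≫ α.ca e X = α.mu (h.trans e) X := by
  subst e
  simp

theorem un_unitary (X : α.H) : IsUnitary (α.un X) := α.unit_unitary X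

theorem mu_unitary {g₂ g₁ g : G} (h : g₂ * g₁ = g) (X : α.H) : IsUnitary (α.mu h X) :=
  α.mul_unitary h X

theorem un_mu (g : G) (X : α.H) : α.un ((α.act g).obj X) ≫ α.mu (one_mul g) X = 𝟙 _ :=
  α.unit_mul g X

theorem map_un_mu (g : G) (X : α.H) : (α.act g).map (α.un X) ≫ α.mu (mul_one g) X = 𝟙 _ :=
  α.mul_unit g X

theorem mu_mu {g₃ g₂ g₁ a b c : G} (ha : g₂ * g₁ = a) (hb : g₃ * g₂ = b)
    (hc : g₃ * a = c) (hc' : b * g₁ = c) (X : α.H) :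
    (α.act g₃).map (α.mu ha X) ≫ α.mu hc X = α.mu hb ((α.act g₁).obj X) ≫ α.mu hc' X :=
  α.mul_mul ha hb hc hc' X

theorem un_naturality {X Y : α.H} (f : X ⟶ Y) : α.un X ≫ (α.act 1).map f = f ≫ α.un Y :=
  (α.unit.naturality f).symm

theorem mu_naturality {g₂ g₁ g : G} (h : g₂ * g₁ = g) {X Y : α.H}
    (f : X ⟶ Y) : (α.act g₂).map ((α.act g₁).map f) ≫ α.mu h Y =
      α.mu h X ≫ (α.act g).map f := (α.mul h).naturality f

theorem act_isEquivalence (g : G) : (α.act g).IsEquivalence where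
  faithful := ⟨fun {X Y f f'} h => by
    have hsub : (α.act g).map (f - f') = 0 := by
      have h1 := (α.act_linearStar g).map_add (f - f') f'
      rw [sub_add_cancel, h] at h1
      exact left_eq_add.1 (h1.trans (add_comm _ _))
    refine sub_eq_zero.1 (eq_zero_of_ip_self _ ?_)
    rw [← α.act_inner g, hsub]
    simpa using ip_smul_left (0 : ℂ) (0 : (α.act g).obj X ⟶ (α.act g).obj Y) 0⟩
  full := ⟨fun f => α.act_surj g _ _ f⟩
  essSurj := ⟨fun Y => ⟨(α.act g⁻¹).obj Y,
    ⟨(α.mul_unitary (mul_inv_cancel g) Y).iso ≪≫ (α.unit_unitary Y).iso.symm⟩⟩⟩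

instance (g : G) (X : α.H) [Simple X] : Simple ((α.act g).obj X) := by
  have := α.act_isEquivalence g
  exact simple_obj (α.act g) X

theorem scale_act (g : G) (X : α.H) : scale ((α.act g).obj X) = scale X := by
  unfold scale
  rw [← α.act_inner g (𝟙 X) (𝟙 X), (α.act g).map_id]

theorem dag_mu_one (g : G) (X : α.H) : dag (α.mu (one_mul g) X) = α.un ((α.act g).obj X) := by
  have h1 := congrArg (fun t => t ≫ dag (α.mu (one_mul g) X)) (α.un_mu g X)
  simp only [Category.assoc] at h1
  rw [(α.mu_unitary (one_mul g) X).1, Category.comp_id, Category.id_comp] at h1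
  exact h1.symm

end TwoRep

namespace MarkedTwoRep

variable (α : MarkedTwoRep.{v, u} G)

/-- The isomorphism class of a simple object. -/
def mark (S : α.H) [hS : Simple S] : α.I := (α.marking S hS).choose

theorem mark_iso (S : α.H) [hS : Simple S] : Nonempty (S ≅ α.e (α.mark S)) :=
  (α.marking S hS).choose_spec.1

theorem mark_eq {S : α.H} [hS : Simple S] {i : α.I} (h : S ≅ α.e i) : α.mark S = i :=
  ((α.marking S hS).choose_spec.2 i ⟨h⟩).symm

/-- The action `g • i = [α_g (e i)]` on the set of isomorphism classes of simple objects. -/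
instance : MulAction G α.I where
  smul g i := α.mark ((α.act g).obj (α.e i))
  one_smul i := α.mark_eq (α.un_unitary (α.e i)).iso.symm
  mul_smul g h i := by
    obtain ⟨a⟩ := α.mark_iso ((α.act h).obj (α.e i))
    obtain ⟨b⟩ := α.mark_iso ((α.act g).obj (α.e (α.mark ((α.act h).obj (α.e i)))))
    exact α.mark_eq ((α.mu_unitary (rfl : g * h = g * h) (α.e i)).iso.symm ≪≫
      (α.act g).mapIso a ≪≫ b)

theorem smul_iso (g : G) (i : α.I) : Nonempty ((α.act g).obj (α.e i) ≅ α.e (g • i)) :=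
  α.mark_iso _

theorem smul_eq {g : G} {i j : α.I} (h : (α.act g).obj (α.e i) ≅ α.e j) : g • i = j :=
  α.mark_eq h

/-- Arrows `i ⟶ j` of the associated gerbe: pairs of an element `g` of `G` (necessarily with
`g • i = j`) and a unitary arrow `e j ⟶ α_g (e i)`. -/
structure Arrow (i j : α.I) : Type (max u v) where
  g : G
  arr : α.e j ⟶ (α.act g).obj (α.e i)
  unitary : IsUnitary arr

variable {α}

theorem Arrow.ext {i j : α.I} {f f' : α.Arrow i j} (h : f.g = f'.g)
    (h' : f.arr ≫ α.ca h _ = f'.arr) : f = f' := by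
  obtain ⟨g, a, ha⟩ := f
  obtain ⟨g', a', ha'⟩ := f'
  change g = g' at h
  subst h
  rw [TwoRep.ca_rfl, Category.comp_id] at h'
  change a = a' at h'
  subst h'
  rfl

theorem Arrow.ext_arr {i j : α.I} {g : G} {a a' : α.e j ⟶ (α.act g).obj (α.e i)}
    (ha : IsUnitary a) (ha' : IsUnitary a') (h : a = a') :
    (⟨g, a, ha⟩ : α.Arrow i j) = ⟨g, a', ha'⟩ := by
  subst h; rfl

/-- The composite `v' ⋄ v = φ(g', g) α_{g'}(v) v'`. -/
def Arrow.comp {i j l : α.I} (f : α.Arrow i j) (f' : α.Arrow j l) : α.Arrow i l where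
  g := f'.g * f.g
  arr := f'.arr ≫ (α.act f'.g).map f.arr ≫ α.mu rfl (α.e i)
  unitary := f'.unitary.comp (((α.act_linearStar f'.g).map_unitary f.unitary).comp
    (α.mu_unitary rfl _))

/-- The identity arrow, given by `φ(e)`. -/
def Arrow.id (i : α.I) : α.Arrow i i := ⟨1, α.un (α.e i), α.un_unitary _⟩

/-- The inverse of an arrow. -/
def Arrow.inv {i j : α.I} (f : α.Arrow i j) : α.Arrow j i where
  g := f.g⁻¹
  arr := α.un (α.e i) ≫ dag (α.mu (inv_mul_cancel f.g) (α.e i)) ≫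
    (α.act f.g⁻¹).map (dag f.arr)
  unitary := (α.un_unitary _).comp ((α.mu_unitary _ _).dag.comp
    ((α.act_linearStar _).map_unitary f.unitary.dag))

theorem Arrow.inv_comp {i j : α.I} (f : α.Arrow i j) : f.inv.comp f = Arrow.id j := by
  refine Arrow.ext (mul_inv_cancel f.g) ?_
  change (f.arr ≫ (α.act f.g).map (α.un (α.e i) ≫
    dag (α.mu (inv_mul_cancel f.g) (α.e i)) ≫ (α.act f.g⁻¹).map (dag f.arr)) ≫
      α.mu rfl (α.e j)) ≫ α.ca (mul_inv_cancel f.g) (α.e j) = α.un (α.e j)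
  have h1 := α.mu_mu (inv_mul_cancel f.g) (mul_inv_cancel f.g) (mul_one f.g) (one_mul f.g)
    (α.e i)
  have hu := α.mu_unitary (inv_mul_cancel f.g) (α.e i)
  have hu' := α.mu_unitary (one_mul f.g) (α.e i)
  have h2 : (α.act f.g).map (dag (α.mu (inv_mul_cancel f.g) (α.e i))) ≫
      α.mu (mul_inv_cancel f.g) ((α.act f.g).obj (α.e i)) =
        α.mu (mul_one f.g) (α.e i) ≫ α.un ((α.act f.g).obj (α.e i)) := by
    rw [← α.dag_mu_one]
    have h3 : α.mu (mul_one f.g) (α.e i) = (α.act f.g).map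
        (dag (α.mu (inv_mul_cancel f.g) (α.e i))) ≫
          α.mu (mul_inv_cancel f.g) ((α.act f.g).obj (α.e i)) ≫
            α.mu (one_mul f.g) (α.e i) := by
      rw [← h1, ← Functor.map_comp_assoc, hu.2]
      simp
    rw [h3, Category.assoc, Category.assoc, hu'.1]
    simp
  simp only [Functor.map_comp, Category.assoc]
  rw [α.mu_ca, α.mu_naturality, reassoc_of% h2, reassoc_of% α.map_un_mu, α.un_naturality,
    reassoc_of% f.unitary.1]

theorem Arrow.comp_inv {i j : α.I} (f : α.Arrow i j) : f.comp f.inv = Arrow.id i := by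
  refine Arrow.ext (inv_mul_cancel f.g) ?_
  change ((α.un (α.e i) ≫ dag (α.mu (inv_mul_cancel f.g) (α.e i)) ≫
    (α.act f.g⁻¹).map (dag f.arr)) ≫ (α.act f.g⁻¹).map f.arr ≫ α.mu rfl (α.e i)) ≫
      α.ca (inv_mul_cancel f.g) (α.e i) = α.un (α.e i)
  have hu := α.mu_unitary (inv_mul_cancel f.g) (α.e i)
  simp only [Category.assoc]
  rw [α.mu_ca, ← Functor.map_comp_assoc, f.unitary.2, CategoryTheory.Functor.map_id, Category.id_comp, hu.2,
    Category.comp_id]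

theorem Arrow.id_comp {i j : α.I} (f : α.Arrow i j) : (Arrow.id i).comp f = f := by
  refine Arrow.ext (mul_one f.g) ?_
  change (f.arr ≫ (α.act f.g).map (α.un (α.e i)) ≫ α.mu rfl (α.e i)) ≫
    α.ca (mul_one f.g) (α.e i) = f.arr
  rw [Category.assoc, Category.assoc, α.mu_ca, α.map_un_mu, Category.comp_id]

theorem Arrow.comp_id {i j : α.I} (f : α.Arrow i j) : f.comp (Arrow.id j) = f := by
  refine Arrow.ext (one_mul f.g) ?_
  change (α.un (α.e j) ≫ (α.act 1).map f.arr ≫ α.mu rfl (α.e i)) ≫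
    α.ca (one_mul f.g) (α.e i) = f.arr
  rw [Category.assoc, Category.assoc, α.mu_ca, reassoc_of% α.un_naturality, α.un_mu,
    Category.comp_id]

theorem Arrow.assoc {i j l m : α.I} (f : α.Arrow i j) (f' : α.Arrow j l) (f'' : α.Arrow l m) :
    (f.comp f').comp f'' = f.comp (f'.comp f'') := by
  refine Arrow.ext (mul_assoc _ _ _).symm ?_
  change (f''.arr ≫ (α.act f''.g).map (f'.arr ≫ (α.act f'.g).map f.arr ≫
    α.mu (rfl : f'.g * f.g = _) (α.e i)) ≫
      α.mu (rfl : f''.g * (f'.g * f.g) = _) (α.e i)) ≫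
        α.ca (mul_assoc f''.g f'.g f.g).symm (α.e i) =
    (f''.arr ≫ (α.act f''.g).map f'.arr ≫ α.mu (rfl : f''.g * f'.g = _) (α.e j)) ≫
        (α.act (f''.g * f'.g)).map f.arr ≫ α.mu (rfl : f''.g * f'.g * f.g = _) (α.e i)
  simp only [Category.assoc, Functor.map_comp]
  rw [α.mu_ca, α.mu_mu rfl rfl _ rfl, reassoc_of% α.mu_naturality]

/-- The groupoid underlying the associated gerbe. -/
instance (α : MarkedTwoRep.{v, u} G) : Groupoid.{max u v} α.I where
  Hom := α.Arrow
  id := Arrow.id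
  comp := Arrow.comp
  inv := Arrow.inv
  id_comp := Arrow.id_comp
  comp_id := Arrow.comp_id
  assoc := Arrow.assoc
  inv_comp := Arrow.inv_comp
  comp_inv := Arrow.comp_inv

theorem Arrow.smul_eq {i j : α.I} (f : α.Arrow i j) : f.g • i = j :=
  α.smul_eq f.unitary.iso.symm

/-- Multiplication of an arrow by an element of `U(1)`. -/
def Arrow.smul {i j : α.I} (z : Circle) (f : α.Arrow i j) : α.Arrow i j :=
  ⟨f.g, (z : ℂ) • f.arr, f.unitary.smul z⟩

theorem Arrow.smul_mul {i j : α.I} (z z' : Circle) (f : α.Arrow i j) :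
    f.smul (z * z') = (f.smul z').smul z :=
  Arrow.ext_arr _ _ (by
    change ((z * z' : Circle) : ℂ) • f.arr = (z : ℂ) • (z' : ℂ) • f.arr
    rw [smul_smul, Circle.coe_mul])

theorem Arrow.smul_comp {i j l : α.I} (z : Circle) (f : α.Arrow i j) (f' : α.Arrow j l) :
    (f.smul z).comp f' = (f.comp f').smul z :=
  Arrow.ext_arr _ _ (by
    change f'.arr ≫ (α.act f'.g).map ((z : ℂ) • f.arr) ≫ α.mu rfl (α.e i) =
      (z : ℂ) • (f'.arr ≫ (α.act f'.g).map f.arr ≫ α.mu rfl (α.e i))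
    rw [(α.act_linearStar _).map_smul, Linear.smul_comp, Linear.comp_smul])

theorem Arrow.comp_smul {i j l : α.I} (z : Circle) (f : α.Arrow i j) (f' : α.Arrow j l) :
    f.comp (f'.smul z) = (f.comp f').smul z :=
  Arrow.ext_arr _ _ (by
    change ((z : ℂ) • f'.arr) ≫ (α.act f'.g).map f.arr ≫ α.mu rfl (α.e i) =
      (z : ℂ) • (f'.arr ≫ (α.act f'.g).map f.arr ≫ α.mu rfl (α.e i))
    rw [Linear.smul_comp])

variable (α) in
/-- The equivariant gerbe associated to a marked unitary 2-representation. -/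
def gerbe : Gerbe.{v, max u v} G where
  X := α.I
  deg := Arrow.g
  deg_smul := Arrow.smul_eq
  deg_id _ := rfl
  deg_comp _ _ := rfl
  full g i j h := by
    obtain ⟨a⟩ := α.smul_iso g i
    rw [h] at a
    obtain ⟨f, hf⟩ := exists_unitary a
    exact ⟨⟨g, dag f, hf.dag⟩, rfl⟩
  circ i z := (Arrow.id i).smul z
  circ_mul i z z' := by
    change _ = ((Arrow.id i).smul z).comp ((Arrow.id i).smul z')
    rw [Arrow.smul_comp, Arrow.comp_smul, Arrow.id_comp, Arrow.smul_mul]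
  circ_inj i z z' h := by
    have h1 : (z : ℂ) • α.un (α.e i) = (z' : ℂ) • α.un (α.e i) := by
      injection h with _ h
    have h2 := congrArg (fun t => t ≫ dag (α.un (α.e i))) h1
    simp only [Linear.smul_comp, (α.un_unitary (α.e i)).1] at h2
    exact Circle.ext (smul_left_injective ℂ (id_nonzero (α.e i)) h2)
  deg_circ _ _ := rfl
  circ_surj i f h := by
    obtain ⟨g, a, ha⟩ := f
    change g = 1 at h
    subst h
    obtain ⟨c, hc⟩ := schur (a ≫ dag (α.un (α.e i)))
    have hu := ha.comp (α.un_unitary (α.e i)).dag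
    have h1 := hu.1
    rw [hc, dag_smul, dag_id, Linear.comp_smul, Linear.smul_comp, Category.comp_id, smul_smul]
      at h1
    have h2 : (starRingEnd ℂ c * c) • 𝟙 (α.e i) = (1 : ℂ) • 𝟙 (α.e i) := by rw [h1, one_smul]
    have h3 := smul_left_injective ℂ (id_nonzero (α.e i)) h2
    have h4 : ‖c‖ = 1 := by
      rw [mul_comm, Complex.mul_conj, Complex.normSq_eq_norm_sq] at h3
      have h5 : ‖c‖ ^ 2 = 1 := by exact_mod_cast h3
      nlinarith [norm_nonneg c]
    refine ⟨⟨c, mem_sphere_zero_iff_norm.2 h4⟩, Arrow.ext_arr _ _ ?_⟩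
    change c • α.un (α.e i) = a
    rw [← Category.id_comp (α.un (α.e i)), ← Linear.smul_comp, ← hc, Category.assoc,
      (α.un_unitary (α.e i)).2, Category.comp_id]
  central {i j} f z := by
    change ((Arrow.id i).smul z).comp f = f.comp ((Arrow.id j).smul z)
    rw [Arrow.smul_comp, Arrow.comp_smul, Arrow.id_comp, Arrow.comp_id]
  k i := scale (α.e i)
  k_pos i := scale_pos _
  k_smul g i := by
    obtain ⟨a⟩ := α.smul_iso g i
    obtain ⟨f, hf⟩ := exists_unitary a
    rw [← scale_eq_of_unitary hf, α.scale_act]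

end MarkedTwoRep

/-! ### The 1-morphism of gerbes associated to a morphism of 2-representations -/

/-- The hom-space `Hom(X, Y)` of a 2-Hilbert space, as a Hilbert space (in a larger universe). -/
def HomSp {H : Type u} [Category.{v} H] [Abelian H] [Linear ℂ H] [TwoHilbert H] (X Y : H) :
    Type (max u v) := ULift.{u} (X ⟶ Y)

namespace HomSp

variable {H : Type u} [Category.{v} H] [Abelian H] [Linear ℂ H] [TwoHilbert H] {X Y : H}

/-- A morphism as an element of the Hilbert space. -/
def up (f : X ⟶ Y) : HomSp X Y := ULift.up f

/-- An element of the Hilbert space as a morphism. -/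
def down (f : HomSp X Y) : X ⟶ Y := ULift.down f

instance : AddCommGroup (HomSp X Y) := inferInstanceAs (AddCommGroup (ULift.{u} (X ⟶ Y)))

instance : Module ℂ (HomSp X Y) := inferInstanceAs (Module ℂ (ULift.{u} (X ⟶ Y)))

variable (X Y) in
/-- The inner product of the hom-space. -/
@[reducible]
def core : InnerProductSpace.Core ℂ (HomSp X Y) where
  inner f f' := ip f.down f'.down
  conj_inner_symm f f' := ip_conj f.down f'.down
  re_inner_nonneg f := ip_self_nonneg f.down
  add_left f f' f'' := ip_add_left f.down f'.down f''.down
  smul_left f f' c := ip_smul_left c f.down f'.down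
  definite f h := congrArg up (eq_zero_of_ip_self f.down h)

instance : NormedAddCommGroup (HomSp X Y) := (core X Y).toNormedAddCommGroup

instance : InnerProductSpace ℂ (HomSp X Y) := InnerProductSpace.ofCore (core X Y).toCore

instance : FiniteDimensional ℂ (HomSp X Y) := by
  have := TwoHilbert.finDim X Y
  exact Module.Finite.equiv (ULift.moduleEquiv (R := ℂ) (M := (X ⟶ Y))).symm

end HomSp

namespace TwoRepHom

section

variable {α β : TwoRep.{v, u} G} (σ : TwoRepHom α β)

/-- The component `β_g (σ X) ⟶ σ (α_g X)` of `σ(g)`. -/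
def co (g : G) (X : α.H) :
    (β.act g).obj (σ.functor.obj X) ⟶ σ.functor.obj ((α.act g).obj X) := (σ.coh g).app X

theorem co_unitary (g : G) (X : α.H) : IsUnitary (σ.co g X) := σ.coh_unitary g X

theorem co_naturality (g : G) {X Y : α.H} (f : X ⟶ Y) :
    (β.act g).map (σ.functor.map f) ≫ σ.co g Y = σ.co g X ≫ σ.functor.map ((α.act g).map f) :=
  (σ.coh g).naturality f

theorem mu_co {g₂ g₁ g : G} (h : g₂ * g₁ = g) (X : α.H) :
    β.mu h (σ.functor.obj X) ≫ σ.co g X =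
      (β.act g₂).map (σ.co g₁ X) ≫ σ.co g₂ ((α.act g₁).obj X) ≫ σ.functor.map (α.mu h X) :=
  σ.coh_mul h X

theorem un_co (X : α.H) : β.un (σ.functor.obj X) ≫ σ.co 1 X = σ.functor.map (α.un X) :=
  σ.coh_unit X

end

variable {α β : MarkedTwoRep.{v, u} G} (σ : TwoRepHom α.toTwoRep β.toTwoRep)

/-- The map `⟨μ|σ|i⟩(v ⊗ u)`, which sends `lam : e μ ⟶ σ (e i)` to `σ(u)* σ(g) β_g(lam) v`. -/
def bra {μ ν : β.I} {i j : α.I} (v : β.Arrow μ ν) (u : α.Arrow i j) (h : v.g = u.g)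
    (lam : β.e μ ⟶ σ.functor.obj (α.e i)) : β.e ν ⟶ σ.functor.obj (α.e j) :=
  v.arr ≫ (β.act v.g).map lam ≫ σ.co v.g (α.e i) ≫ σ.functor.map (α.ca h (α.e i) ≫ dag u.arr)

theorem ca_unitary {g g' : G} (h : g = g') (X : α.H) : IsUnitary (α.ca h X) := by
  subst h
  exact IsUnitary.id _

theorem bra_inner {μ ν : β.I} {i j : α.I} (v : β.Arrow μ ν) (u : α.Arrow i j) (h : v.g = u.g)
    (lam lam' : β.e μ ⟶ σ.functor.obj (α.e i)) :
    ip (σ.bra v u h lam) (σ.bra v u h lam') = ip lam lam' := by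
  have hu : IsUnitary (σ.co v.g (α.e i) ≫ σ.functor.map (α.ca h (α.e i) ≫ dag u.arr)) :=
    (σ.co_unitary _ _).comp (σ.linearStar.map_unitary ((ca_unitary h _).comp u.unitary.dag))
  unfold bra
  rw [v.unitary.ip_comp_left, hu.ip_comp_right, β.act_inner]

theorem bra_add {μ ν : β.I} {i j : α.I} (v : β.Arrow μ ν) (u : α.Arrow i j) (h : v.g = u.g)
    (lam lam' : β.e μ ⟶ σ.functor.obj (α.e i)) :
    σ.bra v u h (lam + lam') = σ.bra v u h lam + σ.bra v u h lam' := by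
  unfold bra
  rw [(β.act_linearStar _).map_add, Preadditive.add_comp, Preadditive.comp_add]

theorem bra_smul {μ ν : β.I} {i j : α.I} (v : β.Arrow μ ν) (u : α.Arrow i j) (h : v.g = u.g)
    (c : ℂ) (lam : β.e μ ⟶ σ.functor.obj (α.e i)) :
    σ.bra v u h (c • lam) = c • σ.bra v u h lam := by
  unfold bra
  rw [(β.act_linearStar _).map_smul, Linear.smul_comp, Linear.comp_smul]

theorem bra_id (μ : β.I) (i : α.I) (lam : β.e μ ⟶ σ.functor.obj (α.e i)) :
    σ.bra (MarkedTwoRep.Arrow.id μ) (MarkedTwoRep.Arrow.id i) rfl lam = lam := by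
  change β.un (β.e μ) ≫ (β.act 1).map lam ≫ σ.co 1 (α.e i) ≫
    σ.functor.map (𝟙 _ ≫ dag (α.un (α.e i))) = lam
  rw [reassoc_of% β.un_naturality, reassoc_of% σ.un_co, Category.id_comp, ← Functor.map_comp,
    (α.un_unitary _).1, CategoryTheory.Functor.map_id, Category.comp_id]

theorem bra_comp {μ ν κ : β.I} {i j l : α.I} (v : β.Arrow μ ν) (u : α.Arrow i j) (h : v.g = u.g)
    (v' : β.Arrow ν κ) (u' : α.Arrow j l) (h' : v'.g = u'.g)
    (h'' : (v.comp v').g = (u.comp u').g) (lam : β.e μ ⟶ σ.functor.obj (α.e i)) :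
    σ.bra (v.comp v') (u.comp u') h'' lam = σ.bra v' u' h' (σ.bra v u h lam) := by
  obtain ⟨g, v, hv⟩ := v
  obtain ⟨g₁, u, hu⟩ := u
  obtain ⟨g', v', hv'⟩ := v'
  obtain ⟨g₂, u', hu'⟩ := u'
  change g = g₁ at h
  change g' = g₂ at h'
  subst h h'
  change (v' ≫ (β.act g').map v ≫ β.mu rfl _) ≫ (β.act (g' * g)).map lam ≫ σ.co (g' * g) _ ≫
      σ.functor.map (𝟙 _ ≫ dag (u' ≫ (α.act g').map u ≫ α.mu rfl _)) =
    v' ≫ (β.act g').map (v ≫ (β.act g).map lam ≫ σ.co g _ ≫ σ.functor.map (𝟙 _ ≫ dag u)) ≫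
      σ.co g' _ ≫ σ.functor.map (𝟙 _ ≫ dag u')
  have hm : σ.functor.map (α.mu (rfl : g' * g = _) (α.e i)) ≫
      σ.functor.map (dag (α.mu (rfl : g' * g = _) (α.e i))) = 𝟙 _ := by
    rw [← Functor.map_comp, (α.mu_unitary _ _).1, CategoryTheory.Functor.map_id]
  have hn := σ.co_naturality g' (dag u)
  simp only [Category.assoc, Category.id_comp, dag_comp, Functor.map_comp]
  rw [← reassoc_of% β.mu_naturality, reassoc_of% σ.mu_co, reassoc_of% hm,
    ← (α.act_linearStar g').map_dag, ← reassoc_of% hn]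

theorem bra_smul_left {μ ν : β.I} {i j : α.I} (z : Circle) (v : β.Arrow μ ν) (u : α.Arrow i j)
    (h : v.g = u.g) (lam : β.e μ ⟶ σ.functor.obj (α.e i)) :
    σ.bra (v.smul z) u h lam = (z : ℂ) • σ.bra v u h lam := by
  exact Linear.smul_comp _ _ _ (z : ℂ) v.arr _

theorem bra_smul_right {μ ν : β.I} {i j : α.I} (z : Circle) (v : β.Arrow μ ν) (u : α.Arrow i j)
    (h : v.g = u.g) (lam : β.e μ ⟶ σ.functor.obj (α.e i)) :
    σ.bra v (u.smul z) h lam = (starRingEnd ℂ) (z : ℂ) • σ.bra v u h lam := by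
  change v.arr ≫ (β.act v.g).map lam ≫ σ.co v.g (α.e i) ≫
    σ.functor.map (α.ca h (α.e i) ≫ dag ((z : ℂ) • u.arr)) = _
  rw [dag_smul, Linear.comp_smul, σ.linearStar.map_smul]
  simp only [Linear.comp_smul]
  rfl

open GerbeHom

/-- The action of the arrow `v ⊗ u` on Hilbert spaces. -/
def braMap {μ ν : β.I} {i j : α.I} (v : β.Arrow μ ν) (u : α.Arrow i j) (h : v.g = u.g) :
    HomSp (β.e μ) (σ.functor.obj (α.e i)) →ₗᵢ[ℂ] HomSp (β.e ν) (σ.functor.obj (α.e j)) :=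
  LinearMap.isometryOfInner
    { toFun := fun lam => HomSp.up (σ.bra v u h lam.down)
      map_add' := fun lam lam' => congrArg HomSp.up (σ.bra_add v u h lam.down lam'.down)
      map_smul' := fun c lam => congrArg HomSp.up (σ.bra_smul v u h c lam.down) }
    (fun lam lam' => σ.bra_inner v u h lam.down lam'.down)

theorem braMap_indep {μ ν : β.I} {i j : α.I} {v v' : β.Arrow μ ν} {u u' : α.Arrow i j}
    (h : v.g = u.g) (h' : v'.g = u'.g)
    (e : (arr (𝔜 := β.gerbe) (𝔛 := α.gerbe) (μ := μ) (ν := ν) (i := i) (j := j) v u h :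
      (pt μ i : (β.gerbe.tensor α.gerbe.conj).X) ⟶ pt ν j) =
        arr (𝔜 := β.gerbe) (𝔛 := α.gerbe) v' u' h')
    (lam : HomSp (β.e μ) (σ.functor.obj (α.e i))) :
    σ.braMap v u h lam = σ.braMap v' u' h' lam := by
  obtain ⟨z, h1, h2⟩ := Quotient.exact e
  change v = ((MarkedTwoRep.Arrow.id μ).smul z).comp v' at h1
  change u' = ((MarkedTwoRep.Arrow.id i).smul z⁻¹).comp u at h2
  rw [MarkedTwoRep.Arrow.smul_comp, MarkedTwoRep.Arrow.id_comp] at h1 h2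
  subst h1 h2
  refine congrArg HomSp.up ?_
  refine (σ.bra_smul_left z v' u h _).trans ?_
  refine Eq.trans ?_ (σ.bra_smul_right z⁻¹ v' u h _).symm
  rw [Circle.coe_inv_eq_conj, Complex.conj_conj]

/-- The action of an arrow of the tensor product. -/
def braFun {a b : (β.gerbe.tensor α.gerbe.conj).X} (t : a ⟶ b) :
    HomSp (β.e (fstPt a)) (σ.functor.obj (α.e (sndPt a))) →ₗᵢ[ℂ]
      HomSp (β.e (fstPt b)) (σ.functor.obj (α.e (sndPt b))) :=
  let hv := exists_arr (𝔜 := β.gerbe) (𝔛 := α.gerbe) (μ := fstPt a) (i := sndPt a) (ν := fstPt b)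
      (j := sndPt b) t
  σ.braMap hv.choose hv.choose_spec.choose hv.choose_spec.choose_spec.choose

theorem braFun_arr {μ ν : β.I} {i j : α.I} (v : β.Arrow μ ν) (u : α.Arrow i j) (h : v.g = u.g)
    (lam : HomSp (β.e μ) (σ.functor.obj (α.e i))) :
    σ.braFun (arr (𝔜 := β.gerbe) (𝔛 := α.gerbe) (μ := μ) (ν := ν) (i := i) (j := j) v u h) lam =
      σ.braMap v u h lam := by
  have hv := exists_arr (𝔜 := β.gerbe) (𝔛 := α.gerbe)
    (arr (𝔜 := β.gerbe) (𝔛 := α.gerbe) (μ := μ) (ν := ν) (i := i) (j := j) v u h)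
  exact σ.braMap_indep _ _ hv.choose_spec.choose_spec.choose_spec.symm lam

/-- The 1-morphism `⟨σ⟩ : 𝔛_α → 𝔛_β` associated to a morphism `σ : α → β` of marked
2-representations: the fibre at `(μ, i)` is `⟨μ|σ|i⟩ = Hom(e μ, σ (e i))`, and `v ⊗ u` sends
`lam` to `σ(u)* σ(g) β_g(lam) v`. -/
def bundle : GerbeHom α.gerbe β.gerbe where
  fib a := HomSp (β.e (fstPt a)) (σ.functor.obj (α.e (sndPt a)))
  map t := σ.braFun t
  map_id a lam := by
    refine (σ.braFun_arr (MarkedTwoRep.Arrow.id (fstPt a)) (MarkedTwoRep.Arrow.id (sndPt a))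
      rfl lam).trans ?_
    exact congrArg HomSp.up (σ.bra_id _ _ lam.down)
  map_comp {a b c} s t lam := by
    obtain ⟨v, q, h, rfl⟩ := exists_arr (𝔜 := β.gerbe) (𝔛 := α.gerbe) (μ := fstPt a)
      (i := sndPt a) (ν := fstPt b) (j := sndPt b) s
    obtain ⟨v', q', h', rfl⟩ := exists_arr (𝔜 := β.gerbe) (𝔛 := α.gerbe) (μ := fstPt b)
      (i := sndPt b) (ν := fstPt c) (j := sndPt c) t
    have h'' : (MarkedTwoRep.Arrow.comp v v').g = (MarkedTwoRep.Arrow.comp q q').g :=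
      congrArg₂ (· * ·) h' h
    refine (σ.braFun_arr (MarkedTwoRep.Arrow.comp v v') (MarkedTwoRep.Arrow.comp q q') h''
      lam).trans ?_
    refine Eq.trans ?_ (σ.braFun_arr v' q' h' _).symm
    refine Eq.trans ?_ (congrArg (σ.braMap v' q' h') (σ.braFun_arr v q h lam).symm)
    exact congrArg HomSp.up (σ.bra_comp v q h v' q' h' h'' lam.down)
  map_circ a z lam := by
    refine (σ.braFun_arr ((MarkedTwoRep.Arrow.id (fstPt a)).smul z)
      (MarkedTwoRep.Arrow.id (sndPt a)) rfl lam).trans ?_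
    refine congrArg HomSp.up ?_
    refine (σ.bra_smul_left z (MarkedTwoRep.Arrow.id (fstPt a)) (MarkedTwoRep.Arrow.id (sndPt a))
      rfl lam.down).trans ?_
    exact congrArg (fun t => (z : ℂ) • t) (σ.bra_id _ _ lam.down)

end TwoRepHom

/-! ### The 2-character on objects -/

namespace TwoRep

variable (α : TwoRep.{v, u} G)

/-- The space `Nat(id, α_x)` of natural transformations. -/
def NatSp (x : G) : Type (max u v) := 𝟭 α.H ⟶ α.act x

instance (x : G) : AddCommGroup (α.NatSp x) := inferInstanceAs (AddCommGroup (𝟭 α.H ⟶ α.act x))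

instance (x : G) : Module ℂ (α.NatSp x) := inferInstanceAs (Module ℂ (𝟭 α.H ⟶ α.act x))

variable {α}

/-- The component of a natural transformation. -/
def NatSp.at {x : G} (θ : α.NatSp x) (Z : α.H) : Z ⟶ (α.act x).obj Z := NatTrans.app θ Z

theorem NatSp.ext {x : G} {θ θ' : α.NatSp x} (h : ∀ Z, θ.at Z = θ'.at Z) : θ = θ' :=
  NatTrans.ext (funext h)

theorem NatSp.naturality {x : G} (θ : α.NatSp x) {Z W : α.H} (f : Z ⟶ W) :
    f ≫ θ.at W = θ.at Z ≫ (α.act x).map f := NatTrans.naturality θ f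

theorem dag_mu_right (g : G) (X : α.H) :
    dag (α.mu (mul_one g) X) = (α.act g).map (α.un X) := by
  have h1 := congrArg (fun t => t ≫ dag (α.mu (mul_one g) X)) (α.map_un_mu g X)
  simp only [Category.assoc] at h1
  rw [(α.mu_unitary (mul_one g) X).1, Category.comp_id, Category.id_comp] at h1
  exact h1.symm

/-- The map `χ_α(g) : Nat(id, α_x) → Nat(id, α_y)`, where `y = g x g⁻¹`. -/
def NatSp.conj {x y : G} (g : G) (h : g * x * g⁻¹ = y) (θ : α.NatSp x) : α.NatSp y where
  app Z := α.un Z ≫ dag (α.mu (mul_inv_cancel g) Z) ≫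
    (α.act g).map (θ.at ((α.act g⁻¹).obj Z)) ≫ α.mu rfl ((α.act g⁻¹).obj Z) ≫ α.mu h Z
  naturality Z W f := by
    have h1 : dag (α.mu (mul_inv_cancel g) Z) ≫ (α.act g).map ((α.act g⁻¹).map f) =
        (α.act 1).map f ≫ dag (α.mu (mul_inv_cancel g) W) := by
      have hZ := α.mu_unitary (mul_inv_cancel g) Z
      have hW := α.mu_unitary (mul_inv_cancel g) W
      have hn := α.mu_naturality (mul_inv_cancel g) f
      calc dag (α.mu (mul_inv_cancel g) Z) ≫ (α.act g).map ((α.act g⁻¹).map f)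
          = dag (α.mu (mul_inv_cancel g) Z) ≫ ((α.act g).map ((α.act g⁻¹).map f) ≫
              α.mu (mul_inv_cancel g) W) ≫ dag (α.mu (mul_inv_cancel g) W) := by
            rw [Category.assoc, hW.1, Category.comp_id]
        _ = _ := by rw [hn, Category.assoc, reassoc_of% hZ.2]
    change f ≫ (α.un W ≫ _) = (α.un Z ≫ _) ≫ (α.act y).map f
    simp only [Category.assoc]
    rw [← α.mu_naturality h, ← reassoc_of% α.mu_naturality rfl, ← Functor.map_comp_assoc,
      ← θ.naturality, Functor.map_comp_assoc, reassoc_of% h1, ← reassoc_of% α.un_naturality f]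

theorem NatSp.conj_at {x y : G} (g : G) (h : g * x * g⁻¹ = y) (θ : α.NatSp x) (Z : α.H) :
    (θ.conj g h).at Z = α.un Z ≫ dag (α.mu (mul_inv_cancel g) Z) ≫
      (α.act g).map (θ.at ((α.act g⁻¹).obj Z)) ≫ α.mu rfl ((α.act g⁻¹).obj Z) ≫ α.mu h Z := rfl

/-- The characterization of `χ_α(g)`. -/
theorem NatSp.conj_act {x y c : G} (g : G) (h : g * x * g⁻¹ = y) (h1 : y * g = c)
    (h2 : g * x = c) (θ : α.NatSp x) (W : α.H) :
    (θ.conj g h).at ((α.act g).obj W) ≫ α.mu h1 W = (α.act g).map (θ.at W) ≫ α.mu h2 W := by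
  subst h2
  rw [NatSp.conj_at]
  simp only [Category.assoc]
  have m1 := α.mu_mu (inv_mul_cancel g) h (mul_one (g * x)) h1 W
  have m2 := α.mu_mu (inv_mul_cancel g) (mul_inv_cancel g) (mul_one g) (one_mul g) W
  have m3 : dag (α.mu (mul_inv_cancel g) ((α.act g).obj W)) ≫
      (α.act g).map (α.mu (inv_mul_cancel g) W) =
        α.mu (one_mul g) W ≫ (α.act g).map (α.un W) := by
    rw [← dag_mu_right]
    have hu := α.mu_unitary (mul_inv_cancel g) ((α.act g).obj W)
    have hu' := α.mu_unitary (mul_one g) W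
    calc dag (α.mu (mul_inv_cancel g) ((α.act g).obj W)) ≫
          (α.act g).map (α.mu (inv_mul_cancel g) W)
        = dag (α.mu (mul_inv_cancel g) ((α.act g).obj W)) ≫
          ((α.act g).map (α.mu (inv_mul_cancel g) W) ≫ α.mu (mul_one g) W) ≫
            dag (α.mu (mul_one g) W) := by rw [Category.assoc, hu'.1, Category.comp_id]
      _ = _ := by rw [m2, Category.assoc, reassoc_of% hu.2]
  rw [← m1, ← reassoc_of% α.mu_naturality rfl, ← Functor.map_comp_assoc, ← θ.naturality,
    Functor.map_comp_assoc, reassoc_of% m3, reassoc_of% α.un_mu, ← Functor.map_comp_assoc,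
    θ.naturality, Functor.map_comp_assoc, reassoc_of% α.mu_naturality rfl, α.map_un_mu,
    Category.comp_id]

/-- A natural transformation is determined by its components on the image of `α_g`. -/
theorem NatSp.ext_act {y : G} (g : G) {θ θ' : α.NatSp y}
    (h : ∀ W, θ.at ((α.act g).obj W) = θ'.at ((α.act g).obj W)) : θ = θ' := by
  refine NatSp.ext fun Z => ?_
  have h1 := θ.naturality (α.un Z ≫ dag (α.mu (mul_inv_cancel g) Z))
  have h2 := θ'.naturality (α.un Z ≫ dag (α.mu (mul_inv_cancel g) Z))
  rw [h, h2] at h1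
  have hu : IsUnitary ((α.act y).map (α.un Z ≫ dag (α.mu (mul_inv_cancel g) Z))) :=
    (α.act_linearStar y).map_unitary ((α.un_unitary Z).comp (α.mu_unitary _ Z).dag)
  have : Mono ((α.act y).map (α.un Z ≫ dag (α.mu (mul_inv_cancel g) Z))) :=
    (inferInstance : Mono hu.iso.hom)
  exact (cancel_mono _).1 h1.symm

theorem IsUnitary_mono {H : Type u} [Category.{v} H] [Abelian H] [Linear ℂ H] [TwoHilbert H]
    {X Y : H} {f : X ⟶ Y} (h : IsUnitary f) : Mono f := (inferInstance : Mono h.iso.hom)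

theorem IsUnitary_epi {H : Type u} [Category.{v} H] [Abelian H] [Linear ℂ H] [TwoHilbert H]
    {X Y : H} {f : X ⟶ Y} (h : IsUnitary f) : Epi f := (inferInstance : Epi h.iso.hom)

/-- Uniqueness in `conj_act`. -/
theorem NatSp.eq_conj {x y c : G} (g : G) (h : g * x * g⁻¹ = y) (h1 : y * g = c)
    (h2 : g * x = c) (θ : α.NatSp x) (ψ : α.NatSp y)
    (hψ : ∀ W, ψ.at ((α.act g).obj W) ≫ α.mu h1 W = (α.act g).map (θ.at W) ≫ α.mu h2 W) :
    θ.conj g h = ψ := by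
  refine NatSp.ext_act g fun W => ?_
  have := IsUnitary_mono (α.mu_unitary h1 W)
  rw [← cancel_mono (α.mu h1 W), NatSp.conj_act g h h1 h2, hψ]

theorem NatSp.conj_one {x : G} (h : 1 * x * 1⁻¹ = x) (θ : α.NatSp x) : θ.conj 1 h = θ := by
  refine NatSp.eq_conj 1 h (mul_one x) (one_mul x) θ θ fun W => ?_
  have := IsUnitary_epi (α.un_unitary W)
  rw [← cancel_epi (α.un W), reassoc_of% θ.naturality, α.map_un_mu, Category.comp_id,
    reassoc_of% α.un_naturality, α.un_mu, Category.comp_id]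

theorem NatSp.conj_mul {x y z : G} (g g' : G) (h : g * x * g⁻¹ = y) (h' : g' * y * g'⁻¹ = z)
    (h'' : g' * g * x * (g' * g)⁻¹ = z) (θ : α.NatSp x) :
    θ.conj (g' * g) h'' = (θ.conj g h).conj g' h' := by
  have e1 : y * g = g * x := by rw [← h]; group
  have e2 : z * g' = g' * y := by rw [← h']; group
  have e3 : z * (g' * g) = g' * g * x := by rw [← h'']; group
  have e4 : g' * y * g = g' * g * x := by rw [mul_assoc, e1, mul_assoc]
  have e5 : g' * (g * x) = g' * g * x := by rw [mul_assoc]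
  refine NatSp.eq_conj (g' * g) h'' e3 rfl θ _ fun W => ?_
  have := IsUnitary_epi (α.mu_unitary (rfl : g' * g = g' * g) W)
  rw [← cancel_epi (α.mu rfl W), reassoc_of% NatSp.naturality, α.mu_mu rfl e2 e3 e4,
    reassoc_of% NatSp.conj_act g' h' e2 rfl, ← α.mu_mu e1 rfl e5 e4, ← Functor.map_comp_assoc,
    NatSp.conj_act g h e1 rfl, Functor.map_comp_assoc, α.mu_mu rfl rfl e5 rfl,
    reassoc_of% α.mu_naturality]

theorem NatSp.ip_unitary {x : G} (θ θ' : α.NatSp x) {Z W : α.H} {f : Z ⟶ W} (hf : IsUnitary f) :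
    ip (θ.at Z) (θ'.at Z) = ip (θ.at W) (θ'.at W) := by
  have hf' := (α.act_linearStar x).map_unitary hf
  rw [← hf'.ip_comp_right, ← θ.naturality, ← θ'.naturality, hf.ip_comp_left]

theorem NatSp.ip_conj {x y : G} (g : G) (h : g * x * g⁻¹ = y) (θ θ' : α.NatSp x) (W : α.H) :
    ip ((θ.conj g h).at ((α.act g).obj W)) ((θ'.conj g h).at ((α.act g).obj W)) =
      ip (θ.at W) (θ'.at W) := by
  have e1 : y * g = g * x := by rw [← h]; group
  rw [← (α.mu_unitary e1 W).ip_comp_right, NatSp.conj_act g h e1 rfl,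
    NatSp.conj_act g h e1 rfl, (α.mu_unitary _ W).ip_comp_right, α.act_inner]

end TwoRep

namespace MarkedTwoRep

variable (α : MarkedTwoRep.{v, u} G)

instance : Fintype α.I := Fintype.ofFinite _

/-- The components of a natural transformation on the distinguished simple objects. -/
def comps (x : G) : α.NatSp x →ₗ[ℂ] ∀ i, HomSp (α.e i) ((α.act x).obj (α.e i)) where
  toFun θ i := HomSp.up (θ.at (α.e i))
  map_add' _ _ := rfl
  map_smul' _ _ := rfl

theorem comps_injective (x : G) : Function.Injective (α.comps x) := by
  rw [← LinearMap.ker_eq_bot, LinearMap.ker_eq_bot']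
  intro θ h
  refine NatTrans.ext (funext fun Z => app_eq_zero θ (fun S hS => ?_) Z)
  obtain ⟨i, ⟨a⟩, -⟩ := α.marking S hS
  have h1 : θ.at (α.e i) = 0 := congrArg HomSp.down (congrFun h i)
  have h2 := θ.naturality a.hom
  rw [h1] at h2
  change θ.at S = 0
  rw [← cancel_mono ((α.act x).map a.hom), ← h2]
  simp

/-- The inner product `(θ, θ') = ∑ i, k i * (θ_{e i}, θ'_{e i})` on `Nat(id, α_x)`, where
`k i` is the scale factor of `e i`. -/
@[reducible]
def natCore (x : G) : InnerProductSpace.Core ℂ (α.NatSp x) where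
  inner θ θ' := ∑ i : α.I, (scale (α.e i) : ℂ) * ip (θ.at (α.e i)) (θ'.at (α.e i))
  conj_inner_symm θ θ' :=
    (weightedCore (V := fun i => HomSp (α.e i) ((α.act x).obj (α.e i))) (fun i => scale (α.e i))
      fun _ => scale_pos _).conj_inner_symm (α.comps x θ) (α.comps x θ')
  re_inner_nonneg θ :=
    (weightedCore (V := fun i => HomSp (α.e i) ((α.act x).obj (α.e i))) (fun i => scale (α.e i))
      fun _ => scale_pos _).re_inner_nonneg (α.comps x θ)
  add_left θ θ' θ'' :=
    (weightedCore (V := fun i => HomSp (α.e i) ((α.act x).obj (α.e i))) (fun i => scale (α.e i))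
      fun _ => scale_pos _).add_left (α.comps x θ) (α.comps x θ') (α.comps x θ'')
  smul_left θ θ' c :=
    (weightedCore (V := fun i => HomSp (α.e i) ((α.act x).obj (α.e i))) (fun i => scale (α.e i))
      fun _ => scale_pos _).smul_left (α.comps x θ) (α.comps x θ') c
  definite θ h := α.comps_injective x (by
    rw [map_zero]
    exact (weightedCore (V := fun i => HomSp (α.e i) ((α.act x).obj (α.e i)))
      (fun i => scale (α.e i)) fun _ => scale_pos _).definite (α.comps x θ) h)

instance (x : G) : NormedAddCommGroup (α.NatSp x) := (α.natCore x).toNormedAddCommGroup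

instance (x : G) : InnerProductSpace ℂ (α.NatSp x) := InnerProductSpace.ofCore (α.natCore x).toCore

instance (x : G) : FiniteDimensional ℂ (α.NatSp x) :=
  FiniteDimensional.of_injective (α.comps x) (α.comps_injective x)

/-- The 2-character `χ_α` of a marked unitary 2-representation: the fibre at `x` is
`Nat(id, α_x)`, and `g` acts by conjugation with `α_g`. -/
def twoChar : HilbG.{v, max u v} G where
  fib x := α.NatSp x.pt
  map {x y} f := LinearMap.isometryOfInner
    { toFun := TwoRep.NatSp.conj f.g f.conj
      map_add' := fun θ θ' => TwoRep.NatSp.ext fun Z => by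
        change _ = (TwoRep.NatSp.conj f.g f.conj θ).at Z + (TwoRep.NatSp.conj f.g f.conj θ').at Z
        simp only [TwoRep.NatSp.conj_at]
        change _ ≫ _ ≫ (α.act f.g).map (θ.at _ + θ'.at _) ≫ _ = _
        rw [(α.act_linearStar f.g).map_add]
        simp only [Preadditive.add_comp, Preadditive.comp_add]
        rfl
      map_smul' := fun c θ => TwoRep.NatSp.ext fun Z => by
        change _ = c • (TwoRep.NatSp.conj f.g f.conj θ).at Z
        simp only [TwoRep.NatSp.conj_at]
        change _ ≫ _ ≫ (α.act f.g).map (c • θ.at _) ≫ _ = _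
        rw [(α.act_linearStar f.g).map_smul]
        simp only [Linear.smul_comp, Linear.comp_smul]
        rfl }
    (fun θ θ' => by
      change ∑ i : α.I, (scale (α.e i) : ℂ) * ip ((TwoRep.NatSp.conj f.g f.conj θ).at (α.e i))
          ((TwoRep.NatSp.conj f.g f.conj θ').at (α.e i)) =
        ∑ i : α.I, (scale (α.e i) : ℂ) * ip (θ.at (α.e i)) (θ'.at (α.e i))
      rw [← Equiv.sum_comp (MulAction.toPerm f.g)]
      refine Finset.sum_congr rfl fun i _ => ?_
      obtain ⟨a⟩ := α.smul_iso f.g i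
      obtain ⟨w, hw⟩ := exists_unitary a
      rw [MulAction.toPerm_apply, ← scale_eq_of_unitary hw, α.scale_act,
        ← TwoRep.NatSp.ip_unitary _ _ hw, TwoRep.NatSp.ip_conj])
  map_id x θ := TwoRep.NatSp.conj_one _ θ
  map_comp f g θ := TwoRep.NatSp.conj_mul f.g g.g f.conj g.conj _ θ

end MarkedTwoRep

/-! ### The 2-character on morphisms -/

/-- An even-handed ambidextrous adjoint of a linear `*`-functor `F : H ⥤ H'` between 2-Hilbert
spaces: a linear `*`-functor `R` with adjunctions `F ⊣ R` and `R ⊣ F`, such that the adjunction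
isomorphisms `φ : Hom(F x, y) ≃ Hom(x, R y)` and `ψ : Hom(R y, x) ≃ Hom(y, F x)` are related by
`ψ = * φ^* *`, where `φ^*` is the adjoint of the linear map `φ` of Hilbert spaces. -/
structure EvenHandedAdj {H H' : Type u} [Category.{v} H] [Abelian H] [Linear ℂ H] [TwoHilbert H]
    [Category.{v} H'] [Abelian H'] [Linear ℂ H'] [TwoHilbert H'] (F : H ⥤ H') where
  R : H' ⥤ H
  linearStar : IsLinearStar R
  right : F ⊣ R
  left : R ⊣ F
  evenHanded : ∀ (x : H) (y : H') (h : F.obj x ⟶ y) (f : R.obj y ⟶ x),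
    ip (right.homEquiv x y h) (dag f) = ip h (dag (left.homEquiv y x f))

namespace TwoRepHom

section

variable {α β : TwoRep.{v, u} G} (σ : TwoRepHom α β)

theorem dag_co_naturality (g : G) {X Y : α.H} (f : X ⟶ Y) :
    σ.functor.map ((α.act g).map f) ≫ dag (σ.co g Y) =
      dag (σ.co g X) ≫ (β.act g).map (σ.functor.map f) := by
  have h := congrArg (fun t => dag (σ.co g X) ≫ t ≫ dag (σ.co g Y)) (σ.co_naturality g f)
  simp only [Category.assoc] at h
  rw [(σ.co_unitary g Y).1, reassoc_of% (σ.co_unitary g X).2, Category.comp_id] at h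
  exact h.symm

/-- The value of `χ(σ)_x : Nat(id, α_x) → Nat(id, β_x)` at `θ`, computed with an even-handed
adjoint `σ*` of `σ`: its component at `y` is the composite
`y ⟶ σ σ* y ⟶ σ α_x σ* y ⟶ β_x σ σ* y ⟶ β_x y` of the unit of `σ* ⊣ σ`, of `σ(θ)`, of
`σ(x)* = σ(x)⁻¹` and of `β_x` applied to the counit of `σ ⊣ σ*`. -/
def charMap (A : EvenHandedAdj σ.functor) (x : G) (θ : α.NatSp x) : β.NatSp x where
  app y := A.left.unit.app y ≫ σ.functor.map (θ.at (A.R.obj y)) ≫ dag (σ.co x (A.R.obj y)) ≫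
    (β.act x).map (A.right.counit.app y)
  naturality y y' f := by
    have h1 : f ≫ A.left.unit.app y' = A.left.unit.app y ≫ σ.functor.map (A.R.map f) :=
      A.left.unit.naturality f
    have h2 : σ.functor.map (A.R.map f) ≫ A.right.counit.app y' = A.right.counit.app y ≫ f :=
      A.right.counit.naturality f
    change f ≫ A.left.unit.app y' ≫ _ = (A.left.unit.app y ≫ _) ≫ (β.act x).map f
    simp only [Category.assoc]
    rw [← Functor.map_comp, ← h2, Functor.map_comp, reassoc_of% h1, ← Functor.map_comp_assoc,
      θ.naturality, Functor.map_comp_assoc, reassoc_of% σ.dag_co_naturality x (A.R.map f)]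

end

end TwoRepHom

/-! ### Functors with a prescribed object map -/

/-- A functor with a prescribed action on objects: a functorial action on morphisms. -/
structure FunctorOn {C : Type*} {D : Type*} [Category C] [Category D] (obj : C → D) where
  map : ∀ {X Y : C}, (X ⟶ Y) → (obj X ⟶ obj Y)
  map_id : ∀ X : C, map (𝟙 X) = 𝟙 (obj X)
  map_comp : ∀ {X Y Z : C} (f : X ⟶ Y) (g : Y ⟶ Z), map (f ≫ g) = map f ≫ map g

/-- The functor. -/
def FunctorOn.toFunctor {C : Type*} {D : Type*} [Category C] [Category D] {obj : C → D}
    (F : FunctorOn obj) : C ⥤ D where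
  obj := obj
  map := F.map
  map_id := F.map_id
  map_comp := F.map_comp

end

/-! In a 2-Hilbert space everything can be computed on simple objects. By Schur's lemma `Hom(e_i,
e_j)` is zero for `i ≠ j` and a line for `i = j`, spanned by an identity of squared norm `k_i`.
Hence the identity of any object `X` is `∑ k_i ∑ b_c* b_c`, with `b` an orthonormal basis of
`Hom(e_i, X)` (`resolution`). Inserting arbitrary maps `e_i ⟶ F e_i` between the two factors
produces every natural transformation `id ⇒ F` (`casSum`).

Adjoints: a count of dimensions on simple objects shows that `Hom(F -, y)` is isometrically
representable. The resulting adjunction isomorphism `φ` is unitary, its Hilbert space adjoint is its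
inverse, and the formula for `ψ` supplies the other adjunction (`exists_evenHandedAdj`). For an
arbitrary even-handed adjoint, `φ` need not be unitary, but `φ⁻¹` and `φ†` carry dual families to
dual families (`EvenHandedAdj.isFrame`). Inserting the resolution of the identity of `σ* y` into the
string diagram of `χ(σ)` therefore yields `∑ k_i ∑ b_c* ≫ σ(θ) ≫ σ(x)* ≫ β_x(b_c)` with `b` an
orthonormal basis of `Hom(σ e_i, y)` (`charMap_eq`). The adjoint has disappeared. Equivariance and
invariance under isomorphism become changes of dual bases, while composition is read off from the
diagram of a composite adjoint.

Gerbes: `⟨τσ⟩` is identified with `⟨τ⟩ ∘ ⟨σ⟩` by composing morphisms, and the inverse is again the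
resolution of the identity. The character `ch` respects composition because an arrow over `x`
permutes the summands of a composite bundle: only the fixed ones contribute to the trace, and on
these the trace is multiplicative (`loopTrace_comp`).

Comparison: `Hom(e_i, α_x e_i)` vanishes unless `x i = i`, and is otherwise the line spanned by any
arrow `u` of the gerbe over the loop. So `θ` carries the same information as the section `u ↦ (u,
θ_{e_i}) / √k_i`, and the square root makes this correspondence unitary. Its naturality rests on
`conj_loopTrace`: since `*` takes orthonormal bases of `Hom(e_μ, σ e_i)` to orthonormal bases of
`Hom(σ e_i, e_μ)`, the conjugate of the trace of `⟨σ⟩(u' ⊗ u)` is a pairing of `u'` with the basis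
formula for `χ(σ)`. -/

noncomputable section

open TwoHilbert

/-! ### Dual families in hom-spaces and the natural transformations built from them. -/

namespace TwoHilbert

section bases

variable {H : Type u} [Category.{v} H] [Abelian H] [Linear ℂ H] [TwoHilbert H]

theorem ip_add_right {X Y : H} (f g h : X ⟶ Y) : ip f (g + h) = ip f g + ip f h := by
  rw [← ip_conj, ip_add_left, map_add, ip_conj, ip_conj]

theorem ip_sum_left {X Y : H} {ι : Type*} (s : Finset ι) (f : ι → (X ⟶ Y)) (g : X ⟶ Y) :
    ip (∑ c ∈ s, f c) g = ∑ c ∈ s, ip (f c) g :=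
  map_sum (AddMonoidHom.mk' (fun f : X ⟶ Y => ip f g) fun f f' => ip_add_left f f' g) f s

theorem ip_sum_right {X Y : H} {ι : Type*} (s : Finset ι) (f : X ⟶ Y) (g : ι → (X ⟶ Y)) :
    ip f (∑ c ∈ s, g c) = ∑ c ∈ s, ip f (g c) :=
  map_sum (AddMonoidHom.mk' (fun g : X ⟶ Y => ip f g) fun g g' => ip_add_right f g g') g s

theorem dag_sum {X Y : H} {ι : Type*} (s : Finset ι) (f : ι → (X ⟶ Y)) :
    dag (∑ c ∈ s, f c) = ∑ c ∈ s, dag (f c) :=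
  map_sum (AddMonoidHom.mk' (fun f : X ⟶ Y => dag f) fun f f' => dag_add f f') f s

theorem ip_ext {X Y : H} {f g : X ⟶ Y} (h : ∀ w, ip w f = ip w g) : f = g := by
  refine sub_eq_zero.1 (eq_zero_of_ip_self _ ?_)
  have h1 : f - g = f + (-1 : ℂ) • g := by rw [neg_one_smul, sub_eq_add_neg]
  have h2 : ip (f - g) (f - g) = ip (f - g) (f + (-1 : ℂ) • g) := by rw [← h1]
  rw [h2, ip_add_right, ip_smul_right, h]
  ring

/-- Both sides equal `ip (𝟙 X) (f ≫ dag g)`. Thus `*` is antiunitary, a fact not among the axioms.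
-/
theorem ip_dag {X Y : H} (f g : X ⟶ Y) : ip (dag f) (dag g) = ip g f := by
  have h := ip_comp_right (dag f) (𝟙 X) (dag g)
  have h' := ip_comp_left (𝟙 X) g f
  rw [Category.id_comp] at h'
  rw [Category.comp_id, dag_dag] at h
  rw [h, h']

/-- Two finite families in a hom-space which are dual to each other. -/
def IsFrame {X Y : H} {ι : Type*} [Fintype ι] (p q : ι → (X ⟶ Y)) : Prop :=
  ∀ w : X ⟶ Y, ∑ c, ip (p c) w • q c = w

/-- The operator `w ↦ ∑ (q c, w) p c` is the Hilbert space adjoint of `w ↦ ∑ (p c, w) q c`, and the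
adjoint of the identity is the identity. -/
theorem IsFrame.symm {X Y : H} {ι : Type*} [Fintype ι] {p q : ι → (X ⟶ Y)} (h : IsFrame p q) :
    IsFrame q p := by
  intro w
  refine ip_ext fun z => ?_
  have h1 := congrArg (fun t => ip t w) (h z)
  simp only [ip_sum_left, ip_smul_left, ip_conj] at h1
  rw [← h1, ip_sum_right]
  refine Finset.sum_congr rfl fun c _ => ?_
  rw [ip_smul_right, mul_comm]

/-- The index type of the chosen orthonormal basis of a hom-space. -/
abbrev OnbIx (X Y : H) : Type := Fin (Module.finrank ℂ (HomSp X Y))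

/-- An orthonormal basis of a hom-space. -/
def onb (X Y : H) (c : OnbIx X Y) : X ⟶ Y := (stdOrthonormalBasis ℂ (HomSp X Y) c).down

theorem onb_isFrame (X Y : H) : IsFrame (onb X Y) (onb X Y) := by
  intro w
  have h := congrArg HomSp.down
    ((stdOrthonormalBasis ℂ (HomSp X Y)).sum_repr' (HomSp.up w))
  refine Eq.trans ?_ h
  exact (map_sum (ULift.moduleEquiv (R := ℂ) (M := (X ⟶ Y))) _ _).symm

theorem sum_onb {X Y : H} (w : X ⟶ Y) : ∑ c, ip (onb X Y c) w • onb X Y c = w :=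
  onb_isFrame X Y w

theorem IsLinearStar.map_sum {K : Type w} [Category.{v} K] [Abelian K] [Linear ℂ K]
    [TwoHilbert K] {F : H ⥤ K} (hF : IsLinearStar F) {X Y : H} {ι : Type*} (s : Finset ι)
    (f : ι → (X ⟶ Y)) : F.map (∑ c ∈ s, f c) = ∑ c ∈ s, F.map (f c) :=
  _root_.map_sum (AddMonoidHom.mk' (fun f : X ⟶ Y => F.map f) fun f f' => hF.map_add f f') f s

variable {F : H ⥤ H}

/-- The summand is conjugate linear in `p c` and linear in `q c`, so the sum depends only on the
canonical tensor `∑ p̄ c ⊗ q c`, which is the same for every frame. Allowing frames that are not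
orthonormal matters later, when frames are transported along maps that are invertible but not
unitary. -/
theorem frame_sum_eq (hF : IsLinearStar F) {X Y : H} (a : X ⟶ F.obj X)
    {ι κ : Type*} [Fintype ι] [Fintype κ] {p q : ι → (X ⟶ Y)} {p' q' : κ → (X ⟶ Y)}
    (h : IsFrame p q) (h' : IsFrame p' q') :
    ∑ c, dag (p c) ≫ a ≫ F.map (q c) = ∑ d, dag (p' d) ≫ a ≫ F.map (q' d) := by
  calc ∑ c, dag (p c) ≫ a ≫ F.map (q c)
      = ∑ c, ∑ d, ip (p' d) (q c) • (dag (p c) ≫ a ≫ F.map (q' d)) := by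
        refine Finset.sum_congr rfl fun c _ => ?_
        conv_lhs => rw [← h' (q c)]
        rw [hF.map_sum, Preadditive.comp_sum, Preadditive.comp_sum]
        refine Finset.sum_congr rfl fun d _ => ?_
        rw [hF.map_smul, Linear.comp_smul, Linear.comp_smul]
    _ = ∑ d, ∑ c, ip (p' d) (q c) • (dag (p c) ≫ a ≫ F.map (q' d)) := Finset.sum_comm
    _ = _ := by
        refine Finset.sum_congr rfl fun d _ => ?_
        conv_rhs => rw [← h.symm (p' d)]
        rw [dag_sum, Preadditive.sum_comp]
        refine Finset.sum_congr rfl fun c _ => ?_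
        rw [dag_smul, ip_conj, Linear.smul_comp]

variable (F) in
/-- The morphism `∑ c, b_c* ≫ a ≫ F(b_c)`, where `b` is an orthonormal basis of `Hom(X, Y)`. -/
def cas {X : H} (a : X ⟶ F.obj X) (Y : H) : Y ⟶ F.obj Y :=
  ∑ c, dag (onb X Y c) ≫ a ≫ F.map (onb X Y c)

theorem cas_eq (hF : IsLinearStar F) {X Y : H} (a : X ⟶ F.obj X)
    {ι : Type*} [Fintype ι] {p q : ι → (X ⟶ Y)} (h : IsFrame p q) :
    cas F a Y = ∑ c, dag (p c) ≫ a ≫ F.map (q c) :=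
  frame_sum_eq hF a (onb_isFrame X Y) h

/-- Postcomposition with `f` and postcomposition with `dag f` are adjoint maps between `Hom(X, Y)`
and `Hom(X, Y')`. Both sides expand into the same double sum, whose coefficients are the matrix
elements `ip (onb X Y' d) (onb X Y c ≫ f)`. -/
theorem cas_naturality (hF : IsLinearStar F) {X : H} (a : X ⟶ F.obj X) {Y Y' : H} (f : Y ⟶ Y') :
    f ≫ cas F a Y' = cas F a Y ≫ F.map f := by
  unfold cas
  rw [Preadditive.comp_sum, Preadditive.sum_comp]
  calc ∑ d, f ≫ dag (onb X Y' d) ≫ a ≫ F.map (onb X Y' d)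
      = ∑ d, ∑ c, ip (onb X Y' d) (onb X Y c ≫ f) •
          (dag (onb X Y c) ≫ a ≫ F.map (onb X Y' d)) := by
        refine Finset.sum_congr rfl fun d _ => ?_
        have h1 : f ≫ dag (onb X Y' d) = dag (onb X Y' d ≫ dag f) := by
          rw [dag_comp, dag_dag]
        rw [reassoc_of% h1]
        conv_lhs => rw [← sum_onb (onb X Y' d ≫ dag f)]
        rw [dag_sum, Preadditive.sum_comp]
        refine Finset.sum_congr rfl fun c _ => ?_
        rw [dag_smul, ip_conj, Linear.smul_comp, ← ip_conj, ← ip_conj (onb X Y' d),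
          TwoHilbert.ip_comp_left (onb X Y c) f, ip_conj]
    _ = ∑ c, ∑ d, ip (onb X Y' d) (onb X Y c ≫ f) •
          (dag (onb X Y c) ≫ a ≫ F.map (onb X Y' d)) := Finset.sum_comm
    _ = _ := by
        refine Finset.sum_congr rfl fun c _ => ?_
        simp only [Category.assoc]
        rw [← F.map_comp]
        conv_rhs => rw [← sum_onb (onb X Y c ≫ f)]
        rw [hF.map_sum, Preadditive.comp_sum, Preadditive.comp_sum]
        refine Finset.sum_congr rfl fun d _ => ?_
        rw [hF.map_smul, Linear.comp_smul, Linear.comp_smul]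

/-- A weighted sum of the natural transformations `cas F (a i)`. -/
def casSum {I : Type w} [Fintype I] (hF : IsLinearStar F) (k : I → ℂ) {X : I → H}
    (a : ∀ i, X i ⟶ F.obj (X i)) : 𝟭 H ⟶ F where
  app Y := ∑ i, k i • cas F (a i) Y
  naturality Y Y' f := by
    change f ≫ ∑ i, k i • cas F (a i) Y' = (∑ i, k i • cas F (a i) Y) ≫ F.map f
    rw [Preadditive.comp_sum, Preadditive.sum_comp]
    refine Finset.sum_congr rfl fun i _ => ?_
    rw [Linear.comp_smul, Linear.smul_comp, cas_naturality hF]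

theorem ip_id_eq_scale (X : H) : ip (𝟙 X) (𝟙 X) = (scale X : ℂ) :=
  Complex.ext rfl (by rw [ip_self_im]; simp)

theorem scale_ne_zero (X : H) [Simple X] : (scale X : ℂ) ≠ 0 :=
  Complex.ofReal_ne_zero.2 (scale_pos X).ne'

/-- Schur's lemma gives a scalar, and pairing with the identity, of squared norm `scale S`,
determines it. This division is the source of the weights `k_i` in all later sums over simple
objects. -/
theorem comp_dag_simple {S Z : H} [Simple S] (t s : S ⟶ Z) :
    t ≫ dag s = (ip s t / scale S) • 𝟙 S := by
  obtain ⟨c, hc⟩ := schur (t ≫ dag s)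
  have h := TwoHilbert.ip_comp_left (𝟙 S) s t
  rw [Category.id_comp, hc, ip_smul_right, ip_id_eq_scale] at h
  rw [hc, h, mul_div_cancel_right₀ _ (scale_ne_zero S)]

theorem endo_simple {S : H} [Simple S] (t : S ⟶ S) : (ip (𝟙 S) t / scale S) • 𝟙 S = t := by
  rw [← comp_dag_simple, dag_id, Category.comp_id]

/-- Putting the whole normalization on one of the two families avoids the square root that an
orthonormal basis of `Hom(S, S)` would require. -/
theorem id_isFrame (S : H) [Simple S] :
    IsFrame (fun _ : Unit => 𝟙 S) (fun _ : Unit => ((scale S : ℂ)⁻¹) • 𝟙 S) := by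
  intro w
  rw [Fintype.sum_unique, smul_smul, ← div_eq_mul_inv, endo_simple]

end bases

end TwoHilbert

/-! ### Semisimplicity in terms of the distinguished simple objects. -/

namespace MarkedTwoRep

variable {G : Type v} [Group G] (α : MarkedTwoRep.{v, u} G)

theorem eq_of_iso {i j : α.I} (a : α.e i ≅ α.e j) : i = j :=
  (α.marking (α.e i) (α.simple i)).unique ⟨Iso.refl _⟩ ⟨a⟩

theorem hom_eq_zero {i j : α.I} (h : i ≠ j) (f : α.e i ⟶ α.e j) : f = 0 := by
  by_contra hf
  have := isIso_of_hom_simple hf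
  exact h (α.eq_of_iso (asIso f))

variable {α}

theorem nat_ext {F : α.H ⥤ α.H} {θ θ' : 𝟭 α.H ⟶ F} (h : ∀ i, θ.app (α.e i) = θ'.app (α.e i)) :
    θ = θ' := by
  refine sub_eq_zero.1 (NatTrans.ext (funext fun Z => app_eq_zero (θ - θ') (fun S hS => ?_) Z))
  obtain ⟨i, ⟨a⟩, -⟩ := α.marking S hS
  have h1 : (θ - θ').app (α.e i) = 0 := by
    rw [NatTrans.app_sub, h, sub_self]
  have h2 : a.hom ≫ (θ - θ').app (α.e i) = (θ - θ').app S ≫ F.map a.hom :=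
    (θ - θ').naturality a.hom
  rw [← cancel_mono (F.map a.hom), ← h2, h1]
  exact comp_zero.trans zero_comp.symm

/-- The weight cancels the inverse scale in the frame `id_isFrame`. -/
theorem cas_e {F : α.H ⥤ α.H} (hF : IsLinearStar F) (i : α.I) (a : α.e i ⟶ F.obj (α.e i)) :
    (scale (α.e i) : ℂ) • cas F a (α.e i) = a := by
  rw [cas_eq hF a (id_isFrame (α.e i)), Fintype.sum_unique, hF.map_smul, dag_id, F.map_id,
    Linear.comp_smul, Category.id_comp, Category.comp_id, smul_smul,
    mul_inv_cancel₀ (scale_ne_zero _), one_smul]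

theorem cas_e_ne {F : α.H ⥤ α.H} {i j : α.I} (h : i ≠ j)
    (a : α.e i ⟶ F.obj (α.e i)) : cas F a (α.e j) = 0 := by
  unfold cas
  refine Finset.sum_eq_zero fun c _ => ?_
  rw [α.hom_eq_zero h (onb (α.e i) (α.e j) c), dag_zero, zero_comp]

/-- Together with `nat_ext` this identifies `Nat(id, F)` with the product of the spaces `Hom(e_i, F
e_i)`: the components at the marked simple objects may be prescribed freely. -/
theorem casSum_e {F : α.H ⥤ α.H} (hF : IsLinearStar F) (a : ∀ i, α.e i ⟶ F.obj (α.e i)) (j : α.I) :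
    (casSum hF (fun i => (scale (α.e i) : ℂ)) a).app (α.e j) = a j := by
  change ∑ i, (scale (α.e i) : ℂ) • cas F (a i) (α.e j) = a j
  rw [Finset.sum_eq_single j (fun i _ h => by rw [cas_e_ne h, smul_zero])
    (fun h => absurd (Finset.mem_univ _) h), cas_e hF]

theorem casSum_eq {F : α.H ⥤ α.H} (hF : IsLinearStar F) (θ : 𝟭 α.H ⟶ F) :
    casSum hF (fun i => (scale (α.e i) : ℂ)) (fun i => θ.app (α.e i)) = θ :=
  nat_ext fun j => casSum_e hF (fun i => θ.app (α.e i)) j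

/-- The identity of `X` is the sum of the projections to simple objects. -/
theorem resolution (X : α.H) :
    ∑ i, (scale (α.e i) : ℂ) • ∑ c, dag (onb (α.e i) X c) ≫ onb (α.e i) X c = 𝟙 X := by
  have hF : IsLinearStar (𝟭 α.H) := ⟨fun _ _ => rfl, fun _ _ => rfl, fun _ => rfl⟩
  -- The identity transformation of the identity functor is recovered from its components at simple
  -- objects.
  refine Eq.trans ?_ (congrArg (fun t => NatTrans.app t X) (casSum_eq hF (𝟙 (𝟭 α.H))))
  refine Finset.sum_congr rfl fun i _ => ?_
  congr 1
  refine Finset.sum_congr rfl fun c _ => ?_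
  exact congrArg (fun t => dag (onb (α.e i) X c) ≫ t) (Category.id_comp _).symm

end MarkedTwoRep

end

noncomputable section

open TwoHilbert

/-! ### Existence of even-handed adjoints -/

namespace MarkedTwoRep

variable {G : Type v} [Group G] (α : MarkedTwoRep.{v, u} G)

/-- There are objects with prescribed multiplicities. -/
theorem exists_finrank (n : α.I → ℕ) :
    ∃ R : α.H, ∀ i, Module.finrank ℂ (HomSp (α.e i) R) = n i := by
  -- The object is the direct sum of `n i` copies of each `e i`.
  let f : (Σ i, Fin (n i)) → α.H := fun p => α.e p.1
  have : HasFiniteBiproducts α.H := Abelian.hasFiniteBiproducts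
  have : HasBiproductsOfShape (Σ i, Fin (n i)) α.H := hasBiproductsOfShape_finite _
  refine ⟨⨁ f, fun i => ?_⟩
  -- Up to the factor `scale (α.e i)`, these are the scalar coordinates of `t` at the copies of `e
  -- i`. The other coordinates vanish by Schur's lemma, which gives injectivity.
  let T : (α.e i ⟶ ⨁ f) →ₗ[ℂ] (Fin (n i) → ℂ) :=
    { toFun := fun t a => ip (𝟙 (α.e i)) (t ≫ biproduct.π f ⟨i, a⟩)
      map_add' := fun t t' => funext fun a => by
        rw [Preadditive.add_comp]; exact ip_add_right _ _ _
      map_smul' := fun c t => funext fun a => by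
        rw [Linear.smul_comp]; exact ip_smul_right _ _ _ }
  have hinj : Function.Injective T := by
    rw [← LinearMap.ker_eq_bot, LinearMap.ker_eq_bot']
    intro t ht
    refine biproduct.hom_ext _ _ fun p => ?_
    obtain ⟨j, a⟩ := p
    rw [zero_comp]
    by_cases hj : i = j
    · subst hj
      have h1 : ip (𝟙 (α.e i)) (t ≫ biproduct.π f ⟨i, a⟩) = 0 := congrFun ht a
      have h2 := endo_simple (S := α.e i) (t ≫ biproduct.π f ⟨i, a⟩)
      rw [h1, zero_div, zero_smul] at h2
      exact h2.symm
    · exact α.hom_eq_zero hj _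
  have hsurj : Function.Surjective T := by
    intro c
    refine ⟨∑ a, (c a / scale (α.e i)) • biproduct.ι f ⟨i, a⟩, funext fun b => ?_⟩
    change ip (𝟙 (α.e i)) ((∑ a, (c a / scale (α.e i)) • biproduct.ι f ⟨i, a⟩) ≫
      biproduct.π f ⟨i, b⟩) = c b
    rw [Preadditive.sum_comp, Finset.sum_eq_single b]
    · rw [Linear.smul_comp, biproduct.ι_π_self, ip_smul_right]
      refine (congrArg (fun t => c b / scale (α.e i) * t) (ip_id_eq_scale (α.e i))).trans ?_
      exact div_mul_cancel₀ _ (scale_ne_zero _)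
    · intro a _ hab
      rw [Linear.smul_comp, biproduct.ι_π_ne f (fun h => hab (by simpa using h)), smul_zero]
    · exact fun h => absurd (Finset.mem_univ _) h
  have e1 := LinearEquiv.finrank_eq ((ULift.moduleEquiv (R := ℂ) (M := (α.e i ⟶ ⨁ f))).trans
    (LinearEquiv.ofBijective T ⟨hinj, hsurj⟩))
  rw [Module.finrank_fin_fun] at e1
  exact e1

variable {α}
variable {K : Type u} [Category.{v} K] [Abelian K] [Linear ℂ K] [TwoHilbert K] {F : α.H ⥤ K}

/-- Only dimensions are matched here, separately at each simple object, and orthonormal bases are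
paired off arbitrarily. No naturality condition links different simple objects, since there are no
nonzero morphisms between them; `exists_counit` spreads the choice to all objects. -/
theorem exists_isometries (F : α.H ⥤ K) (y : K) :
    ∃ (R : α.H) (V : ∀ i, (α.e i ⟶ R) ≃ₗ[ℂ] (F.obj (α.e i) ⟶ y)),
      ∀ i t t', ip (V i t) (V i t') = ip t t' := by
  obtain ⟨R, hR⟩ := α.exists_finrank fun i => Module.finrank ℂ (HomSp (F.obj (α.e i)) y)
  let U : ∀ i, HomSp (α.e i) R ≃ₗᵢ[ℂ] HomSp (F.obj (α.e i)) y := fun i =>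
    (stdOrthonormalBasis ℂ (HomSp (α.e i) R)).equiv
      (stdOrthonormalBasis ℂ (HomSp (F.obj (α.e i)) y)) (finCongr (hR i))
  exact ⟨R, fun i => (ULift.moduleEquiv (R := ℂ) (M := (α.e i ⟶ R))).symm.trans
    ((U i).toLinearEquiv.trans (ULift.moduleEquiv (R := ℂ) (M := (F.obj (α.e i) ⟶ y)))),
    fun i t t' => (U i).inner_map_map (HomSp.up t) (HomSp.up t')⟩

/-- Inner products are determined by the composites with arrows out of simple objects. -/
theorem ip_eq_sum (hF : IsLinearStar F) {X : α.H} {y : K} (h h' : F.obj X ⟶ y) :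
    ip h h' = ∑ i, (scale (α.e i) : ℂ) *
      ∑ c, ip (F.map (onb (α.e i) X c) ≫ h) (F.map (onb (α.e i) X c) ≫ h') := by
  -- The resolution of the identity of `X` is inserted in front of `h'`, and the adjoint factors are
  -- then moved to the other side of the inner product.
  have h1 : F.map (𝟙 X) ≫ h' = h' := by rw [F.map_id, Category.id_comp]
  conv_lhs => rw [← h1, ← resolution X]
  rw [hF.map_sum, Preadditive.sum_comp, ip_sum_right]
  refine Finset.sum_congr rfl fun i _ => ?_
  rw [hF.map_smul, Linear.smul_comp, ip_smul_right, hF.map_sum, Preadditive.sum_comp, ip_sum_right]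
  congr 1
  refine Finset.sum_congr rfl fun c _ => ?_
  rw [F.map_comp, Category.assoc, hF.map_dag, TwoHilbert.ip_comp_right]

/-- The functor `Hom(F -, y)` is unitarily representable. -/
theorem exists_counit (hF : IsLinearStar F) (y : K) :
    ∃ (R : α.H) (ε : F.obj R ⟶ y),
      (∀ x : α.H, Function.Bijective fun a : x ⟶ R => F.map a ≫ ε) ∧
      ∀ (x : α.H) (a a' : x ⟶ R), ip (F.map a ≫ ε) (F.map a' ≫ ε) = ip a a' := by
  obtain ⟨R, V, hV⟩ := exists_isometries F y
  -- By Yoneda the counit must be the image of the identity of `R`, so it is the resolution of `𝟙 R`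
  -- with its right-hand factors replaced by their images under `V i`.
  let ε : F.obj R ⟶ y := ∑ i, (scale (α.e i) : ℂ) •
    ∑ c, F.map (dag (onb (α.e i) R c)) ≫ V i (onb (α.e i) R c)
  -- On arrows out of `e i` the counit reproduces the chosen isometry: Schur's lemma kills the terms
  -- `j ≠ i`, and the weight cancels the denominator in `comp_dag_simple`.
  have hε : ∀ i (t : α.e i ⟶ R), F.map t ≫ ε = V i t := by
    intro i t
    change F.map t ≫ ∑ i, (scale (α.e i) : ℂ) • _ = _
    rw [Preadditive.comp_sum, Finset.sum_eq_single i]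
    · conv_rhs => rw [← sum_onb t]
      rw [Linear.comp_smul, Preadditive.comp_sum, Finset.smul_sum, map_sum]
      refine Finset.sum_congr rfl fun c _ => ?_
      rw [← F.map_comp_assoc, comp_dag_simple, hF.map_smul, F.map_id, Linear.smul_comp,
        Category.id_comp, smul_smul, mul_div_cancel₀ _ (scale_ne_zero _), map_smul]
    · intro j _ hj
      rw [Linear.comp_smul, Preadditive.comp_sum]
      refine smul_eq_zero_of_right _ (Finset.sum_eq_zero fun c _ => ?_)
      rw [← F.map_comp_assoc, α.hom_eq_zero (fun h => hj h.symm) (t ≫ dag (onb (α.e j) R c))]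
      have : F.map (0 : α.e i ⟶ α.e j) = 0 := by
        simpa using hF.map_smul (0 : ℂ) (0 : α.e i ⟶ α.e j)
      rw [this, zero_comp]
    · exact fun h => absurd (Finset.mem_univ _) h
  have hip : ∀ (x : α.H) (a a' : x ⟶ R), ip (F.map a ≫ ε) (F.map a' ≫ ε) = ip a a' := by
    intro x a a'
    have hid : IsLinearStar (𝟭 α.H) := ⟨fun _ _ => rfl, fun _ _ => rfl, fun _ => rfl⟩
    refine (ip_eq_sum hF _ _).trans (Eq.trans ?_ (ip_eq_sum (F := 𝟭 α.H) hid a a').symm)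
    refine Finset.sum_congr rfl fun i _ => ?_
    congr 1
    refine Finset.sum_congr rfl fun c _ => ?_
    rw [← F.map_comp_assoc, ← F.map_comp_assoc, hε, hε, hV]
    rfl
  refine ⟨R, ε, fun x => ⟨fun a a' h => ?_, fun h => ?_⟩, hip⟩
  -- Injectivity follows from the isometry property.
  · refine ip_ext fun w => ?_
    have h' : F.map a ≫ ε = F.map a' ≫ ε := h
    rw [← hip, ← hip x w a', h']
  -- For surjectivity, `h` is decomposed by the resolution of the identity of `x`, and each piece,
  -- an arrow out of `F (e i)`, is lifted through `V i`.
  · refine ⟨∑ i, (scale (α.e i) : ℂ) • ∑ c, dag (onb (α.e i) x c) ≫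
      (V i).symm (F.map (onb (α.e i) x c) ≫ h), ?_⟩
    have h1 : F.map (𝟙 x) ≫ h = h := by rw [F.map_id, Category.id_comp]
    conv_rhs => rw [← h1, ← resolution x]
    change F.map _ ≫ ε = _
    rw [hF.map_sum, hF.map_sum, Preadditive.sum_comp, Preadditive.sum_comp]
    refine Finset.sum_congr rfl fun i _ => ?_
    rw [hF.map_smul, hF.map_smul, Linear.smul_comp, Linear.smul_comp, hF.map_sum, hF.map_sum,
      Preadditive.sum_comp, Preadditive.sum_comp]
    congr 1
    refine Finset.sum_congr rfl fun c _ => ?_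
    rw [F.map_comp, F.map_comp, Category.assoc, Category.assoc, hε, LinearEquiv.apply_symm_apply]

/-- Linear `*`-functors out of the 2-Hilbert space of a marked 2-representation have even-handed
adjoints. -/
theorem exists_evenHandedAdj (hF : IsLinearStar F) : Nonempty (EvenHandedAdj F) := by
  choose R ε hbij hip using exists_counit (α := α) hF
  let Φ : ∀ x y, (x ⟶ R y) ≃ (F.obj x ⟶ y) := fun x y => Equiv.ofBijective _ (hbij y x)
  have hΦ : ∀ {x y} (a : x ⟶ R y), Φ x y a = F.map a ≫ ε y := fun _ => rfl
  have hΦip : ∀ {x y} (a a' : x ⟶ R y), ip (Φ x y a) (Φ x y a') = ip a a' :=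
    fun a a' => hip _ _ a a'
  have hΦl : ∀ {x' x y} (f : x' ⟶ x) (a : x ⟶ R y), Φ x' y (f ≫ a) = F.map f ≫ Φ x y a := by
    intro x' x y f a
    rw [hΦ, hΦ, F.map_comp, Category.assoc]
  have he : ∀ (x' x : α.H) (y : K) (f : x' ⟶ x) (g : F.obj x ⟶ y),
      (Φ x' y).symm (F.map f ≫ g) = f ≫ (Φ x y).symm g := by
    intro x' x y f g
    rw [Equiv.symm_apply_eq, hΦl, Equiv.apply_symm_apply]
  let adj := Adjunction.adjunctionOfEquivRight (fun x y => (Φ x y).symm) he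
  let S : K ⥤ α.H := Adjunction.rightAdjointOfEquiv (fun x y => (Φ x y).symm) he
  have hadj : ∀ {x y} (h : F.obj x ⟶ y), adj.homEquiv x y h = (Φ x y).symm h := fun h => by
    simp [adj, Adjunction.adjunctionOfEquivRight]
  have hSr : ∀ {x : α.H} {y y' : K} (a : x ⟶ R y) (b : y ⟶ y'),
      Φ x y' (a ≫ S.map b) = Φ x y a ≫ b := by
    intro x y y' a b
    have h1 := adj.homEquiv_naturality_right (Φ x y a) b
    rw [hadj, hadj, Equiv.symm_apply_apply] at h1
    rw [Equiv.symm_apply_eq] at h1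
    exact h1.symm
  -- `Φ` turns `S b` into postcomposition with `b`. Being injective it transfers linearity, and
  -- being isometric it transfers the adjointness of postcomposition with `f` and with `dag f`.
  have hS : IsLinearStar S := by
    refine ⟨fun {y y'} f g => ?_, fun {y y'} c f => ?_, fun {y y'} f => ?_⟩
    · apply (Φ _ _).injective
      rw [← Category.id_comp (S.map (f + g)), hSr, Preadditive.comp_add, ← hSr, ← hSr,
        Category.id_comp, Category.id_comp, hΦ, hΦ, hΦ, hF.map_add, Preadditive.add_comp]
    · apply (Φ _ _).injective
      rw [← Category.id_comp (S.map (c • f)), hSr, Linear.comp_smul, ← hSr,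
        Category.id_comp, hΦ, hΦ, hF.map_smul, Linear.smul_comp]
    · refine ip_ext fun w => ?_
      rw [← Category.id_comp (S.map (dag f)), ← hΦip, hSr, ← TwoHilbert.ip_comp_left, ← hSr, hΦip,
        TwoHilbert.ip_comp_left, Category.id_comp]
  -- Here `φ` is the inverse of the isometry `Φ`, so its Hilbert space adjoint is `Φ` itself and
  -- even-handedness forces this formula for `ψ`. Its naturality is the image under `*` of the
  -- naturality of `Φ`.
  let Ψ : ∀ y x, (S.obj y ⟶ x) ≃ (y ⟶ F.obj x) := fun y x =>
    { toFun := fun f => dag (Φ x y (dag f))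
      invFun := fun h => dag ((Φ x y).symm (dag h))
      left_inv := fun f => by beta_reduce; rw [dag_dag, Equiv.symm_apply_apply, dag_dag]
      right_inv := fun h => by beta_reduce; rw [dag_dag, Equiv.apply_symm_apply, dag_dag] }
  have hΨ : ∀ {y x} (f : S.obj y ⟶ x), Ψ y x f = dag (Φ x y (dag f)) := fun _ => rfl
  let adj' : S ⊣ F := Adjunction.mkOfHomEquiv
    { homEquiv := Ψ
      homEquiv_naturality_left_symm := fun {y' y x} f g => by
        rw [Equiv.symm_apply_eq, hΨ, dag_comp, ← hS.map_dag]
        refine Eq.trans ?_ (congrArg dag (hSr (dag ((Ψ y x).symm g)) (dag f))).symm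
        rw [dag_comp, dag_dag, ← hΨ, Equiv.apply_symm_apply]
      homEquiv_naturality_right := fun {y x x'} f g => by
        rw [hΨ, dag_comp]
        refine (congrArg dag (hΦl (dag g) (dag f))).trans ?_
        rw [dag_comp, hF.map_dag, dag_dag, hΨ] }
  exact ⟨⟨S, hS, adj, adj', fun x y h f => by
    rw [hadj, ← hΦip, Equiv.apply_symm_apply]
    have : adj'.homEquiv y x f = Ψ y x f := by
      simp only [adj', Adjunction.mkOfHomEquiv_homEquiv]
    rw [this, hΨ, dag_dag]⟩⟩

end MarkedTwoRep

end

noncomputable section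

open TwoHilbert

/-! ### The 2-character as a functor -/

namespace TwoHilbert

variable {H : Type u} [Category.{v} H] [Abelian H] [Linear ℂ H] [TwoHilbert H]

theorem IsUnitary.cancel_right {X Y Z : H} {f : Y ⟶ Z} (hf : IsUnitary f) {a b : X ⟶ Y}
    (h : a ≫ f = b ≫ f) : a = b := (cancel_mono hf.iso.hom).1 h

theorem IsUnitary.cancel_left {X Y Z : H} {f : X ⟶ Y} (hf : IsUnitary f) {a b : Y ⟶ Z}
    (h : f ≫ a = f ≫ b) : a = b := (cancel_epi hf.iso.hom).1 h

/-- Precomposition with a unitary map is a unitary map of hom-spaces, so it may be applied to both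
families. -/
theorem IsFrame.unitary_comp {X X' Y : H} {ι : Type*} [Fintype ι] {p q : ι → (X ⟶ Y)}
    (h : IsFrame p q) {f : X' ⟶ X} (hf : IsUnitary f) :
    IsFrame (fun c => f ≫ p c) (fun c => f ≫ q c) := by
  intro w
  have h1 := congrArg (fun t => f ≫ t) (h (dag f ≫ w))
  rw [Preadditive.comp_sum, reassoc_of% hf.1] at h1
  refine Eq.trans ?_ h1
  refine Finset.sum_congr rfl fun c _ => ?_
  rw [ip_comp_right, Linear.comp_smul]

end TwoHilbert

/-! ### Stability of even-handed adjoints, and their effect on dual families. -/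

namespace EvenHandedAdj

variable {H H' H'' : Type u} [Category.{v} H] [Abelian H] [Linear ℂ H] [TwoHilbert H]
    [Category.{v} H'] [Abelian H'] [Linear ℂ H'] [TwoHilbert H']
    [Category.{v} H''] [Abelian H''] [Linear ℂ H''] [TwoHilbert H'']

variable (H) in
/-- The identity functor is an even-handed adjoint of itself. -/
def id : EvenHandedAdj (𝟭 H) where
  R := 𝟭 H
  linearStar := ⟨fun _ _ => rfl, fun _ _ => rfl, fun _ => rfl⟩
  right := Adjunction.id
  left := Adjunction.id
  evenHanded x y h f := by
    have h1 : Adjunction.id.homEquiv x y h = h := by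
      rw [Adjunction.homEquiv_unit]
      exact Category.id_comp h
    have h2 : Adjunction.id.homEquiv y x f = f := by
      rw [Adjunction.homEquiv_unit]
      exact Category.id_comp f
    exact congrArg₂ (fun a b => ip a (dag b)) h1 h2.symm

/-- Even-handed adjoints compose. -/
def comp {F : H ⥤ H'} {F' : H' ⥤ H''} (A : EvenHandedAdj F) (B : EvenHandedAdj F') :
    EvenHandedAdj (F ⋙ F') where
  R := B.R ⋙ A.R
  linearStar := ⟨fun f g => by simp [A.linearStar.map_add, B.linearStar.map_add],
    fun c f => by simp [A.linearStar.map_smul, B.linearStar.map_smul],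
    fun f => by simp [A.linearStar.map_dag, B.linearStar.map_dag]⟩
  right := A.right.comp B.right
  left := B.left.comp A.left
  evenHanded x y h f := by
    rw [Adjunction.comp_homEquiv, Adjunction.comp_homEquiv]
    -- The Hilbert space adjoint of a composite is the composite of the adjoints in reverse order,
    -- so the two conditions chain.
    exact (A.evenHanded x (B.R.obj y) (B.right.homEquiv _ _ h) f).trans
      (B.evenHanded (F.obj x) y h (A.left.homEquiv _ _ f))

section

variable {F : H ⥤ H'} (A : EvenHandedAdj F)

/-- The unit `y ⟶ F (R y)` of `R ⊣ F`. -/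
def eta (y : H') : y ⟶ F.obj (A.R.obj y) := A.left.unit.app y

/-- The counit `F (R y) ⟶ y` of `F ⊣ R`. -/
def eps (y : H') : F.obj (A.R.obj y) ⟶ y := A.right.counit.app y

/-- This is where even-handedness enters. The second family is `φ⁻¹(q c)`. The first is `(ψ((p
c)*))*`, which even-handedness equates with `φ†(p c)`. Since `(φ† p, w) = (p, φ w)`, expanding `φ w`
in the given frame and applying `φ⁻¹` proves the duality. No unitarity of `φ` is needed. -/
theorem isFrame (hF : IsLinearStar F) {x : H} {y : H'} {ι : Type*} [Fintype ι]
    {p q : ι → (x ⟶ A.R.obj y)} (h : IsFrame p q) :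
    IsFrame (fun c => dag (A.eta y ≫ F.map (dag (p c)))) (fun c => F.map (q c) ≫ A.eps y) := by
  intro w
  have h1 : F.map (A.right.homEquiv x y w) ≫ A.eps y = w := by
    refine Eq.trans ?_ ((A.right.homEquiv x y).symm_apply_apply w)
    rw [Adjunction.homEquiv_counit]
    rfl
  refine Eq.trans ?_ h1
  conv_rhs => rw [← h (A.right.homEquiv x y w)]
  rw [hF.map_sum, Preadditive.sum_comp]
  refine Finset.sum_congr rfl fun c _ => ?_
  rw [hF.map_smul, Linear.smul_comp]
  congr 1
  have h2 := A.evenHanded x y w (dag (p c))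
  rw [dag_dag, Adjunction.homEquiv_unit (adj := A.left)] at h2
  rw [← ip_conj, ← ip_conj (p c), h2]
  rfl

end

end EvenHandedAdj

variable {G : Type v} [Group G]

namespace TwoRep

variable {α : TwoRep.{v, u} G}

theorem isFrame_act {X Y : α.H} {ι : Type*} [Fintype ι] {p q : ι → (X ⟶ Y)}
    (h : IsFrame p q) (g : G) :
    IsFrame (fun c => (α.act g).map (p c)) (fun c => (α.act g).map (q c)) := by
  intro w
  obtain ⟨w, rfl⟩ := α.act_surj g _ _ w
  conv_rhs => rw [← h w]
  rw [(α.act_linearStar g).map_sum]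
  refine Finset.sum_congr rfl fun c _ => ?_
  rw [α.act_inner, (α.act_linearStar g).map_smul]

end TwoRep

/-! ### The basis formula for `χ(σ)` and its functoriality. -/

namespace TwoRepHom

section

variable {α β : TwoRep.{v, u} G} (σ : TwoRepHom α β)

/-- The composite `σ X ⟶ σ (α_x X) ⟶ β_x (σ X)` of `σ(θ)` and `σ(x)*`. -/
def through {x : G} (θ : α.NatSp x) (X : α.H) :
    σ.functor.obj X ⟶ (β.act x).obj (σ.functor.obj X) :=
  σ.functor.map (θ.at X) ≫ dag (σ.co x X)

theorem through_naturality {x : G} (θ : α.NatSp x) {X Y : α.H} (f : X ⟶ Y) :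
    σ.functor.map f ≫ σ.through θ Y = σ.through θ X ≫ (β.act x).map (σ.functor.map f) := by
  unfold through
  rw [← Functor.map_comp_assoc, θ.naturality, Functor.map_comp_assoc, Category.assoc,
    σ.dag_co_naturality]

theorem through_add {x : G} (θ θ' : α.NatSp x) (X : α.H) :
    σ.through (θ + θ') X = σ.through θ X + σ.through θ' X := by
  change σ.functor.map (θ.at X + θ'.at X) ≫ _ = _
  rw [σ.linearStar.map_add, Preadditive.add_comp]
  rfl

theorem through_smul {x : G} (c : ℂ) (θ : α.NatSp x) (X : α.H) :
    σ.through (c • θ) X = c • σ.through θ X := by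
  change σ.functor.map (c • θ.at X) ≫ _ = _
  rw [σ.linearStar.map_smul, Linear.smul_comp]
  rfl

/-- This is the coherence law `mu_co` with the maps `σ(g)` replaced by their inverses `σ(g)*`. -/
theorem dag_co_mu {g₂ g₁ g : G} (h : g₂ * g₁ = g) (X : α.H) :
    dag (σ.co g₂ ((α.act g₁).obj X)) ≫ (β.act g₂).map (dag (σ.co g₁ X)) ≫
      β.mu h (σ.functor.obj X) = σ.functor.map (α.mu h X) ≫ dag (σ.co g X) := by
  refine (σ.co_unitary g X).cancel_right ?_
  rw [Category.assoc, Category.assoc, Category.assoc, σ.mu_co, (σ.co_unitary g X).2,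
    ← Functor.map_comp_assoc, (σ.co_unitary g₁ X).2, CategoryTheory.Functor.map_id,
    Category.id_comp, reassoc_of% (σ.co_unitary g₂ _).2, Category.comp_id]

/-- The analogue of `conj_act` one level down: up to the coherence maps, `through` of the conjugated
transformation at `α_g X` is `β_g` of `through` at `X`. The equivariance of `χ(σ)` reduces to this
identity, one summand at a time. -/
theorem co_through_conj {x y c : G} (g : G) (h : g * x * g⁻¹ = y) (h1 : y * g = c)
    (h2 : g * x = c) (θ : α.NatSp x) (X : α.H) :
    σ.co g X ≫ σ.through (θ.conj g h) ((α.act g).obj X) ≫ (β.act y).map (dag (σ.co g X)) ≫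
      β.mu h1 (σ.functor.obj X) = (β.act g).map (σ.through θ X) ≫ β.mu h2 (σ.functor.obj X) := by
  unfold through
  rw [Category.assoc, σ.dag_co_mu h1, ← Functor.map_comp_assoc, θ.conj_act g h h1 h2,
    Functor.map_comp_assoc, ← reassoc_of% σ.co_naturality, ← σ.dag_co_mu h2,
    reassoc_of% (σ.co_unitary g _).1, Functor.map_comp, Category.assoc]

end

variable {α β : MarkedTwoRep.{v, u} G} (σ : TwoRepHom α.toTwoRep β.toTwoRep)

/-- The map `χ(σ)_x`, written with orthonormal bases of the spaces `Hom(σ (e i), y)`. -/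
def charNat (x : G) (θ : α.NatSp x) : β.NatSp x :=
  casSum (β.act_linearStar x) (fun i => (scale (α.e i) : ℂ)) (fun i => σ.through θ (α.e i))

theorem charNat_at (x : G) (θ : α.NatSp x) (y : β.H) : (σ.charNat x θ).at y =
    ∑ i, (scale (α.e i) : ℂ) • cas (β.act x) (σ.through θ (α.e i)) y := rfl

/-- Insert the resolution of the identity of `σ* y` between the unit and `through`. Naturality moves
one half of each projection to the counit end. By `EvenHandedAdj.isFrame` the two ends then form a
frame of `Hom(σ e_i, y)`, so the sum is the value of `cas`. The right-hand side does not mention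
`A`, whence the independence of the adjoint. -/
theorem charMap_eq (A : EvenHandedAdj σ.functor) (x : G) (θ : α.NatSp x) :
    σ.charMap A x θ = σ.charNat x θ := by
  refine TwoRep.NatSp.ext fun y => ?_
  rw [charNat_at]
  have h1 : (σ.charMap A x θ).at y = A.eta y ≫ σ.functor.map (𝟙 (A.R.obj y)) ≫
        σ.through θ _ ≫ (β.act x).map (A.eps y) := by
    rw [CategoryTheory.Functor.map_id, Category.id_comp]
    unfold through
    rw [Category.assoc]
    rfl
  rw [h1, ← MarkedTwoRep.resolution, σ.linearStar.map_sum, Preadditive.sum_comp,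
    Preadditive.comp_sum]
  refine Finset.sum_congr rfl fun i _ => ?_
  rw [σ.linearStar.map_smul, Linear.smul_comp, Linear.comp_smul]
  congr 1
  rw [σ.linearStar.map_sum, Preadditive.sum_comp, Preadditive.comp_sum,
    cas_eq (β.act_linearStar x) _ (A.isFrame σ.linearStar (onb_isFrame (α.e i) (A.R.obj y)))]
  refine Finset.sum_congr rfl fun c _ => ?_
  rw [dag_dag, Functor.map_comp_assoc, Functor.map_comp, ← reassoc_of% σ.through_naturality,
    Category.assoc]

theorem charNat_add (x : G) (θ θ' : α.NatSp x) :
    σ.charNat x (θ + θ') = σ.charNat x θ + σ.charNat x θ' := by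
  refine TwoRep.NatSp.ext fun y => ?_
  change _ = (σ.charNat x θ).at y + (σ.charNat x θ').at y
  simp only [charNat_at, cas, through_add, Preadditive.add_comp, Preadditive.comp_add,
    Finset.sum_add_distrib, smul_add]

theorem charNat_smul (x : G) (c : ℂ) (θ : α.NatSp x) :
    σ.charNat x (c • θ) = c • σ.charNat x θ := by
  refine TwoRep.NatSp.ext fun y => ?_
  change _ = c • (σ.charNat x θ).at y
  simp only [charNat_at, cas, through_smul, Linear.smul_comp, Linear.comp_smul, Finset.smul_sum]
  refine Finset.sum_congr rfl fun i _ => Finset.sum_congr rfl fun d _ => ?_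
  rw [smul_comm]

/-- It suffices to compare components on the image of `β_g`. There the sum over simple objects is
reindexed by `i ↦ g i`, which preserves scales, and each `cas` is computed in a frame transported by
`β_g`. -/
theorem charNat_conj {x y : G} (g : G) (h : g * x * g⁻¹ = y) (θ : α.NatSp x) :
    σ.charNat y (θ.conj g h) = (σ.charNat x θ).conj g h := by
  refine TwoRep.NatSp.ext_act g fun W => ?_
  have e1 : y * g = g * x := by rw [← h]; group
  refine (β.mu_unitary e1 W).cancel_right ?_
  rw [TwoRep.NatSp.conj_act g h e1 rfl, charNat_at, charNat_at, (β.act_linearStar g).map_sum,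
    Preadditive.sum_comp, Preadditive.sum_comp, ← Equiv.sum_comp (MulAction.toPerm g)]
  refine Finset.sum_congr rfl fun i _ => ?_
  rw [MulAction.toPerm_apply, (β.act_linearStar g).map_smul, Linear.smul_comp, Linear.smul_comp]
  obtain ⟨a⟩ := α.smul_iso g i
  obtain ⟨v, hv⟩ := exists_unitary a.symm
  rw [scale_eq_of_unitary hv, α.scale_act]
  congr 1
  -- The unitary map `σ e_{gi} ⟶ σ α_g e_i ⟶ β_g σ e_i` carries the image under `β_g` of an
  -- orthonormal basis of `Hom(σ e_i, W)` to a frame of `Hom(σ e_{gi}, β_g W)`.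
  have hU : IsUnitary (σ.functor.map v ≫ dag (σ.co g (α.e i))) :=
    (σ.linearStar.map_unitary hv).comp (σ.co_unitary _ _).dag
  rw [cas_eq (β.act_linearStar y) _
    ((TwoRep.isFrame_act (onb_isFrame (σ.functor.obj (α.e i)) W) g).unitary_comp hU)]
  unfold cas
  rw [(β.act_linearStar g).map_sum, Preadditive.sum_comp, Preadditive.sum_comp]
  refine Finset.sum_congr rfl fun c _ => ?_
  have h3 : σ.functor.map (dag v) ≫ σ.functor.map v = 𝟙 _ := by
    rw [← Functor.map_comp, hv.2, CategoryTheory.Functor.map_id]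
  simp only [dag_comp, Functor.map_comp, Category.assoc, dag_dag]
  rw [← reassoc_of% σ.through_naturality, ← σ.linearStar.map_dag v, reassoc_of% h3,
    β.mu_naturality, β.mu_naturality, reassoc_of% σ.co_through_conj g h e1 rfl,
    (β.act_linearStar g).map_dag]

theorem charNat_congr {σ ρ : TwoRepHom α.toTwoRep β.toTwoRep} (h : Isomorphic σ ρ) (x : G)
    (θ : α.NatSp x) : σ.charNat x θ = ρ.charNat x θ := by
  obtain ⟨N, N', h1, h2⟩ := h
  refine TwoRep.NatSp.ext fun y => ?_
  rw [charNat_at, charNat_at]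
  refine Finset.sum_congr rfl fun i _ => ?_
  congr 1
  have e1 : ∀ X, N.nat.app X ≫ N'.nat.app X = 𝟙 _ := fun X =>
    congrArg (fun t => NatTrans.app t X) h1
  have e2 : ∀ X, N'.nat.app X ≫ N.nat.app X = 𝟙 _ := fun X =>
    congrArg (fun t => NatTrans.app t X) h2
  -- An invertible 2-morphism need not be unitary, so it does not carry orthonormal bases to
  -- orthonormal bases. It does give dual families: one is transported by `N`, the other by the
  -- adjoint of its inverse `N'`.
  have hfr : IsFrame (fun c : OnbIx (ρ.functor.obj (α.e i)) y =>
      dag (N'.nat.app (α.e i)) ≫ onb _ y c) (fun c => N.nat.app (α.e i) ≫ onb _ y c) := by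
    intro w
    have h3 := congrArg (fun t => N.nat.app (α.e i) ≫ t) (sum_onb (N'.nat.app (α.e i) ≫ w))
    rw [reassoc_of% e1, Preadditive.comp_sum] at h3
    refine Eq.trans ?_ h3
    refine Finset.sum_congr rfl fun c _ => ?_
    rw [TwoHilbert.ip_comp_right, dag_dag, Linear.comp_smul]
  rw [cas_eq (β.act_linearStar x) _ hfr]
  refine Finset.sum_congr rfl fun c _ => ?_
  have h3 : dag (σ.co x (α.e i)) ≫ (β.act x).map (N.nat.app (α.e i)) =
      N.nat.app ((α.act x).obj (α.e i)) ≫ dag (ρ.co x (α.e i)) := by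
    refine (σ.co_unitary x _).cancel_left ((ρ.co_unitary x _).cancel_right ?_)
    rw [reassoc_of% (σ.co_unitary x _).1, Category.assoc, Category.assoc, (ρ.co_unitary x _).2,
      Category.comp_id]
    exact (N.comm x (α.e i)).symm
  have h4 : σ.functor.map (θ.at (α.e i)) ≫ N.nat.app ((α.act x).obj (α.e i)) =
      N.nat.app (α.e i) ≫ ρ.functor.map (θ.at (α.e i)) := N.nat.naturality _
  unfold through
  rw [dag_comp, dag_dag, Functor.map_comp, Category.assoc, Category.assoc, Category.assoc,
    reassoc_of% h3, reassoc_of% h4, reassoc_of% e2]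

theorem charNat_id (x : G) (θ : α.NatSp x) : (TwoRepHom.id α.toTwoRep).charNat x θ = θ := by
  rw [← charMap_eq _ (EvenHandedAdj.id α.H)]
  refine TwoRep.NatSp.ext fun y => ?_
  change 𝟙 _ ≫ θ.at y ≫ dag (𝟙 _) ≫ (α.act x).map (𝟙 _) = θ.at y
  simp [dag_id]

/-- The string diagram is better suited to composition than the basis formula: with the composite
even-handed adjoint, the two diagrams differ only by sliding `τ(x)*` past the image of the counit of
`σ`. The existence of adjoints is used to pass to diagrams. -/
theorem charNat_comp {γ : MarkedTwoRep.{v, u} G} (τ : TwoRepHom β.toTwoRep γ.toTwoRep) (x : G)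
    (θ : α.NatSp x) : (σ.comp τ).charNat x θ = τ.charNat x (σ.charNat x θ) := by
  obtain ⟨A⟩ := MarkedTwoRep.exists_evenHandedAdj σ.linearStar
  obtain ⟨B⟩ := MarkedTwoRep.exists_evenHandedAdj τ.linearStar
  rw [← charMap_eq (σ.comp τ) (A.comp B), ← charMap_eq σ A, ← charMap_eq τ B]
  refine TwoRep.NatSp.ext fun z => ?_
  have e1 : (B.left.comp A.left).unit.app z =
    B.left.unit.app z ≫ τ.functor.map (A.left.unit.app (B.R.obj z)) := by simp
  have e2 : (A.right.comp B.right).counit.app z =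
    τ.functor.map (A.right.counit.app (B.R.obj z)) ≫ B.right.counit.app z := by simp
  change (B.left.comp A.left).unit.app z ≫
    τ.functor.map (σ.functor.map (θ.at (A.R.obj (B.R.obj z)))) ≫
      dag (τ.co x _ ≫ τ.functor.map (σ.co x _)) ≫
        (γ.act x).map ((A.right.comp B.right).counit.app z) =
    B.left.unit.app z ≫ τ.functor.map (A.left.unit.app _ ≫ σ.functor.map (θ.at _) ≫
      dag (σ.co x _) ≫ (β.act x).map (A.right.counit.app _)) ≫ dag (τ.co x _) ≫
        (γ.act x).map (B.right.counit.app z)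
  rw [e1, e2]
  simp only [Functor.map_comp, Category.assoc, dag_comp]
  rw [reassoc_of% τ.dag_co_naturality, τ.linearStar.map_dag]

/-- The morphism `χ(σ)` of unitary bundles over `ΛG`. -/
def charHom : α.twoChar ⟶ β.twoChar :=
  (⟨fun x => { toFun := σ.charNat x.pt
               map_add' := σ.charNat_add x.pt
               map_smul' := σ.charNat_smul x.pt },
    fun f θ => σ.charNat_conj f.g f.conj θ⟩ : UnitaryBundle.Hom α.twoChar β.twoChar)

end TwoRepHom

/-- The 2-character as a functor on the homotopy category of marked 2-representations. -/
def twoCharFunctor (G : Type v) [Group G] :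
    FunctorOn (C := HoTwoRep.{v, u} G) (D := HilbG.{v, max u v} G) fun α => α.rep.twoChar where
  map {α β} := Quotient.lift (fun σ : TwoRepHom α.rep.toTwoRep β.rep.toTwoRep => σ.charHom)
    fun _ _ h => UnitaryBundle.Hom.ext (funext fun x => LinearMap.ext fun θ =>
      TwoRepHom.charNat_congr h x.pt θ)
  map_id _ := UnitaryBundle.Hom.ext (funext fun x => LinearMap.ext fun θ =>
      TwoRepHom.charNat_id x.pt θ)
  map_comp f g := by
    induction f using Quotient.ind with | _ σ =>
    induction g using Quotient.ind with | _ τ =>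
    exact UnitaryBundle.Hom.ext (funext fun x => LinearMap.ext fun θ =>
      TwoRepHom.charNat_comp σ τ x.pt θ)

end

noncomputable section

/-! ### The geometric character as a functor -/

variable {G : Type v} [Group G]

namespace GerbeHom

open Gerbe

variable {𝔛 𝔜 𝔷 : Gerbe.{v, w} G}

/-- The trace of `E(u' ⊗ u)` for arrows `u`, `u'` over loops. -/
def loopTrace (E : GerbeHom 𝔛 𝔜) {g : G} {μ : 𝔜.X} {i : 𝔛.X} (u' : 𝔜.Tor g μ μ)
    (u : 𝔛.Tor g i i) : ℂ :=
  LinearMap.trace ℂ (E.fib (pt μ i)) (E.map (arr u'.1 u.1 (u'.2.trans u.2.symm))).toLinearMap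

theorem loopTrace_circ_left (E : GerbeHom 𝔛 𝔜) {g : G} {μ : 𝔜.X} {i : 𝔛.X} {p q : 𝔜.Tor g μ μ}
    (u : 𝔛.Tor g i i) (z : Circle) (h : q.1 = 𝔜.circ μ z ≫ p.1) :
    E.loopTrace q u = (z : ℂ) * E.loopTrace p u := by
  obtain ⟨q, hq⟩ := q
  change q = _ at h
  subst h
  unfold loopTrace
  rw [← smul_eq_mul, ← map_smul]
  congr 1
  exact LinearMap.ext fun ψ => E.map_circ_left p.1 u.1 _ z _ ψ

theorem loopTrace_circ_right (E : GerbeHom 𝔛 𝔜) {g : G} {μ : 𝔜.X} {i : 𝔛.X} (u' : 𝔜.Tor g μ μ)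
    {p q : 𝔛.Tor g i i} (z : Circle) (h : q.1 = 𝔛.circ i z ≫ p.1) :
    E.loopTrace u' q = (starRingEnd ℂ) (z : ℂ) * E.loopTrace u' p := by
  obtain ⟨q, hq⟩ := q
  change q = _ at h
  subst h
  unfold loopTrace
  rw [← smul_eq_mul, ← map_smul, ← Circle.coe_inv_eq_conj]
  congr 1
  exact LinearMap.ext fun ψ => E.map_circ_right u'.1 p.1 _ z _ ψ

/-- A trace is a class function: `E` turns conjugation by `v' ⊗ v` into conjugation of linear maps,
and the trace is cyclic. -/
theorem loopTrace_conj (E : GerbeHom 𝔛 𝔜) {g g' : G} {μ ν : 𝔜.X} {i j : 𝔛.X} (v' : μ ⟶ ν)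
    (v : i ⟶ j) (hv : 𝔜.deg v' = 𝔛.deg v) {p' : 𝔜.Tor g μ μ} {p : 𝔛.Tor g i i}
    {q' : 𝔜.Tor g' ν ν} {q : 𝔛.Tor g' j j} (h' : p'.1 = v' ≫ q'.1 ≫ Groupoid.inv v')
    (h : p.1 = v ≫ q.1 ≫ Groupoid.inv v) : E.loopTrace p' p = E.loopTrace q' q := by
  obtain ⟨p', hp'⟩ := p'
  obtain ⟨p, hp⟩ := p
  change p' = _ at h'
  change p = _ at h
  subst h' h
  have hi : 𝔜.deg (Groupoid.inv v') = 𝔛.deg (Groupoid.inv v) := by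
    rw [𝔜.deg_inv, 𝔛.deg_inv, hv]
  have hq : 𝔜.deg q'.1 = 𝔛.deg q.1 := q'.2.trans q.2.symm
  have e1 : (E.map (arr (v' ≫ q'.1 ≫ Groupoid.inv v') (v ≫ q.1 ≫ Groupoid.inv v)
      (hp'.trans hp.symm))).toLinearMap = (E.map (arr _ _ hi)).toLinearMap ∘ₗ
        ((E.map (arr _ _ hq)).toLinearMap ∘ₗ (E.map (arr _ _ hv)).toLinearMap) := by
    refine LinearMap.ext fun ψ => ?_
    exact (E.map_comp (arr _ _ hv) (arr _ _ hq ≫ arr _ _ hi) ψ).trans (E.map_comp _ _ _)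
  have e2 : (E.map (arr _ _ hv)).toLinearMap ∘ₗ (E.map (arr _ _ hi)).toLinearMap =
      LinearMap.id := by
    refine LinearMap.ext fun ψ => ?_
    change E.map (arr _ _ hv) (E.map (arr _ _ hi) ψ) = ψ
    have h0 : arr _ _ hi ≫ arr _ _ hv = 𝟙 (pt ν j : (𝔜.tensor 𝔛.conj).X) := by
      rw [arr_comp, ← arr_id]
      congr 1
      · exact Groupoid.inv_comp _
      · exact Groupoid.inv_comp _
    rw [← E.map_comp, h0, E.map_id]
  unfold loopTrace
  rw [e1, LinearMap.trace_comp_comm', LinearMap.comp_assoc, e2, LinearMap.comp_id]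

theorem loopTrace_congr {E F : GerbeHom 𝔛 𝔜} (h : Isomorphic E F) {g : G} {μ : 𝔜.X} {i : 𝔛.X}
    (u' : 𝔜.Tor g μ μ) (u : 𝔛.Tor g i i) : E.loopTrace u' u = F.loopTrace u' u := by
  obtain ⟨e, he⟩ := h.exists_equiv
  unfold loopTrace
  rw [← LinearMap.trace_conj' _ (e (pt μ i))]
  congr 1
  refine LinearMap.ext fun ψ => ?_
  rw [LinearEquiv.conj_apply_apply]
  refine (he _ _ _ _).trans ?_
  rw [LinearEquiv.apply_symm_apply]
  rfl

/-- Conjugation by `u` fixes the identity arrow, so `u ⊗ u` acts trivially on a one-dimensional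
fibre. -/
theorem loopTrace_id {g : G} {i : 𝔛.X} (u : 𝔛.Tor g i i) : (id 𝔛).loopTrace u u = 1 := by
  have h : ((id 𝔛).map (arr u.1 u.1 (u.2.trans u.2.symm))).toLinearMap = LinearMap.id :=
    LinearMap.ext fun F => (idEv (𝔛 := 𝔛) i).injective (idEv_map u.1 F)
  unfold loopTrace
  rw [h, LinearMap.trace_id, LinearEquiv.finrank_eq (idEv (𝔛 := 𝔛) i), Module.finrank_self,
    Nat.cast_one]

theorem loopTrace_id_ne {g : G} {i j : 𝔛.X} (h : i ≠ j) (u' : 𝔛.Tor g j j) (u : 𝔛.Tor g i i) :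
    (id 𝔛).loopTrace u' u = 0 := by
  have := id_subsingleton h
  unfold loopTrace
  rw [Subsingleton.elim ((id 𝔛).map (arr u'.1 u.1 (u'.2.trans u.2.symm))).toLinearMap 0, map_zero]

open Classical in
-- Decompose the identity as the sum of `single i ∘ proj i` and use the cyclicity of the trace.
theorem _root_.LinearMap.trace_eq_sum_proj {ι : Type u} [Fintype ι] {V : ι → Type w}
    [∀ i, AddCommGroup (V i)] [∀ i, Module ℂ (V i)] [∀ i, FiniteDimensional ℂ (V i)]
    (T : (∀ i, V i) →ₗ[ℂ] ∀ i, V i) : LinearMap.trace ℂ _ T =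
      ∑ i, LinearMap.trace ℂ (V i) (LinearMap.proj i ∘ₗ T ∘ₗ LinearMap.single ℂ V i) := by
  have h : T = ∑ i, LinearMap.single ℂ V i ∘ₗ (LinearMap.proj i ∘ₗ T) := by
    refine LinearMap.ext fun x => funext fun j => ?_
    simp [LinearMap.sum_apply, Finset.sum_apply]
  conv_lhs => rw [h]
  rw [map_sum]
  refine Finset.sum_congr rfl fun i _ => ?_
  rw [LinearMap.trace_comp_comm', LinearMap.comp_assoc]

open Classical in
-- An arrow over `g` maps the summand `μ` to the summand `g μ`, so only fixed `μ` give diagonal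
-- blocks; these blocks are tensor products, on which the trace is multiplicative. The weights `k μ`
-- rescale inner products and do not affect traces.
theorem loopTrace_comp (E : GerbeHom 𝔛 𝔜) (E' : GerbeHom 𝔜 𝔷) {g : G} {κ : 𝔷.X} {i : 𝔛.X}
    (v : 𝔷.Tor g κ κ) (u : 𝔛.Tor g i i) (p : ∀ μ : Push.Fix 𝔜.X g, 𝔜.Tor g μ.1 μ.1) :
    (E.comp E').loopTrace v u = ∑ μ : Push.Fix 𝔜.X g, E'.loopTrace v (p μ) *
      E.loopTrace (p μ) u := by
  let V : 𝔜.X → Type w := fun μ => E'.fib (pt κ μ) ⊗[ℂ] E.fib (pt μ i)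
  let T : (∀ μ, V μ) →ₗ[ℂ] ∀ μ, V μ :=
    ((E.comp E').map (arr v.1 u.1 (v.2.trans u.2.symm))).toLinearMap
  have hT : ∀ {μ ν : 𝔜.X} (p : 𝔜.Tor g μ ν) (x : ∀ μ, V μ), T x ν =
      twist E E' v.1 p.1 u.1 (v.2.trans p.2.symm) (p.2.trans u.2.symm) (x μ) := fun p x =>
    compFun_apply (E := E) (E' := E') v.1 p.1 u.1 (v.2.trans p.2.symm) (p.2.trans u.2.symm) x
  refine (LinearMap.trace_eq_sum_proj T).trans ?_
  symm
  refine Fintype.sum_of_injective (fun μ : Push.Fix 𝔜.X g => μ.1) Subtype.val_injective _ _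
    (fun μ hμ => ?_) fun μ => ?_
  -- The component at `μ` of the image depends only on the component at `g⁻¹ μ`, which vanishes for
  -- a vector supported at a different `μ`.
  · have hne : g⁻¹ • μ ≠ μ := fun h => hμ ⟨⟨μ, by
      rw [inv_smul_eq_iff] at h; exact h.symm⟩, rfl⟩
    obtain ⟨q, hq⟩ := exists_to g μ
    have h0 : LinearMap.proj μ ∘ₗ T ∘ₗ LinearMap.single ℂ V μ = 0 := by
      refine LinearMap.ext fun t => ?_
      change T (Pi.single μ t) μ = 0
      rw [hT ⟨q, hq⟩, Pi.single_eq_of_ne hne, map_zero]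
    rw [h0, map_zero]
  · have h0 : LinearMap.proj μ.1 ∘ₗ T ∘ₗ LinearMap.single ℂ V μ.1 =
        TensorProduct.map (E'.map (arr v.1 (p μ).1 (v.2.trans (p μ).2.symm))).toLinearMap
          (E.map (arr (p μ).1 u.1 ((p μ).2.trans u.2.symm))).toLinearMap := by
      refine LinearMap.ext fun t => ?_
      change T (Pi.single μ.1 t) μ.1 = _
      rw [hT (p μ), Pi.single_eq_same]
      rfl
    rw [h0]
    exact (LinearMap.trace_tensorProduct' _ _).symm

/-! ### The operators `ch(E)` on sections of the transgressed line bundle. -/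

/-- A choice of an arrow over a loop. -/
def pick {g : G} (i : Push.Fix 𝔛.X g) : 𝔛.Tor g i.1 i.1 := (𝔛.tor_nonempty i.loop).some

/-- The value at `i` of a section of the transgressed line bundle. -/
def secVal {g : G} (ψ : Push.Sec 𝔛.transgression g) (i : Push.Fix 𝔛.X g) : 𝔛.Line g i.1 i.1 := ψ i

theorem sec_ext {g : G} {ψ ψ' : Push.Sec 𝔛.transgression g}
    (h : ∀ i u, (secVal ψ i).1 u = (secVal ψ' i).1 u) : ψ = ψ' :=
  funext fun i => Line.ext (h i)

theorem secVal_map {x y : LoopGroup G} (f : x ⟶ y) (ψ : Push.Sec 𝔛.transgression x.pt)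
    (j : Push.Fix 𝔛.X y.pt) (q : 𝔛.Tor y.pt j.1 j.1) :
    (secVal (𝔛.geomChar.map f ψ) j).1 q =
      (secVal ψ ((Push.fixEquiv f).symm j)).1 (𝔛.conjTor (Push.lift f j) q) := rfl

/-- Multiplying the arrow by `z` multiplies the value of the section by `z̄` and the conjugate of
the trace by `z`. -/
theorem secVal_trace_indep (E : GerbeHom 𝔛 𝔜) {g : G} (ψ : Push.Sec 𝔛.transgression g) {μ : 𝔜.X}
    (u' : 𝔜.Tor g μ μ) (i : Push.Fix 𝔛.X g) (p q : 𝔛.Tor g i.1 i.1) :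
    (secVal ψ i).1 p * (starRingEnd ℂ) (E.loopTrace u' p) =
      (secVal ψ i).1 q * (starRingEnd ℂ) (E.loopTrace u' q) := by
  obtain ⟨z, hz⟩ := 𝔛.exists_circ p.1 q.1 (p.2.trans q.2.symm)
  rw [E.loopTrace_circ_right u' z hz, (secVal ψ i).2 z q p hz, map_mul, Complex.conj_conj]
  linear_combination ((secVal ψ i).1 q * (starRingEnd ℂ) (E.loopTrace u' q)) * conj_mul_self z

/-- The map `ch(E)_x` on sections. -/
def chMap (E : GerbeHom 𝔛 𝔜) (g : G) :
    Push.Sec 𝔛.transgression g →ₗ[ℂ] Push.Sec 𝔜.transgression g where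
  -- The matrix elements refer to localized sections with values `1 / √k`. A value `c` at `i` is `c
  -- √(k i)` times such a section, and the target section takes the value `1 / √(k μ)` at `μ`; this
  -- explains the ratio.
  toFun ψ μ := (⟨fun u' => ∑ i : Push.Fix 𝔛.X g, ((√(𝔛.k i.1) / √(𝔜.k μ.1) : ℝ) : ℂ) *
      ((secVal ψ i).1 (pick i) * (starRingEnd ℂ) (E.loopTrace u' (pick i))), fun z p q h => by
        rw [Finset.mul_sum]
        refine Finset.sum_congr rfl fun i _ => ?_
        rw [E.loopTrace_circ_left (p := p) (q := q) (pick i) z h, map_mul]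
        ring⟩ : 𝔜.Line g μ.1 μ.1)
  map_add' ψ ψ' := sec_ext fun μ u' => by
    change ∑ i : Push.Fix 𝔛.X g, ((√(𝔛.k i.1) / √(𝔜.k μ.1) : ℝ) : ℂ) *
      (((secVal ψ i).1 (pick i) + (secVal ψ' i).1 (pick i)) * _) =
        ∑ i : Push.Fix 𝔛.X g, _ + ∑ i : Push.Fix 𝔛.X g, _
    rw [← Finset.sum_add_distrib]
    refine Finset.sum_congr rfl fun i _ => ?_
    ring
  map_smul' c ψ := sec_ext fun μ u' => by
    change ∑ i : Push.Fix 𝔛.X g, ((√(𝔛.k i.1) / √(𝔜.k μ.1) : ℝ) : ℂ) *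
      ((c * (secVal ψ i).1 (pick i)) * _) = c * ∑ i : Push.Fix 𝔛.X g, _
    rw [Finset.mul_sum]
    refine Finset.sum_congr rfl fun i _ => ?_
    ring

theorem chMap_apply (E : GerbeHom 𝔛 𝔜) {g : G} (ψ : Push.Sec 𝔛.transgression g)
    (μ : Push.Fix 𝔜.X g) (u' : 𝔜.Tor g μ.1 μ.1) (u : ∀ i : Push.Fix 𝔛.X g, 𝔛.Tor g i.1 i.1) :
    (secVal (E.chMap g ψ) μ).1 u' = ∑ i : Push.Fix 𝔛.X g, ((√(𝔛.k i.1) / √(𝔜.k μ.1) : ℝ) : ℂ) *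
      ((secVal ψ i).1 (u i) * (starRingEnd ℂ) (E.loopTrace u' (u i))) := by
  refine Finset.sum_congr rfl fun i _ => ?_
  rw [E.secVal_trace_indep ψ u' i (u i) (pick i)]

/-- Fixed points of `x` and of its conjugate correspond under `f`, the metrics are invariant, and
the traces agree by `loopTrace_conj` applied to lifts of `f` to both gerbes. -/
theorem chMap_naturality (E : GerbeHom 𝔛 𝔜) {x y : LoopGroup G} (f : x ⟶ y)
    (ψ : Push.Sec 𝔛.transgression x.pt) :
    E.chMap y.pt (𝔛.geomChar.map f ψ) = 𝔜.geomChar.map f (E.chMap x.pt ψ) := by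
  refine sec_ext fun ν q' => ?_
  refine (E.chMap_apply (𝔛.geomChar.map f ψ) ν q' pick).trans ?_
  rw [secVal_map]
  refine Eq.trans ?_ (E.chMap_apply ψ _ _ pick).symm
  rw [← (Push.fixEquiv f).symm.sum_comp]
  refine Finset.sum_congr rfl fun j _ => ?_
  have hk : 𝔛.k ((Push.fixEquiv f).symm j).1 = 𝔛.k j.1 := 𝔛.k_smul f.g⁻¹ j.1
  have hk' : 𝔜.k ((Push.fixEquiv f).symm ν).1 = 𝔜.k ν.1 := 𝔜.k_smul f.g⁻¹ ν.1
  rw [hk, hk', secVal_map]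
  congr 1
  refine Eq.trans ?_ (E.secVal_trace_indep ψ (𝔜.conjTor (Push.lift f ν) q') _
    (𝔛.conjTor (Push.lift f j) (pick j)) (pick _))
  exact congrArg (fun t => (secVal ψ ((Push.fixEquiv f).symm j)).1
    (𝔛.conjTor (Push.lift f j) (pick j)) * (starRingEnd ℂ) t)
    (E.loopTrace_conj (𝔜.liftArrow (Push.lift f ν)) (𝔛.liftArrow (Push.lift f j))
      ((𝔜.deg_liftArrow (Push.lift f ν)).trans (𝔛.deg_liftArrow (Push.lift f j)).symm)
      rfl rfl).symm

theorem chMap_congr {E F : GerbeHom 𝔛 𝔜} (h : Isomorphic E F) (g : G) : E.chMap g = F.chMap g := by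
  refine LinearMap.ext fun ψ => sec_ext fun μ u' => ?_
  rw [E.chMap_apply _ _ _ pick, F.chMap_apply _ _ _ pick]
  simp only [loopTrace_congr h]

theorem sqrt_k_ne_zero (i : 𝔛.X) : √(𝔛.k i) ≠ 0 := (Real.sqrt_pos.2 (𝔛.k_pos i)).ne'

theorem chMap_id (g : G) (ψ : Push.Sec 𝔛.transgression g) : (id 𝔛).chMap g ψ = ψ := by
  classical
  refine sec_ext fun j v => ?_
  -- The arrow used at `j` is taken to be `v` itself, so that the diagonal trace is that of `v ⊗ v`,
  -- which is one.
  rw [chMap_apply _ _ _ _ (Function.update pick j v), Finset.sum_eq_single j]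
  · rw [Function.update_self, loopTrace_id, div_self (sqrt_k_ne_zero j.1)]
    simp
  · intro i _ hij
    rw [loopTrace_id_ne (fun h => hij (Subtype.ext h))]
    simp
  · exact fun h => absurd (Finset.mem_univ _) h

theorem chMap_comp (E : GerbeHom 𝔛 𝔜) (E' : GerbeHom 𝔜 𝔷) (g : G)
    (ψ : Push.Sec 𝔛.transgression g) :
    (E.comp E').chMap g ψ = E'.chMap g (E.chMap g ψ) := by
  refine sec_ext fun κ v => ?_
  rw [chMap_apply _ _ _ _ pick, chMap_apply _ _ _ _ pick]
  simp only [chMap_apply _ _ _ _ pick, loopTrace_comp E E' _ _ pick, Finset.mul_sum,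
    Finset.sum_mul, map_sum]
  rw [Finset.sum_comm]
  refine Finset.sum_congr rfl fun μ _ => Finset.sum_congr rfl fun i _ => ?_
  -- The normalizing ratios telescope: the intermediate `√(k μ)` cancels.
  have h1 : ((√(𝔛.k i.1) / √(𝔷.k κ.1) : ℝ) : ℂ) = ((√(𝔜.k μ.1) / √(𝔷.k κ.1) : ℝ) : ℂ) *
      ((√(𝔛.k i.1) / √(𝔜.k μ.1) : ℝ) : ℂ) := by
    rw [← Complex.ofReal_mul]
    congr 1
    have := sqrt_k_ne_zero μ.1
    have := sqrt_k_ne_zero κ.1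
    field_simp
  rw [h1, map_mul]
  ring

/-- The morphism `ch(E)` of unitary bundles over `ΛG`. -/
def chHom (E : GerbeHom 𝔛 𝔜) : 𝔛.geomChar ⟶ 𝔜.geomChar :=
  (⟨fun x => E.chMap x.pt, fun f ψ => E.chMap_naturality f ψ⟩ :
    UnitaryBundle.Hom 𝔛.geomChar 𝔜.geomChar)

theorem inner_geomChar {x : LoopGroup G} (ψ ψ' : 𝔛.geomChar.fib x)
    (u : ∀ i : Push.Fix 𝔛.X x.pt, 𝔛.Tor x.pt i.1 i.1) :
    inner ℂ ψ ψ' = ∑ i : Push.Fix 𝔛.X x.pt, (𝔛.k i.1 : ℂ) *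
      ((starRingEnd ℂ) ((secVal ψ i).1 (u i)) * (secVal ψ' i).1 (u i)) :=
  Finset.sum_congr rfl fun i _ => congrArg (fun t => (𝔛.k i.1 : ℂ) * t)
    (Line.ip_eq (secVal ψ i) (secVal ψ' i) (u i))

theorem secVal_locSec_self {x : LoopGroup G} (i : Push.Fix 𝔛.X x.pt) (u : 𝔛.Tor x.pt i.1 i.1) :
    (secVal (locSec i u) i).1 u = 1 / (√(𝔛.k i.1) : ℂ) := by
  classical
  have h : secVal (locSec i u) i = Line.tmul u (1 / (√(𝔛.k i.1) : ℂ)) := by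
    unfold secVal locSec
    exact Pi.single_eq_same i _
  rw [h, Line.tmul_apply]

theorem secVal_locSec_ne {x : LoopGroup G} {i j : Push.Fix 𝔛.X x.pt} (u : 𝔛.Tor x.pt i.1 i.1)
    (h : j ≠ i) (q : 𝔛.Tor x.pt j.1 j.1) : (secVal (locSec i u) j).1 q = 0 := by
  classical
  have h : secVal (locSec i u) j = 0 := by
    unfold secVal locSec
    exact Pi.single_eq_of_ne h _
  rw [h]
  rfl

theorem inner_chMap (E : GerbeHom 𝔛 𝔜) {x : LoopGroup G} (i : Push.Fix 𝔛.X x.pt)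
    (μ : Push.Fix 𝔜.X x.pt) (u : 𝔛.Tor x.pt i.1 i.1) (u' : 𝔜.Tor x.pt μ.1 μ.1) :
    inner ℂ (locSec μ u') (E.chHom.app x (locSec i u)) =
      (starRingEnd ℂ) (E.loopTrace u' u) := by
  classical
  have h1 : (secVal (E.chMap x.pt (locSec i u)) μ).1 u' = ((√(𝔛.k i.1) / √(𝔜.k μ.1) : ℝ) : ℂ) *
      ((1 / (√(𝔛.k i.1) : ℂ)) * (starRingEnd ℂ) (E.loopTrace u' u)) := by
    -- The freedom in the choice of arrows puts the given `u` at `i`, where alone the localized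
    -- section is nonzero.
    refine (E.chMap_apply (locSec i u) μ u' (Function.update pick i u)).trans ?_
    rw [Finset.sum_eq_single i]
    · rw [Function.update_self, secVal_locSec_self]
    · intro j _ hj
      rw [secVal_locSec_ne u hj]
      simp
    · exact fun h => absurd (Finset.mem_univ _) h
  refine (inner_geomChar (𝔛 := 𝔜) _ _ (Function.update pick μ u')).trans ?_
  rw [Finset.sum_eq_single μ]
  · rw [Function.update_self, secVal_locSec_self]
    refine (congrArg (fun t => (𝔜.k μ.1 : ℂ) *
      ((starRingEnd ℂ) (1 / (√(𝔜.k μ.1) : ℂ)) * t)) h1).trans ?_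
    have hi : (√(𝔛.k i.1) : ℂ) ≠ 0 := Complex.ofReal_ne_zero.2 (sqrt_k_ne_zero i.1)
    have hμ : (√(𝔜.k μ.1) : ℂ) ≠ 0 := Complex.ofReal_ne_zero.2 (sqrt_k_ne_zero μ.1)
    have hk : (𝔜.k μ.1 : ℂ) = (√(𝔜.k μ.1) : ℂ) * (√(𝔜.k μ.1) : ℂ) := by
      rw [← Complex.ofReal_mul, Real.mul_self_sqrt (𝔜.k_pos _).le]
    rw [hk, map_div₀, map_one, Complex.conj_ofReal, Complex.ofReal_div]
    field_simp
  · intro ν _ hν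
    rw [secVal_locSec_ne u' hν]
    simp
  · exact fun h => absurd (Finset.mem_univ _) h

end GerbeHom

/-- The geometric character as a functor on the homotopy category of gerbes. -/
def geomCharFunctor (G : Type v) [Group G] :
    FunctorOn (C := HoGerbes.{v, w} G) (D := HilbG.{v, w} G) fun 𝔛 => 𝔛.gerbe.geomChar where
  map {𝔛 𝔜} := Quotient.lift (fun E : GerbeHom 𝔛.gerbe 𝔜.gerbe => E.chHom)
    fun _ _ h => UnitaryBundle.Hom.ext (funext fun x => GerbeHom.chMap_congr h x.pt)
  map_id _ := UnitaryBundle.Hom.ext (funext fun x => LinearMap.ext fun ψ =>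
      GerbeHom.chMap_id x.pt ψ)
  map_comp f g := by
    induction f using Quotient.ind with | _ E =>
    induction g using Quotient.ind with | _ E' =>
    exact UnitaryBundle.Hom.ext (funext fun x => LinearMap.ext fun ψ =>
      GerbeHom.chMap_comp E E' x.pt ψ)

end

noncomputable section

open TwoHilbert

/-! ### The associated gerbe as a functor -/

variable {G : Type v} [Group G]

namespace MarkedTwoRep

variable {α : MarkedTwoRep.{v, u} G}

theorem Arrow.arr_eq {i j : α.I} {f f' : α.Arrow i j} (h : f = f') (e : f.g = f'.g) :
    f.arr ≫ α.ca e _ = f'.arr := by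
  subst h
  exact Category.comp_id _

/-- The morphism `e j ⟶ e i` underlying an arrow of degree one. -/
def Arrow.base {i j : α.I} (b : α.Arrow i j) (h : b.g = 1) : α.e j ⟶ α.e i :=
  b.arr ≫ α.ca h (α.e i) ≫ dag (α.un (α.e i))

theorem Arrow.base_id (i : α.I) : (Arrow.id i).base rfl = 𝟙 (α.e i) := by
  change α.un (α.e i) ≫ 𝟙 _ ≫ dag (α.un (α.e i)) = _
  rw [Category.id_comp, (α.un_unitary _).1]

theorem Arrow.base_smul {i j : α.I} (z : Circle) (b : α.Arrow i j) (h : b.g = 1) :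
    (b.smul z).base h = (z : ℂ) • b.base h :=
  Linear.smul_comp _ _ _ (z : ℂ) b.arr _

theorem circ_comp_eq {i j : α.I} (z : Circle) (b : α.Arrow i j) :
    (α.gerbe.circ i z ≫ b : α.Arrow i j) = b.smul z := by
  change ((Arrow.id i).smul z).comp b = _
  rw [Arrow.smul_comp, Arrow.id_comp]

theorem dag_un_act (g : G) (X : α.H) : dag (α.un ((α.act g).obj X)) = α.mu (one_mul g) X := by
  rw [← α.dag_mu_one, dag_dag]

theorem act_dag_un (g : G) (X : α.H) : (α.act g).map (dag (α.un X)) = α.mu (mul_one g) X := by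
  rw [(α.act_linearStar g).map_dag, ← TwoRep.dag_mu_right, dag_dag]

theorem dag_un_naturality {X Y : α.H} (f : X ⟶ Y) :
    (α.act 1).map f ≫ dag (α.un Y) = dag (α.un X) ≫ f := by
  refine (α.un_unitary X).cancel_left ((α.un_unitary Y).cancel_right ?_)
  simp only [Category.assoc]
  rw [(α.un_unitary Y).2, Category.comp_id, reassoc_of% (α.un_unitary X).1, α.un_naturality]

end MarkedTwoRep

namespace TwoRepHom

open GerbeHom

section congr

variable {α β : MarkedTwoRep.{v, u} G}

theorem bundle_map (σ : TwoRepHom α.toTwoRep β.toTwoRep) {μ ν : β.I} {i j : α.I}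
    (v : β.Arrow μ ν) (u : α.Arrow i j) (h : v.g = u.g)
    (lam : HomSp (β.e μ) (σ.functor.obj (α.e i))) :
    σ.bundle.map (arr (𝔜 := β.gerbe) (𝔛 := α.gerbe) (μ := μ) (ν := ν) (i := i) (j := j) v u h)
      lam = HomSp.up (σ.bra v u h lam.down) := σ.braFun_arr v u h lam

theorem bra_nat {σ ρ : TwoRepHom α.toTwoRep β.toTwoRep} (N : TwoRepMod σ ρ) {μ ν : β.I}
    {i j : α.I} (v : β.Arrow μ ν) (u : α.Arrow i j) (h : v.g = u.g)
    (lam : β.e μ ⟶ σ.functor.obj (α.e i)) :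
    σ.bra v u h lam ≫ N.nat.app (α.e j) = ρ.bra v u h (lam ≫ N.nat.app (α.e i)) := by
  have h1 : σ.co v.g (α.e i) ≫ N.nat.app ((α.act v.g).obj (α.e i)) =
    (β.act v.g).map (N.nat.app (α.e i)) ≫ ρ.co v.g (α.e i) := N.comm v.g (α.e i)
  unfold bra
  simp only [Category.assoc]
  rw [N.nat.naturality, reassoc_of% h1, Functor.map_comp_assoc]

/-- Postcomposition with the 2-morphism is inverted by postcomposition with its inverse, and
`bra_nat` makes it equivariant. Isomorphisms of bundles need only be linear on fibres, so unitarity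
of the 2-morphism is not required. -/
theorem bundle_congr {σ ρ : TwoRepHom α.toTwoRep β.toTwoRep} (h : Isomorphic σ ρ) :
    GerbeHom.Isomorphic σ.bundle ρ.bundle := by
  obtain ⟨N, N', h1, h2⟩ := h
  have e1 : ∀ X, N.nat.app X ≫ N'.nat.app X = 𝟙 _ := fun X =>
    congrArg (fun t => NatTrans.app t X) h1
  have e2 : ∀ X, N'.nat.app X ≫ N.nat.app X = 𝟙 _ := fun X =>
    congrArg (fun t => NatTrans.app t X) h2
  let e : ∀ (μ : β.I) (i : α.I), HomSp (β.e μ) (σ.functor.obj (α.e i)) ≃ₗ[ℂ]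
      HomSp (β.e μ) (ρ.functor.obj (α.e i)) := fun μ i =>
    { toFun := fun lam => HomSp.up (lam.down ≫ N.nat.app (α.e i))
      map_add' := fun lam lam' => congrArg HomSp.up (Preadditive.add_comp _ _ _ lam.down lam'.down _)
      map_smul' := fun c lam => congrArg HomSp.up (Linear.smul_comp _ _ _ c lam.down _)
      invFun := fun lam => HomSp.up (lam.down ≫ N'.nat.app (α.e i))
      left_inv := fun lam => congrArg HomSp.up (by
        change (lam.down ≫ N.nat.app (α.e i)) ≫ N'.nat.app (α.e i) = lam.down
        rw [Category.assoc, e1, Category.comp_id])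
      right_inv := fun lam => congrArg HomSp.up (by
        change (lam.down ≫ N'.nat.app (α.e i)) ≫ N.nat.app (α.e i) = lam.down
        rw [Category.assoc, e2, Category.comp_id]) }
  refine GerbeHom.Isomorphic.of_equiv_arr (𝔛 := α.gerbe) (𝔜 := β.gerbe) e
    fun {μ ν i j} v u hd lam => ?_
  refine (congrArg (e ν j) (σ.bundle_map v u hd lam)).trans ?_
  exact (congrArg HomSp.up (bra_nat N v u hd lam.down)).trans (ρ.bundle_map v u hd _).symm

end congr

/-! ### The bundle of the identity morphism. -/

section identity

variable (α : MarkedTwoRep.{v, u} G)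

/-- On unitary morphisms, viewed as arrows of degree one, the action `λ ↦ u* α_g(λ) v` on hom-spaces
is the action `c ↦ v c u⁻¹ = b` on the identity 1-morphism. The unit laws turn the components of `φ`
into the identifications of `α_{1·g}` and `α_{g·1}` with `α_g`. -/
theorem bra_base {i i' j j' : α.I} (c : α.Arrow i j) (hc : c.g = 1) (b : α.Arrow i' j')
    (hb : b.g = 1) (v : α.Arrow j j') (u : α.Arrow i i') (h : v.g = u.g)
    (e : c.comp v = u.comp b) :
    (TwoRepHom.id α.toTwoRep).bra v u h (c.base hc) = b.base hb := by
  obtain ⟨g₁, c, hc'⟩ := c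
  obtain ⟨g₂, b, hb'⟩ := b
  obtain ⟨g, v, hv⟩ := v
  obtain ⟨g', u, hu⟩ := u
  change g₁ = 1 at hc
  change g₂ = 1 at hb
  change g = g' at h
  subst hc hb h
  have e1 : (v ≫ (α.act g).map c ≫ α.mu rfl (α.e i)) ≫
      α.ca ((mul_one g).trans (one_mul g).symm) (α.e i) =
        b ≫ (α.act 1).map u ≫ α.mu rfl (α.e i) := MarkedTwoRep.Arrow.arr_eq e _
  simp only [Category.assoc] at e1
  rw [α.mu_ca] at e1
  have e2 := congrArg (fun t => t ≫ α.ca (one_mul g) (α.e i)) e1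
  simp only [Category.assoc] at e2
  rw [α.mu_ca, α.mu_ca, ← MarkedTwoRep.dag_un_act, MarkedTwoRep.dag_un_naturality] at e2
  change v ≫ (α.act g).map (c ≫ 𝟙 _ ≫ dag (α.un (α.e i))) ≫ 𝟙 _ ≫ 𝟙 _ ≫ dag u =
    b ≫ 𝟙 _ ≫ dag (α.un (α.e i'))
  simp only [Category.id_comp, Functor.map_comp, Category.assoc]
  rw [MarkedTwoRep.act_dag_un, reassoc_of% e2, hu.1, Category.comp_id]

/-- The comparison of `Hom(e j, e i)` with the line of the torsor of arrows `i ⟶ j` of degree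
one. -/
def homToLine (i j : α.gerbe.X) : HomSp (α.e j) (α.e i) →ₗ[ℂ] α.gerbe.Line (1 : G) i j where
  toFun lam := ⟨fun b => ip (MarkedTwoRep.Arrow.base b.1 b.2) lam.down, fun z p q h => by
    obtain ⟨q, hq⟩ := q
    have h' : q = MarkedTwoRep.Arrow.smul z p.1 := h.trans (MarkedTwoRep.circ_comp_eq z p.1)
    subst h'
    change ip (MarkedTwoRep.Arrow.base (MarkedTwoRep.Arrow.smul z p.1) hq) lam.down = _
    rw [MarkedTwoRep.Arrow.base_smul z p.1 p.2, ip_smul_left]⟩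
  map_add' lam lam' := Gerbe.Line.ext fun b => ip_add_right _ lam.down lam'.down
  map_smul' c lam := Gerbe.Line.ext fun b => ip_smul_right c _ lam.down

theorem homToLine_apply {i j : α.gerbe.X} (lam : HomSp (α.e j) (α.e i)) (b : α.gerbe.Tor (1 : G) i j) :
    (homToLine α i j lam).1 b = ip (MarkedTwoRep.Arrow.base b.1 b.2) lam.down := rfl

theorem homToLine_self {i : α.gerbe.X} (lam : HomSp (α.e i) (α.e i)) :
    (homToLine α i i lam).1 ⟨𝟙 i, rfl⟩ = ip (𝟙 (α.e i)) lam.down :=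
  (homToLine_apply α lam ⟨𝟙 i, rfl⟩).trans
    (congrArg (fun t => ip t lam.down) (MarkedTwoRep.Arrow.base_id i))

/-- Schur's lemma: both spaces are zero for `i ≠ j`, and for `i = j` both are lines, on which the
comparison is detected by the identity arrow. -/
theorem homToLine_bijective (i j : α.gerbe.X) : Function.Bijective (homToLine α i j) := by
  by_cases h : i = j
  · subst h
    have : Simple (α.e i) := α.simple i
    constructor
    · rw [← LinearMap.ker_eq_bot, LinearMap.ker_eq_bot']
      intro lam hl
      have h1 := (homToLine_self α lam).symm.trans
        (congrArg (fun F : α.gerbe.Line (1 : G) i i => F.1 ⟨𝟙 i, rfl⟩) hl)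
      have h2 := endo_simple (S := α.e i) lam.down
      rw [h1] at h2
      refine congrArg HomSp.up (h2.symm.trans ?_)
      change ((0 : ℂ) / _) • _ = (0 : α.e i ⟶ α.e i)
      rw [zero_div, zero_smul]
    · intro F
      let c : ℂ := F.1 ⟨𝟙 i, rfl⟩
      refine ⟨HomSp.up ((c / scale (α.e i)) • 𝟙 (α.e i)), sub_eq_zero.1
        (Gerbe.Line.eq_zero_of _ ⟨𝟙 i, rfl⟩ ?_)⟩
      refine sub_eq_zero.2 ((homToLine_self α _).trans ?_)
      change ip (𝟙 (α.e i)) ((c / scale (α.e i)) • 𝟙 (α.e i)) = c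
      rw [ip_smul_right, ip_id_eq_scale, div_mul_cancel₀ _ (scale_ne_zero _)]
  · constructor
    · intro lam lam' _
      exact congrArg HomSp.up ((α.hom_eq_zero (fun e => h e.symm) lam.down).trans
        (α.hom_eq_zero (fun e => h e.symm) lam'.down).symm)
    · intro F
      have := GerbeHom.id_subsingleton (𝔛 := α.gerbe) h
      exact ⟨0, Subsingleton.elim (α := (GerbeHom.id α.gerbe).fib (pt j i)) _ _⟩

theorem bundle_id : GerbeHom.Isomorphic (TwoRepHom.id α.toTwoRep).bundle
    (GerbeHom.id α.gerbe) := by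
  let e : ∀ (j i : α.gerbe.X), HomSp (α.e j) (α.e i) ≃ₗ[ℂ] α.gerbe.Line (1 : G) i j := fun j i =>
    LinearEquiv.ofBijective (homToLine α i j) (homToLine_bijective α i j)
  refine GerbeHom.Isomorphic.of_equiv_arr (𝔛 := α.gerbe) (𝔜 := α.gerbe) e
    fun {j j' i i'} v u hd lam => ?_
  refine (congrArg (e j' i') ((TwoRepHom.id α.toTwoRep).bundle_map v u hd lam)).trans ?_
  refine Eq.trans ?_ (GerbeHom.id_map (𝔛 := α.gerbe) v u hd (homToLine α i j lam)).symm
  refine Gerbe.Line.ext fun b => ?_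
  rw [GerbeHom.idMap_apply]
  have hc : MarkedTwoRep.Arrow.comp (GerbeHom.idTor (𝔛 := α.gerbe) v u hd b).1 v =
      MarkedTwoRep.Arrow.comp u b.1 := by
    change (u ≫ b.1 ≫ Groupoid.inv v) ≫ v = u ≫ b.1
    simp
  -- The test arrow `b` is the image of `v⁻¹ b u` under the same action, so equivariance of the
  -- pairing reduces to the action being isometric.
  have h1 := bra_base α _ (GerbeHom.idTor (𝔛 := α.gerbe) v u hd b).2 b.1 b.2 v u hd hc
  change ip (MarkedTwoRep.Arrow.base b.1 b.2)
      ((TwoRepHom.id α.toTwoRep).bra v u hd lam.down) = _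
  rw [← h1]
  exact (TwoRepHom.id α.toTwoRep).bra_inner v u hd _ _

end identity

/-! ### The bundle of a composite morphism. -/

section composite

variable {α β γ : MarkedTwoRep.{v, u} G} (σ : TwoRepHom α.toTwoRep β.toTwoRep)
  (τ : TwoRepHom β.toTwoRep γ.toTwoRep)

/-- The map `b ⊗ a ↦ τ(a) b`. -/
def tensorComp (κ : γ.I) (μ : β.I) (i : α.I) :
    HomSp (γ.e κ) (τ.functor.obj (β.e μ)) ⊗[ℂ] HomSp (β.e μ) (σ.functor.obj (α.e i)) →ₗ[ℂ]
      HomSp (γ.e κ) (τ.functor.obj (σ.functor.obj (α.e i))) :=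
  TensorProduct.lift (LinearMap.mk₂ ℂ
    (fun b a => HomSp.up (b.down ≫ τ.functor.map a.down))
    (fun b b' a => congrArg HomSp.up (Preadditive.add_comp _ _ _ b.down b'.down _))
    (fun c b a => congrArg HomSp.up (Linear.smul_comp _ _ _ c b.down _))
    (fun b a a' => congrArg HomSp.up (by
      change b.down ≫ τ.functor.map (a.down + a'.down) = _
      rw [τ.linearStar.map_add, Preadditive.comp_add]
      rfl))
    (fun c b a => congrArg HomSp.up (by
      change b.down ≫ τ.functor.map (c • a.down) = _
      rw [τ.linearStar.map_smul, Linear.comp_smul]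
      rfl)))

theorem tensorComp_tmul {κ : γ.I} {μ : β.I} {i : α.I} (b : HomSp (γ.e κ) (τ.functor.obj (β.e μ)))
    (a : HomSp (β.e μ) (σ.functor.obj (α.e i))) :
    tensorComp σ τ κ μ i (b ⊗ₜ a) = HomSp.up (b.down ≫ τ.functor.map a.down) := rfl

/-- The intermediate arrow enters once as `τ(p)*` and once as `τ(p)`, and these cancel because `p`
is unitary. The rest is the naturality of `τ(g)`. -/
theorem bra_comp_eq {κ κ' : γ.I} {μ ν : β.I} {i j : α.I} (v : γ.Arrow κ κ') (p : β.Arrow μ ν)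
    (u : α.Arrow i j) (hv : v.g = p.g) (hu : p.g = u.g)
    (b : γ.e κ ⟶ τ.functor.obj (β.e μ)) (a : β.e μ ⟶ σ.functor.obj (α.e i)) :
    τ.bra v p hv b ≫ τ.functor.map (σ.bra p u hu a) =
      (σ.comp τ).bra v u (hv.trans hu) (b ≫ τ.functor.map a) := by
  obtain ⟨g, v, hv'⟩ := v
  obtain ⟨g₁, p, hp⟩ := p
  obtain ⟨g₂, u, hu'⟩ := u
  change g = g₁ at hv
  change g₁ = g₂ at hu
  subst hv hu
  change (v ≫ (γ.act g).map b ≫ τ.co g _ ≫ τ.functor.map (𝟙 _ ≫ dag p)) ≫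
      τ.functor.map (p ≫ (β.act g).map a ≫ σ.co g _ ≫ σ.functor.map (𝟙 _ ≫ dag u)) =
    v ≫ (γ.act g).map (b ≫ τ.functor.map a) ≫
      (τ.co g _ ≫ τ.functor.map (σ.co g _)) ≫ τ.functor.map (σ.functor.map (𝟙 _ ≫ dag u))
  have h1 : τ.functor.map (dag p) ≫ τ.functor.map p = 𝟙 _ := by
    rw [← Functor.map_comp, hp.2, CategoryTheory.Functor.map_id]
  simp only [Category.id_comp, Functor.map_comp, Category.assoc]
  rw [reassoc_of% h1, ← reassoc_of% τ.co_naturality]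

theorem tensorComp_twist {κ κ' : γ.I} {μ ν : β.I} {i j : α.I} (v : γ.Arrow κ κ')
    (p : β.Arrow μ ν) (u : α.Arrow i j) (hv : v.g = p.g) (hu : p.g = u.g)
    (t : HomSp (γ.e κ) (τ.functor.obj (β.e μ)) ⊗[ℂ] HomSp (β.e μ) (σ.functor.obj (α.e i))) :
    tensorComp σ τ κ' ν j (twist (𝔛 := α.gerbe) (𝔜 := β.gerbe) (𝔷 := γ.gerbe) σ.bundle τ.bundle
      v p u hv hu t) = (σ.comp τ).braMap v u (hv.trans hu) (tensorComp σ τ κ μ i t) := by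
  induction t using TensorProduct.induction_on with
  | zero => exact (congrArg _ (map_zero _)).trans ((map_zero _).trans
      ((congrArg _ (map_zero _)).trans (map_zero _)).symm)
  | add s t hs ht =>
    exact (congrArg _ (map_add _ s t)).trans ((map_add (tensorComp σ τ κ' ν j) _ _).trans
      ((congrArg₂ (· + ·) hs ht).trans ((congrArg _ (map_add (tensorComp σ τ κ μ i) s t)).trans
        (map_add ((σ.comp τ).braMap v u _) _ _)).symm))
  | tmul b a =>
    refine (congrArg₂ (fun b a => tensorComp σ τ κ' ν j (b ⊗ₜ a))
      (τ.bundle_map v p hv b) (σ.bundle_map p u hu a)).trans ?_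
    exact congrArg HomSp.up (bra_comp_eq σ τ v p u hv hu b.down a.down)

/-- The map from `⨁ μ, Hom(e κ, τ (e μ)) ⊗ Hom(e μ, σ (e i))` to `Hom(e κ, τ (σ (e i)))`. -/
def compFwd (κ : γ.I) (i : α.I) :
    (∀ μ : β.I, HomSp (γ.e κ) (τ.functor.obj (β.e μ)) ⊗[ℂ]
      HomSp (β.e μ) (σ.functor.obj (α.e i))) →ₗ[ℂ]
      HomSp (γ.e κ) (τ.functor.obj (σ.functor.obj (α.e i))) :=
  ∑ μ : β.I, tensorComp σ τ κ μ i ∘ₗ LinearMap.proj μ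

theorem compFwd_apply (κ : γ.I) (i : α.I) (x : ∀ μ : β.I,
    HomSp (γ.e κ) (τ.functor.obj (β.e μ)) ⊗[ℂ] HomSp (β.e μ) (σ.functor.obj (α.e i))) :
    compFwd σ τ κ i x = ∑ μ, tensorComp σ τ κ μ i (x μ) := by
  simp [compFwd, LinearMap.sum_apply]

/-- The inverse of `compFwd`. -/
def compBwd (κ : γ.I) (i : α.I) :
    HomSp (γ.e κ) (τ.functor.obj (σ.functor.obj (α.e i))) →ₗ[ℂ]
      ∀ μ : β.I, HomSp (γ.e κ) (τ.functor.obj (β.e μ)) ⊗[ℂ]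
        HomSp (β.e μ) (σ.functor.obj (α.e i)) where
  -- The resolution of the identity of `σ e_i` is inserted after `h`, with its two factors kept
  -- apart by the tensor sign.
  toFun h μ := (scale (β.e μ) : ℂ) • ∑ c, HomSp.up (h.down ≫
      τ.functor.map (dag (onb (β.e μ) (σ.functor.obj (α.e i)) c))) ⊗ₜ[ℂ] HomSp.up (onb _ _ c)
  map_add' h h' := funext fun μ => by
    rw [Pi.add_apply, ← smul_add, ← Finset.sum_add_distrib]
    congr 1
    refine Finset.sum_congr rfl fun c _ => ?_
    rw [← TensorProduct.add_tmul]
    exact congrArg (fun t : HomSp (γ.e κ) (τ.functor.obj (β.e μ)) => t ⊗ₜ[ℂ] HomSp.up (onb (β.e μ) (σ.functor.obj (α.e i)) c))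
      (congrArg HomSp.up (Preadditive.add_comp _ _ _ h.down h'.down _))
  map_smul' c h := funext fun μ => by
    rw [Pi.smul_apply, RingHom.id_apply, smul_comm]
    congr 1
    rw [Finset.smul_sum]
    refine Finset.sum_congr rfl fun d _ => ?_
    rw [TensorProduct.smul_tmul']
    exact congrArg (fun t : HomSp (γ.e κ) (τ.functor.obj (β.e μ)) => t ⊗ₜ[ℂ] HomSp.up (onb (β.e μ) (σ.functor.obj (α.e i)) d))
      (congrArg HomSp.up (Linear.smul_comp _ _ _ c h.down _))

theorem compBwd_apply (κ : γ.I) (i : α.I)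
    (h : HomSp (γ.e κ) (τ.functor.obj (σ.functor.obj (α.e i)))) (μ : β.I) :
    compBwd σ τ κ i h μ = (scale (β.e μ) : ℂ) • ∑ c, HomSp.up (h.down ≫
      τ.functor.map (dag (onb (β.e μ) (σ.functor.obj (α.e i)) c))) ⊗ₜ[ℂ] HomSp.up (onb _ _ c) :=
  rfl

theorem _root_.HomSp.up_sum {H : Type u} [Category.{v} H] [Abelian H] [Linear ℂ H] [TwoHilbert H]
    {X Y : H} {ι : Type*} (s : Finset ι) (f : ι → (X ⟶ Y)) :
    HomSp.up (∑ c ∈ s, f c) = ∑ c ∈ s, HomSp.up (f c) :=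
  map_sum (AddMonoidHom.mk' (HomSp.up : (X ⟶ Y) → HomSp X Y) fun _ _ => rfl) f s

theorem _root_.HomSp.up_smul {H : Type u} [Category.{v} H] [Abelian H] [Linear ℂ H] [TwoHilbert H]
    {X Y : H} (c : ℂ) (f : X ⟶ Y) : HomSp.up (c • f) = c • HomSp.up f := rfl

theorem compFwd_compBwd (κ : γ.I) (i : α.I)
    (h : HomSp (γ.e κ) (τ.functor.obj (σ.functor.obj (α.e i)))) :
    compFwd σ τ κ i (compBwd σ τ κ i h) = h := by
  rw [compFwd_apply]
  have h1 : ∀ μ, tensorComp σ τ κ μ i (compBwd σ τ κ i h μ) =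
      HomSp.up (h.down ≫ τ.functor.map ((scale (β.e μ) : ℂ) • ∑ c,
        dag (onb (β.e μ) (σ.functor.obj (α.e i)) c) ≫ onb _ _ c)) := by
    intro μ
    rw [compBwd_apply, map_smul, map_sum, τ.linearStar.map_smul, τ.linearStar.map_sum,
      Linear.comp_smul, Preadditive.comp_sum, HomSp.up_smul, HomSp.up_sum]
    congr 1
    refine Finset.sum_congr rfl fun c _ => ?_
    rw [tensorComp_tmul]
    refine congrArg HomSp.up ?_
    change (h.down ≫ τ.functor.map _) ≫ τ.functor.map (onb _ _ c) = _
    rw [Category.assoc, ← Functor.map_comp]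
  rw [Finset.sum_congr rfl fun μ _ => h1 μ, ← HomSp.up_sum, ← Preadditive.comp_sum,
    ← τ.linearStar.map_sum, MarkedTwoRep.resolution, CategoryTheory.Functor.map_id,
    Category.comp_id]
  rfl

/-- On `b ⊗ a` in the summand `μ`, the composites of `a` with adjoint basis elements are
endomorphisms of `e_μ`, or maps `e_μ ⟶ e_ν`. The latter vanish; the former are the coordinates of
`a` divided by `k_μ`, which cross the tensor sign to rebuild `a`. -/
theorem compBwd_compFwd (κ : γ.I) (i : α.I) :
    compBwd σ τ κ i ∘ₗ compFwd σ τ κ i = LinearMap.id := by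
  classical
  refine LinearMap.pi_ext' fun μ => TensorProduct.ext' fun b a => ?_
  funext ν
  have h1 : compFwd σ τ κ i (Pi.single μ (b ⊗ₜ a)) =
      HomSp.up (b.down ≫ τ.functor.map a.down) := by
    rw [compFwd_apply, Finset.sum_eq_single μ]
    · rw [Pi.single_eq_same, tensorComp_tmul]
    · intro ν _ hν
      rw [Pi.single_eq_of_ne hν, map_zero]
    · exact fun h => absurd (Finset.mem_univ _) h
  change compBwd σ τ κ i (compFwd σ τ κ i (Pi.single μ (b ⊗ₜ a))) ν =
    (Pi.single μ (b ⊗ₜ a) : ∀ μ : β.I, HomSp (γ.e κ) (τ.functor.obj (β.e μ)) ⊗[ℂ]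
        HomSp (β.e μ) (σ.functor.obj (α.e i))) ν
  rw [h1, compBwd_apply]
  have h2 : ∀ c, (HomSp.up (b.down ≫ τ.functor.map a.down) :
      HomSp (γ.e κ) (τ.functor.obj (σ.functor.obj (α.e i)))).down ≫
      τ.functor.map (dag (onb (β.e ν) (σ.functor.obj (α.e i)) c)) =
      b.down ≫ τ.functor.map (a.down ≫ dag (onb (β.e ν) (σ.functor.obj (α.e i)) c)) := by
    intro c
    rw [Functor.map_comp]
    exact Category.assoc _ _ _
  simp only [h2]
  by_cases hμ : μ = ν
  · subst hμ
    rw [Pi.single_eq_same, Finset.smul_sum]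
    have h3 : a = ∑ c, ip (onb (β.e μ) (σ.functor.obj (α.e i)) c) a.down •
        HomSp.up (onb (β.e μ) (σ.functor.obj (α.e i)) c) :=
      (congrArg HomSp.up (sum_onb a.down).symm).trans (HomSp.up_sum _ _)
    conv_rhs => rw [h3, TensorProduct.tmul_sum]
    refine Finset.sum_congr rfl fun c _ => ?_
    rw [comp_dag_simple, τ.linearStar.map_smul, CategoryTheory.Functor.map_id, Linear.comp_smul,
      Category.comp_id, TensorProduct.tmul_smul, TensorProduct.smul_tmul',
      TensorProduct.smul_tmul']
    congr 1
    refine congrArg HomSp.up ?_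
    change (scale (β.e μ) : ℂ) • (ip (onb _ _ c) a.down / scale (β.e μ)) • b.down = _
    rw [smul_smul, mul_div_cancel₀ _ (scale_ne_zero _)]
    rfl
  · rw [Pi.single_eq_of_ne (Ne.symm hμ)]
    refine smul_eq_zero_of_right _ (Finset.sum_eq_zero fun c _ => ?_)
    have h4 : τ.functor.map (0 : β.e μ ⟶ β.e ν) = 0 := by
      simpa using τ.linearStar.map_smul (0 : ℂ) (0 : β.e μ ⟶ β.e ν)
    rw [β.hom_eq_zero hμ (a.down ≫ dag (onb (β.e ν) (σ.functor.obj (α.e i)) c)), h4, comp_zero]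
    exact TensorProduct.zero_tmul _ _

theorem bundle_comp : GerbeHom.Isomorphic (σ.comp τ).bundle (σ.bundle.comp τ.bundle) := by
  let e : ∀ (κ : γ.I) (i : α.I), (∀ μ : β.I, HomSp (γ.e κ) (τ.functor.obj (β.e μ)) ⊗[ℂ]
      HomSp (β.e μ) (σ.functor.obj (α.e i))) ≃ₗ[ℂ]
      HomSp (γ.e κ) (τ.functor.obj (σ.functor.obj (α.e i))) := fun κ i =>
    LinearEquiv.ofLinearMap (compFwd σ τ κ i) (compBwd σ τ κ i)
      (LinearMap.ext fun h => compFwd_compBwd σ τ κ i h) (compBwd_compFwd σ τ κ i)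
  refine Setoid.symm (α := GerbeHom α.gerbe γ.gerbe) ?_
  refine GerbeHom.Isomorphic.of_equiv_arr (𝔛 := α.gerbe) (𝔜 := γ.gerbe) e
    fun {κ κ' i i'} v u hd x => ?_
  refine Eq.trans ?_ ((σ.comp τ).bundle_map v u hd _).symm
  let y : ∀ μ : β.I, HomSp (γ.e κ') (τ.functor.obj (β.e μ)) ⊗[ℂ]
      HomSp (β.e μ) (σ.functor.obj (α.e i')) := (σ.bundle.comp τ.bundle).map (arr v u hd) x
  refine (compFwd_apply σ τ κ' i' y).trans ?_
  refine Eq.trans ?_ (congrArg ((σ.comp τ).braMap v u hd) (compFwd_apply σ τ κ i x)).symm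
  refine Eq.trans ?_ (map_sum ((σ.comp τ).braMap v u hd) _ _).symm
  -- The component of the image at `ν` comes from the component of `x` at `g⁻¹ ν`, so the sum over
  -- the middle index is reindexed accordingly.
  refine Eq.trans ?_ (Equiv.sum_comp (MulAction.toPerm (MarkedTwoRep.Arrow.g v)⁻¹) _)
  refine Finset.sum_congr rfl fun ν _ => ?_
  obtain ⟨p, hp⟩ := exists_to (𝔜 := β.gerbe) (MarkedTwoRep.Arrow.g v) ν
  have hy : y ν = twist σ.bundle τ.bundle v p u hp.symm (hp.trans hd)
    (x ((MarkedTwoRep.Arrow.g v)⁻¹ • ν)) :=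
    compFun_apply (E := σ.bundle) (E' := τ.bundle) v p u hp.symm (hp.trans hd) x
  exact (congrArg (tensorComp σ τ κ' ν i') hy).trans
    (tensorComp_twist σ τ v p u hp.symm (hp.trans hd) _)

end composite

end TwoRepHom

/-- The associated gerbe as a functor on the homotopy category of marked 2-representations. -/
def gerbeFunctor (G : Type v) [Group G] :
    FunctorOn (C := HoTwoRep.{v, u} G) (D := HoGerbes.{v, max u v} G)
      fun α => ⟨α.rep.gerbe⟩ where
  map {α β} := Quotient.map (fun σ : TwoRepHom α.rep.toTwoRep β.rep.toTwoRep => σ.bundle)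
    fun _ _ h => TwoRepHom.bundle_congr h
  map_id α := Quotient.sound (TwoRepHom.bundle_id α.rep)
  map_comp f g := by
    induction f using Quotient.ind with | _ σ =>
    induction g using Quotient.ind with | _ τ =>
    exact Quotient.sound (TwoRepHom.bundle_comp σ τ)

end

noncomputable section

open TwoHilbert

/-! ### Comparison of the 2-character with the geometric character of the associated gerbe -/

namespace TwoHilbert

variable {H : Type u} [Category.{v} H] [Abelian H] [Linear ℂ H] [TwoHilbert H]

theorem IsFrame.dag {X Y : H} {ι : Type*} [Fintype ι] {p q : ι → (X ⟶ Y)} (h : IsFrame p q) :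
    IsFrame (fun c => TwoHilbert.dag (p c)) (fun c => TwoHilbert.dag (q c)) := by
  intro w
  have h1 := congrArg TwoHilbert.dag (h (TwoHilbert.dag w))
  rw [dag_sum, dag_dag] at h1
  refine Eq.trans (Finset.sum_congr rfl fun c _ => ?_) h1
  rw [dag_smul, ip_conj, ← ip_dag (p c), dag_dag]

/-- A simple object unitarily isomorphic to `Y` makes `Hom(S, Y)` a line. The denominator is the
squared norm of `f`. -/
theorem IsUnitary.smul_eq {S Y : H} [Simple S] {f : S ⟶ Y} (hf : IsUnitary f) (t : S ⟶ Y) :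
    (ip f t / scale S) • f = t := by
  have h := endo_simple (t ≫ TwoHilbert.dag f)
  rw [← TwoHilbert.ip_comp_left, Category.id_comp] at h
  refine hf.dag.cancel_right ?_
  rw [← h, Linear.smul_comp, hf.1]

theorem IsUnitary.ip_self {S Y : H} {f : S ⟶ Y} (hf : IsUnitary f) :
    ip f f = (scale S : ℂ) := by
  rw [← ip_id_eq_scale, ← hf.ip_comp_right, Category.id_comp]

/-- This matches the weight `k_i` in the inner product of the 2-character with the coordinates `(u,
θ_{e_i})` along arrows of the gerbe, and makes `charSec` isometric. -/
theorem IsUnitary.scale_mul_ip {S Y : H} [Simple S] {f : S ⟶ Y} (hf : IsUnitary f)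
    (t t' : S ⟶ Y) : (scale S : ℂ) * ip t t' = (starRingEnd ℂ) (ip f t) * ip f t' := by
  conv_lhs => rw [← hf.smul_eq t]
  rw [ip_smul_left, map_div₀, Complex.conj_ofReal, ← mul_assoc,
    mul_div_cancel₀ _ (scale_ne_zero S)]

end TwoHilbert

variable {G : Type v} [Group G]

namespace UnitaryBundle

/-- A morphism of bundles which is bijective on fibres is an isomorphism. -/
def isoOfBijective {C : Type u} [Groupoid.{v} C] {E F : UnitaryBundle.{v, u, w} C} (T : Hom E F)
    (h : ∀ a, Function.Bijective (T.app a)) : E ≅ F where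
  hom := T
  inv := (⟨fun a => (LinearEquiv.ofBijective (T.app a) (h a)).symm.toLinearMap, fun {a b} f ψ => by
    refine (h b).1 ?_
    refine ((LinearEquiv.ofBijective (T.app b) (h b)).apply_symm_apply _).trans ?_
    refine Eq.trans ?_ (T.naturality f _).symm
    exact congrArg (F.map f) ((LinearEquiv.ofBijective (T.app a) (h a)).apply_symm_apply ψ).symm⟩ :
    Hom F E)
  hom_inv_id := Hom.ext (funext fun a => LinearMap.ext fun ψ =>
    (LinearEquiv.ofBijective (T.app a) (h a)).symm_apply_apply ψ)
  inv_hom_id := Hom.ext (funext fun a => LinearMap.ext fun ψ =>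
    (LinearEquiv.ofBijective (T.app a) (h a)).apply_symm_apply ψ)

end UnitaryBundle

theorem Gerbe.conjTor_comp {𝔛 : Gerbe.{v, w} G} {a b : Loop G 𝔛.X} (f : a ⟶ b)
    (q : 𝔛.Tor b.x b.i b.i) :
    (𝔛.conjTor f q).1 ≫ 𝔛.liftArrow f = 𝔛.liftArrow f ≫ q.1 := by
  change (𝔛.liftArrow f ≫ q.1 ≫ Groupoid.inv (𝔛.liftArrow f)) ≫ 𝔛.liftArrow f = _
  simp

namespace MarkedTwoRep

section

variable {α : MarkedTwoRep.{v, u} G}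

/-- The unitary morphism `e j ⟶ α_g (e i)` given by an arrow over `g`. -/
def Arrow.over {i j : α.I} (f : α.Arrow i j) {g : G} (h : f.g = g) :
    α.e j ⟶ (α.act g).obj (α.e i) := f.arr ≫ α.ca h (α.e i)

theorem Arrow.over_unitary {i j : α.I} (f : α.Arrow i j) {g : G} (h : f.g = g) :
    IsUnitary (f.over h) := f.unitary.comp (TwoRepHom.ca_unitary h _)

theorem Arrow.over_smul {i j : α.I} (z : Circle) (f : α.Arrow i j) {g : G} (h : f.g = g) :
    (f.smul z).over h = (z : ℂ) • f.over h := Linear.smul_comp _ _ _ (z : ℂ) f.arr _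

theorem Arrow.over_conj {i j : α.I} {f : α.Arrow i i} {v : α.Arrow i j} {q : α.Arrow j j}
    (e : f.comp v = v.comp q) {x y c : G} (hf : f.g = x) (hq : q.g = y) (h1 : y * v.g = c)
    (h2 : v.g * x = c) : q.over hq ≫ (α.act y).map v.arr ≫ α.mu h1 (α.e i) =
      v.arr ≫ (α.act v.g).map (f.over hf) ≫ α.mu h2 (α.e i) := by
  subst hf hq h2
  have h3 := Arrow.arr_eq e.symm h1
  change (q.arr ≫ (α.act q.g).map v.arr ≫ α.mu rfl (α.e i)) ≫ α.ca h1 (α.e i) =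
    v.arr ≫ (α.act v.g).map f.arr ≫ α.mu rfl (α.e i) at h3
  unfold Arrow.over
  rw [TwoRep.ca_rfl, TwoRep.ca_rfl, Category.comp_id, Category.comp_id, ← h3]
  simp only [Category.assoc]
  rw [α.mu_ca]

/-- Transporting the arrow and the transformation together along `v` preserves their pairing: after
composition with a unitary map, both arguments on the left become `v` followed by `α_g` of those on
the right and then `φ`, by `over_conj` and `conj_act`. -/
theorem ip_over_conj {i j : α.I} {f : α.Arrow i i} {v : α.Arrow i j} {q : α.Arrow j j}
    (e : f.comp v = v.comp q) {x y : G} (hf : f.g = x) (hq : q.g = y) (h : v.g * x * v.g⁻¹ = y)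
    (θ : α.NatSp x) : ip (q.over hq) ((θ.conj v.g h).at (α.e j)) =
      ip (f.over hf) (θ.at (α.e i)) := by
  have h1 : y * v.g = v.g * x := by rw [← h]; group
  have hu : IsUnitary ((α.act y).map v.arr ≫ α.mu h1 (α.e i)) :=
    ((α.act_linearStar y).map_unitary v.unitary).comp (α.mu_unitary h1 _)
  rw [← hu.ip_comp_right, Arrow.over_conj e hf hq h1 rfl, ← reassoc_of% TwoRep.NatSp.naturality,
    TwoRep.NatSp.conj_act v.g h h1 rfl, v.unitary.ip_comp_left,
    (α.mu_unitary _ _).ip_comp_right, α.act_inner]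

/-- The target is isomorphic to `e_{xi}`, a different simple object. This reduces sums over all
simple objects to sums over fixed points. -/
theorem at_eq_zero {i : α.I} {x : G} (h : x • i ≠ i) (t : α.e i ⟶ (α.act x).obj (α.e i)) :
    t = 0 := by
  obtain ⟨a⟩ := α.smul_iso x i
  rw [← cancel_mono a.hom, zero_comp]
  exact α.hom_eq_zero (Ne.symm h) _

end

/-! ### The unitary isomorphism between the two characters. -/

section

open Gerbe GerbeHom

variable (α : MarkedTwoRep.{v, u} G)

theorem sqrt_scale_ne_zero (i : α.I) : (√(scale (α.e i)) : ℂ) ≠ 0 :=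
  Complex.ofReal_ne_zero.2 (Real.sqrt_pos.2 (scale_pos (α.e i))).ne'

theorem sqrt_scale_mul_self (i : α.I) :
    (√(scale (α.e i)) : ℂ) * (√(scale (α.e i)) : ℂ) = (scale (α.e i) : ℂ) := by
  rw [← Complex.ofReal_mul, Real.mul_self_sqrt (scale_pos (α.e i)).le]

/-- The section of the transgressed line bundle which sends an arrow `u : e i ⟶ α_x (e i)` over
the loop `(i, x)` to `(u, θ_{e i}) / √(k i)`. -/
def charSec (x : G) : α.NatSp x →ₗ[ℂ] Push.Sec α.gerbe.transgression x where
  -- Antilinearity of the inner product in its first variable is exactly the rule `F (z p) = z̄ F p`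
  -- that defines the line of the torsor.
  toFun θ i := (⟨fun u => ip (Arrow.over u.1 u.2) (θ.at (α.e i.1)) / (√(scale (α.e i.1)) : ℂ),
    fun z p q h => by
      obtain ⟨q, hq⟩ := q
      change q = _ at h
      subst h
      refine (congrArg (fun t => ip t (θ.at (α.e i.1)) / (√(scale (α.e i.1)) : ℂ))
        ?_ : _ = ip ((z : ℂ) • Arrow.over p.1 p.2) (θ.at (α.e i.1)) / _).trans ?_
      · refine Eq.trans ?_ (Arrow.over_smul z p.1 p.2)
        congr 1
        exact circ_comp_eq z p.1
      · rw [ip_smul_left, mul_div_assoc]⟩ : α.gerbe.Line x i.1 i.1)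
  map_add' θ θ' := sec_ext (𝔛 := α.gerbe) fun i u =>
    (congrArg (fun t : ℂ => t / (√(scale (α.e i.1)) : ℂ))
      (ip_add_right (Arrow.over u.1 u.2) (θ.at (α.e i.1)) (θ'.at (α.e i.1)))).trans
        (add_div _ _ _)
  map_smul' c θ := sec_ext (𝔛 := α.gerbe) fun i u =>
    (congrArg (fun t : ℂ => t / (√(scale (α.e i.1)) : ℂ))
      (ip_smul_right c (Arrow.over u.1 u.2) (θ.at (α.e i.1)))).trans (mul_div_assoc _ _ _)

theorem charSec_apply {x : G} (θ : α.NatSp x) (i : Push.Fix α.gerbe.X x)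
    (u : α.gerbe.Tor x i.1 i.1) : (secVal (α.charSec x θ) i).1 u =
      ip (Arrow.over u.1 u.2) (θ.at (α.e i.1)) / (√(scale (α.e i.1)) : ℂ) := rfl

theorem charSec_map {x y : LoopGroup G} (f : x ⟶ y) (θ : α.NatSp x.pt) :
    α.charSec y.pt (θ.conj f.g f.conj) = α.gerbe.geomChar.map f (α.charSec x.pt θ) := by
  refine sec_ext (𝔛 := α.gerbe) fun j q => ?_
  refine (α.charSec_apply _ j q).trans ?_
  refine Eq.trans ?_ (secVal_map f (α.charSec x.pt θ) j q).symm
  refine Eq.trans ?_ (α.charSec_apply θ _ _).symm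
  let i := (Push.fixEquiv f).symm j
  have hk : scale (α.e j.1) = scale (α.e i.1) := (α.gerbe.k_smul f.g⁻¹ j.1).symm
  rw [hk]
  congr 1
  obtain ⟨v, hv⟩ : ∃ v : α.gerbe.Tor f.g i.1 j.1, v.1 = α.gerbe.liftArrow (Push.lift f j) :=
    ⟨⟨_, α.gerbe.deg_liftArrow (Push.lift f j)⟩, rfl⟩
  obtain ⟨v, hv'⟩ := v
  change v = _ at hv
  have e : (α.gerbe.conjTor (Push.lift f j) q).1 ≫ v = v ≫ q.1 := by
    rw [hv]
    exact conjTor_comp (Push.lift f j) q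
  have hg : MarkedTwoRep.Arrow.g v * x.pt * (MarkedTwoRep.Arrow.g v)⁻¹ = y.pt := by
    have : MarkedTwoRep.Arrow.g v = f.g := hv'
    rw [this]
    exact f.conj
  refine Eq.trans ?_ (ip_over_conj (v := v) e _ q.2 hg θ)
  congr 2
  -- The degree of the lift `v` equals `f.g` only propositionally, so the conjugation of `θ` has to
  -- be transported along this equality.
  have : ∀ {g : G} (h : g = f.g) (hg : g * x.pt * g⁻¹ = y.pt),
      θ.conj f.g f.conj = θ.conj g hg := by
    intro g h hg
    subst h
    rfl
  exact this hv' hg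

theorem inner_charSec (x : LoopGroup G) (θ θ' : α.NatSp x.pt) :
    inner (E := α.gerbe.geomChar.fib x) ℂ (α.charSec x.pt θ) (α.charSec x.pt θ') =
      inner ℂ θ θ' := by
  refine (inner_geomChar (𝔛 := α.gerbe) _ _ pick).trans ?_
  change _ = ∑ i : α.I, (scale (α.e i) : ℂ) * ip (θ.at (α.e i)) (θ'.at (α.e i))
  refine Fintype.sum_of_injective (fun i : Push.Fix α.gerbe.X x.pt => (i.1 : α.I))
    Subtype.val_injective _ _ (fun i hi => ?_) fun i => ?_
  · have hne : x.pt • i ≠ i := fun h => hi ⟨⟨i, h⟩, rfl⟩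
    rw [at_eq_zero hne (θ'.at (α.e i))]
    have := ip_smul_right (0 : ℂ) (θ.at (α.e i)) 0
    rw [zero_smul, zero_mul] at this
    rw [this, mul_zero]
  · have hu := Arrow.over_unitary (pick i).1 (pick i).2
    have := α.simple i.1
    refine Eq.trans ?_ (hu.scale_mul_ip _ _).symm
    rw [charSec_apply, charSec_apply, map_div₀, Complex.conj_ofReal]
    have hk : ∀ (s a b : ℂ), s ≠ 0 → s * s * (a / s * (b / s)) = a * b := fun s a b hs => by
      field_simp
    exact (congrArg (fun t : ℂ => t * _) (α.sqrt_scale_mul_self i.1).symm).trans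
      (hk _ _ _ (α.sqrt_scale_ne_zero i.1))

theorem charSec_injective (x : LoopGroup G) : Function.Injective (α.charSec x.pt) := by
  rw [← LinearMap.ker_eq_bot, LinearMap.ker_eq_bot']
  intro θ h
  refine inner_self_eq_zero (𝕜 := ℂ) |>.1 ((α.inner_charSec x θ θ).symm.trans ?_)
  refine (congrArg (fun ψ : α.gerbe.geomChar.fib x => inner ℂ ψ ψ) h).trans ?_
  exact inner_zero_left (𝕜 := ℂ) (0 : α.gerbe.geomChar.fib x)

open Classical in
theorem charSec_surjective (x : G) : Function.Surjective (α.charSec x) := by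
  intro ψ
  -- At a fixed point the component must be a multiple of the chosen arrow. That arrow has squared
  -- norm `k_i` and `charSec` divides by `√k_i`, so the coefficient is the value of `ψ` divided by
  -- `√k_i`.
  let a : ∀ i : α.I, α.e i ⟶ (α.act x).obj (α.e i) := fun i =>
    if h : x • i = i then
      ((secVal (𝔛 := α.gerbe) ψ ⟨i, h⟩).1 (pick (𝔛 := α.gerbe) ⟨i, h⟩) / (√(scale (α.e i)) : ℂ)) •
        Arrow.over (pick (𝔛 := α.gerbe) ⟨i, h⟩).1 (pick (𝔛 := α.gerbe) ⟨i, h⟩).2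
    else 0
  let θ : α.NatSp x := casSum (α.act_linearStar x) (fun i => (scale (α.e i) : ℂ)) a
  have hθ : ∀ i, θ.at (α.e i) = a i := casSum_e (α.act_linearStar x) a
  refine ⟨θ, funext fun i => sub_eq_zero.1 (Line.eq_zero_of _ (pick i) (sub_eq_zero.2 ?_))⟩
  have hu := Arrow.over_unitary (pick i).1 (pick i).2
  let c : ℂ := (secVal ψ i).1 (pick i) / (√(scale (α.e i.1)) : ℂ)
  have h1 : θ.at (α.e i.1) = c • Arrow.over (pick i).1 (pick i).2 := (hθ i.1).trans (dif_pos i.2)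
  have h2 : ip (Arrow.over (pick i).1 (pick i).2) (θ.at (α.e i.1)) =
      c * (√(scale (α.e i.1)) * √(scale (α.e i.1))) :=
    (congrArg (ip _) h1).trans ((ip_smul_right _ _ _).trans
      (congrArg (fun t => c * t) (hu.ip_self.trans (α.sqrt_scale_mul_self i.1).symm)))
  have hk : ∀ (s p : ℂ), s ≠ 0 → p / s * (s * s) / s = p := fun s p hs => by
    field_simp
  exact (congrArg (fun t : ℂ => t / (√(scale (α.e i.1)) : ℂ)) h2).trans
    (hk _ _ (α.sqrt_scale_ne_zero i.1))

/-- The isomorphism from the 2-character to the geometric character of the associated gerbe. -/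
def charIso : α.twoChar ≅ α.gerbe.geomChar :=
  UnitaryBundle.isoOfBijective ⟨fun x => α.charSec x.pt, fun f θ => α.charSec_map f θ⟩
    fun x => ⟨α.charSec_injective x, α.charSec_surjective x.pt⟩

end

end MarkedTwoRep

/-! ### Naturality of the comparison. -/

namespace TwoRepHom

open GerbeHom

variable {α β : MarkedTwoRep.{v, u} G} (σ : TwoRepHom α.toTwoRep β.toTwoRep)

theorem bra_over {μ ν : β.I} {i j : α.I} (v : β.Arrow μ ν) (u : α.Arrow i j) {x : G}
    (hv : v.g = x) (hu : u.g = x) (lam : β.e μ ⟶ σ.functor.obj (α.e i)) :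
    σ.bra v u (hv.trans hu.symm) lam = v.over hv ≫ (β.act x).map lam ≫ σ.co x (α.e i) ≫
      σ.functor.map (dag (u.over hu)) := by
  obtain ⟨g, v, hv'⟩ := v
  obtain ⟨g', u, hu'⟩ := u
  change g = x at hv
  change g' = x at hu
  subst hv hu
  change v ≫ _ ≫ _ ≫ σ.functor.map (𝟙 _ ≫ dag u) =
    (v ≫ 𝟙 _) ≫ _ ≫ _ ≫ σ.functor.map (dag (u ≫ 𝟙 _))
  rw [Category.id_comp, Category.comp_id, Category.comp_id]

/-- Expand the trace over an orthonormal basis `b` of `Hom(e_μ, σ e_i)`. Conjugation exchanges the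
two arguments of the inner product, and everything except `u'` moves to the second slot, giving `b_c
≫ σ(u) ≫ σ(x)* ≫ β_x(b_c*)`. Since the `b_c*` form a frame of `Hom(σ e_i, e_μ)`, the sum is a value
of `cas`. This accounts for the complex conjugate in the definition of `ch(E)`. -/
theorem conj_loopTrace {x : G} {μ : β.I} {i : α.I} (u' : β.gerbe.Tor x μ μ)
    (u : α.gerbe.Tor x i i) : (starRingEnd ℂ) (σ.bundle.loopTrace u' u) =
      ip (MarkedTwoRep.Arrow.over u'.1 u'.2) (cas (β.act x)
        (σ.functor.map (MarkedTwoRep.Arrow.over u.1 u.2) ≫ dag (σ.co x (α.e i))) (β.e μ)) := by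
  have h1 : σ.bundle.loopTrace u' u = ∑ c, ip (onb (β.e μ) (σ.functor.obj (α.e i)) c)
      (σ.bra u'.1 u.1 (u'.2.trans u.2.symm) (onb _ _ c)) := by
    refine (LinearMap.trace_eq_sum_inner (E := HomSp (β.e μ) (σ.functor.obj (α.e i))) _
      (stdOrthonormalBasis ℂ _)).trans ?_
    refine Finset.sum_congr rfl fun c _ => ?_
    exact congrArg (fun t : HomSp (β.e μ) (σ.functor.obj (α.e i)) =>
      ip (onb (β.e μ) (σ.functor.obj (α.e i)) c) t.down) (σ.bundle_map u'.1 u.1 _ _)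
  rw [h1, map_sum, cas_eq (β.act_linearStar x) _ (onb_isFrame (β.e μ) _).dag, ip_sum_right]
  refine Finset.sum_congr rfl fun c _ => ?_
  rw [ip_conj, σ.bra_over u'.1 u.1 u'.2 u.2, TwoHilbert.ip_comp_left]
  congr 1
  simp only [dag_comp, dag_dag, Category.assoc]
  rw [σ.linearStar.map_dag, dag_dag, (β.act_linearStar x).map_dag]

/-- Terms with `x i ≠ i` vanish. At a fixed point `θ_{e_i}` is `(u, θ_{e_i}) / k_i` times the arrow
`u`, so the summand of `χ(σ)` becomes a multiple of the conjugate trace in `conj_loopTrace`. In both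
sums its coefficient is `(u, θ_{e_i}) / √k_μ`: on one side `k_i` cancels the denominator, on the
other `√k_i` does. -/
theorem charSec_naturality {x : G} (θ : α.NatSp x) :
    β.charSec x (σ.charNat x θ) = σ.bundle.chMap x (α.charSec x θ) := by
  refine sec_ext (𝔛 := β.gerbe) fun μ u' => ?_
  refine (β.charSec_apply _ μ u').trans ?_
  refine Eq.trans ?_ (σ.bundle.chMap_apply (α.charSec x θ) μ u' pick).symm
  rw [charNat_at, ip_sum_right, Finset.sum_div]
  symm
  refine Fintype.sum_of_injective (fun i : Push.Fix α.gerbe.X x => (i.1 : α.I))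
    Subtype.val_injective _ _ (fun i hi => ?_) fun i => ?_
  · have hne : x • i ≠ i := fun h => hi ⟨⟨i, h⟩, rfl⟩
    have h0 : σ.through θ (α.e i) = 0 := by
      unfold through
      rw [MarkedTwoRep.at_eq_zero hne (θ.at (α.e i))]
      have := σ.linearStar.map_smul (0 : ℂ) (0 : α.e i ⟶ (α.act x).obj (α.e i))
      rw [zero_smul, zero_smul] at this
      rw [this, zero_comp]
    have h2 : cas (β.act x) (0 : σ.functor.obj (α.e i) ⟶ _) (β.e μ.1) = 0 :=
      Finset.sum_eq_zero fun c _ => by rw [zero_comp, comp_zero]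
    rw [h0, h2, smul_zero]
    have := ip_smul_right (0 : ℂ) (MarkedTwoRep.Arrow.over u'.1 u'.2) 0
    rw [zero_smul, zero_mul] at this
    rw [this, zero_div]
  · have := α.simple i.1
    have hu := MarkedTwoRep.Arrow.over_unitary (pick i).1 (pick i).2
    have h1 : σ.through θ (α.e i.1) =
        (ip (MarkedTwoRep.Arrow.over (pick i).1 (pick i).2) (θ.at (α.e i.1)) / scale (α.e i.1)) •
          (σ.functor.map (MarkedTwoRep.Arrow.over (pick i).1 (pick i).2) ≫
            dag (σ.co x (α.e i.1))) := by
      unfold through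
      conv_lhs => rw [← hu.smul_eq (θ.at (α.e i.1))]
      rw [σ.linearStar.map_smul, Linear.smul_comp]
    have h2 : ∀ (c : ℂ) (a : σ.functor.obj (α.e i.1) ⟶ (β.act x).obj (σ.functor.obj (α.e i.1))),
        cas (β.act x) (c • a) (β.e μ.1) = c • cas (β.act x) a (β.e μ.1) := fun c a => by
      unfold cas
      rw [Finset.smul_sum]
      refine Finset.sum_congr rfl fun d _ => ?_
      rw [Linear.smul_comp, Linear.comp_smul]
    rw [h1, h2, ip_smul_right, ip_smul_right]
    refine (congrArg (fun t => ((√(scale (α.e i.1)) / √(scale (β.e μ.1)) : ℝ) : ℂ) *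
      (ip (MarkedTwoRep.Arrow.over (pick i).1 (pick i).2) (θ.at (α.e i.1)) /
        (√(scale (α.e i.1)) : ℂ) * t)) (σ.conj_loopTrace u' (pick i))).trans ?_
    rw [Complex.ofReal_div]
    have h3 := α.sqrt_scale_ne_zero i.1
    have h4 := β.sqrt_scale_ne_zero μ.1
    have h5 := scale_ne_zero (α.e i.1)
    field_simp

end TwoRepHom

end

/-! ### Assembly of the three functors and the natural isomorphism. -/

theorem mainTheorem1 {G : Type v} [Group G] [Finite G] :
    ∃ (χ : FunctorOn (C := HoTwoRep.{v, u} G) (D := HilbG.{v, max u v} G)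
          fun α => α.rep.twoChar)
      (Q : FunctorOn (C := HoTwoRep.{v, u} G) (D := HoGerbes.{v, max u v} G)
          fun α => ⟨α.rep.gerbe⟩)
      (ch : FunctorOn (C := HoGerbes.{v, max u v} G) (D := HilbG.{v, max u v} G)
          fun 𝔛 => 𝔛.gerbe.geomChar),
      -- `χ` on morphisms: every `σ` has an even-handed adjoint, and `χ(σ)` is given by the string
      -- diagram formula for any such adjoint
      (∀ (α β : HoTwoRep.{v, u} G) (σ : TwoRepHom α.rep.toTwoRep β.rep.toTwoRep),
        Nonempty (EvenHandedAdj σ.functor)) ∧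
      (∀ (α β : HoTwoRep.{v, u} G) (σ : TwoRepHom α.rep.toTwoRep β.rep.toTwoRep)
        (A : EvenHandedAdj σ.functor) (x : LoopGroup G) (θ : α.rep.NatSp x.pt),
        (χ.map (HoTwoRep.mk_hom σ)).app x θ = σ.charMap A x.pt θ) ∧
      -- the passage from 2-representations to gerbes on morphisms
      (∀ (α β : HoTwoRep.{v, u} G) (σ : TwoRepHom α.rep.toTwoRep β.rep.toTwoRep),
        Q.map (HoTwoRep.mk_hom σ) = HoGerbes.mk_hom σ.bundle) ∧
      -- `ch` on morphisms: the matrix elements of `ch(E)` are the complex conjugates of traces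
      (∀ (𝔛 𝔜 : HoGerbes.{v, max u v} G) (E : GerbeHom 𝔛.gerbe 𝔜.gerbe) (x : LoopGroup G)
        (i : Push.Fix 𝔛.gerbe.X x.pt) (μ : Push.Fix 𝔜.gerbe.X x.pt)
        (u : 𝔛.gerbe.Tor x.pt i.1 i.1) (u' : 𝔜.gerbe.Tor x.pt μ.1 μ.1),
        inner ℂ (Gerbe.locSec μ u') ((ch.map (HoGerbes.mk_hom E)).app x (Gerbe.locSec i u)) =
          (starRingEnd ℂ) (LinearMap.trace ℂ (E.fib (GerbeHom.pt μ.1 i.1))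
            (E.map (GerbeHom.arr u'.1 u.1 (u'.2.trans u.2.symm))).toLinearMap)) ∧
      -- the triangle commutes up to a unitary natural isomorphism
      ∃ γ : χ.toFunctor ≅ Q.toFunctor ⋙ ch.toFunctor,
        ∀ (α : HoTwoRep.{v, u} G) (x : LoopGroup G) (θ θ' : α.rep.NatSp x.pt),
          inner ℂ ((γ.hom.app α).app x θ) ((γ.hom.app α).app x θ') = inner ℂ θ θ' := by
  refine ⟨twoCharFunctor G, gerbeFunctor G, geomCharFunctor G,
    fun α β σ => MarkedTwoRep.exists_evenHandedAdj σ.linearStar,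
    fun α β σ A x θ => (σ.charMap_eq A x.pt θ).symm, fun α β σ => rfl,
    fun 𝔛 𝔜 E x i μ u u' => E.inner_chMap i μ u u',
    NatIso.ofComponents (fun α => α.rep.charIso) fun {α β} f => ?_,
    fun α x θ θ' => α.rep.inner_charSec x θ θ'⟩
  induction f using Quotient.ind with | _ σ =>
  exact UnitaryBundle.Hom.ext (funext fun x => LinearMap.ext fun θ => σ.charSec_naturality θ)
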